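/- **Setting.** Consider the monadic $\pi$-calculus with processes $P,Q ::= \mathbf 0 \mid \nu x.P \mid P\parallel Q \mid M \mid {!M}$, choices $M ::= M+M \mid \pi.P$ and prefixes $\pi ::= a(x)\mid \overline a\langle b\rangle\mid\tau$, taken up to $\alpha$-conversion. Structural congruence $\equiv$ is the least congruence making $+$ and $\parallel$ associative and commutative, with $\mathbf 0$ neutral for $\parallel$, and containing $\nu a.\mathbf 0\equiv\mathbf 0$, $\nu a.\nu b.P\equiv\nu b.\nu a.P$, $!M\equiv M\parallel {!M}$ and $P\parallel\nu a.Q\equiv\nu a.(P\parallel Q)$ for $a\notin\mathrm{fn}(P)$. Normal forms are the terms $\nu x_1\cdots\nu x_n.(A_1\parallel\dots\parallel A_m)$ with each $A_i$ of the form $\sum_j\pi_j.N_j$ or $!\sum_j\pi_j.N_j$ and all $N_j$ in normal form; $\mathrm{nf}(P)\equiv P$ is obtained by pulling out restrictions. $P\to Q$ holds if $P\equiv\nu W.(S\parallel R\parallel C)$ (a normal form) with $S=(\overline a\langle b\rangle.\nu Y_s.S')+M_s$, $R=(a(x).\nu Y_r.R')+M_r$ ($M_s$, $M_r$ may be absent)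 and $Q\equiv\nu W Y_sY_r.(S'\parallel R'\{x\mapsto b\}\parallel C)$, or if $P\equiv\nu W.(\tau.\nu Y.P'\parallel C)$ (a normal form) and $Q\equiv\nu WY.(P'\parallel C)$. $Q$ is *reachable* from $P$ if $P\to^*Q$. **Hierarchical terms.** Let $\mathcal T$ be a finite forest of base types, $<$ its strict ancestor order. Annotated terms carry types on restrictions, $\nu(x:\tau)$, where every type $\tau$ has a base type $\mathrm{base}(\tau)\in\mathcal T$; $\equiv$ preserves annotations, and $\to$ preserves them except that the restrictions $Y_s,Y_r,Y$ activated by a step may be re-annotated arbitrarily. The forest of a term has a node for each active restriction (labelled by its base type) and a leaf for each active sequential process. An annotated term is $\mathcal T$-compatible if some congruent term has a forest in which, along every path ending in a sequential process, base types strictly increase; it is $\mathcal T$-shaped if all its subterms are $\mathcal T$-compatible. $P$ is *hierarchical* if for some finite forest $\mathcal T$ (base types serving as types) there are an annotation $P'$ of $P$ and a function choosing, for every annotated term $R'$ reached by the choices from $P'$ and every transition $\mathrm{erase}(R')\to Q$, an annotation $Q'$ of $Q$ with $R'\to Q'$, such that all annotated terms so reached are $\mathcal T$-compatible. **Typably hierarchical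 terms.** Types are $\tau::=t\mid t[\tau]$ with $t\in\mathcal T$, $\mathrm{base}(t)=\mathrm{base}(t[\tau])=t$; an environment $\Gamma$ is a partial map from names to types. In $\nu X.\prod_i A_i$, $A_i$ and $A_j$ are linked if they share a free name from $X$; "tied" is the reflexive-transitive closure of "linked", and a name $y$ is tied to $A_i$ if $y\in\mathrm{fn}(A_j)$ for some $A_j$ tied to $A_i$. Normal forms are typed by the following rules. $\Gamma\vdash\nu X.\prod_iA_i$ if $\Gamma,X\vdash A_i$ for all $i$ and, whenever $(x:\tau)\in X$ is tied to $A_i$, $\mathrm{base}(\Gamma(y))<\mathrm{base}(\tau)$ for every $y\in\mathrm{fn}(A_i)\cap\mathrm{dom}(\Gamma)$. A choice is typed if its summands are, $!M$ if $M$ is, $\tau.P$ if $P$ is. $\Gamma\vdash\overline a\langle b\rangle.Q$ if $\Gamma(a)=t[\sigma]$, $\Gamma(b)=\sigma$ and $\Gamma\vdash Q$. $\Gamma\vdash a(x).\nu X.\prod_iA_i$ if $\Gamma(a)=t[\sigma]$, $\Gamma,x:\sigma\vdash\nu X.\prod_iA_i$, and either $\mathrm{base}(\sigma)<t$ or, for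 every $A_i$ to which $x$ is tied, $\mathrm{base}(\Gamma(y))<t$ for all $y\in(\mathrm{fn}(A_i)\setminus\{a\})\cap\mathrm{dom}(\Gamma)$. $P$ is *typably hierarchical* if for some finite forest $\mathcal T$ there are an annotation $P'$ of $\mathrm{nf}(P)$ that is $\mathcal T$-shaped and an environment $\Gamma$ such that $\Gamma\vdash P'$ and $\mathrm{base}(\Gamma(x))<\mathrm{base}(\tau)$ for all $x\in\mathrm{fn}(P')\cap\mathrm{dom}(\Gamma)$ and all annotations $\tau$ of restrictions in $P'$. **Encoding.** A Minsky machine with $k$ counters is a list of instructions $I_1,\dots,I_n$, each $\mathtt{inc}\ i\ j$ (increment counter $i$, go to $I_j$) or $\mathtt{dec}\ i\ j_1\ j_2$ (if counter $i$ is positive, decrement it and go to $I_{j_1}$, otherwise go to $I_{j_2}$); a configuration consists of the counter values $r_1,\dots,r_k$ and the current instruction $j$. Write $c.P$ for $c(x).P$ and $\overline c.P$ for $\nu x.\overline c\langle x\rangle.P$, and $\overline c.P+\overline d.Q$ for $\nu x.(\overline c\langle x\rangle.P+\overline d\langle x\rangle.Q)$, with $x$ fresh; a trailing $.\mathbf 0$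 is omitted. For pairwise distinct names $p_i,\mathrm{inc}_i,\mathrm{dec}_i,\mathrm{rst}_i,\ell_m$ let $$C_i={!}\bigl(p_i(t).(\mathrm{inc}_i.(\overline t\parallel\overline{p_i}\langle t\rangle)+\mathrm{dec}_i.t.\overline{p_i}\langle t\rangle+\mathrm{rst}_i.\nu t'.\overline{p_i}\langle t'\rangle)\bigr),$$ let $P_{I_m}={!(\ell_m.\overline{\mathrm{inc}_i}.\overline{\ell_j})}$ if $I_m=\mathtt{inc}\ i\ j$, and $P_{I_m}={!(\ell_m.(\overline{\mathrm{dec}_i}.\overline{\ell_{j_1}}+\overline{\mathrm{rst}_i}.\overline{\ell_{j_2}}))}$ if $I_m=\mathtt{dec}\ i\ j_1\ j_2$. The encoding of the configuration $c=(r_1,\dots,r_k;j)$ of the machine $M$ is $$[\![c]\!]_M=\prod_{i=1}^k\nu t_i.\bigl(\overline{p_i}\langle t_i\rangle\parallel\overline{t_i}^{\,r_i}\bigr)\parallel\prod_{i=1}^kC_i\parallel\overline{\ell_j}\parallel\prod_{m=1}^nP_{I_m}.$$ **Theorem.** 1. For every Minsky machine $M$ and every configuration $c$ of $M$, the term $[\![c]\!]_M$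 is typably hierarchical and hierarchical. 2. For all configurations $c,d$ of a Minsky machine $M$: $d$ is reachable from $c$ in $M$ if and only if $[\![d]\!]_M$ is reachable from $[\![c]\!]_M$. 3. The reachability problem is undecidable for typably hierarchical terms, and it is undecidable for hierarchical terms: no partial recursive function of (the Gödel numbers of) two terms $P,Q$ answers correctly whether $Q$ is reachable from $P$ for all typably hierarchical $P$ and all $Q$; likewise for all hierarchical $P$ and all $Q$. -/

import Mathlib

/-! # The π-calculus, hierarchical terms, the type system, and Minsky machines

Names are natural numbers and binders are handled by de Bruijn indices: below `d` binders the index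
`i < d` refers to the binder that is `i` levels up, and the index `a + d` to the free name `a`.
Hence α-convertible terms are equal, and name clashes do not exist. -/

namespace PiCalc

/-! ## Syntax -/

/-- Prefixes: input `a(x)` (which binds index `0` in its continuation), output `a⟨b⟩`, and `τ`. -/
inductive Pre : Type
  | inp (a : ℕ) : Pre
  | out (a b : ℕ) : Pre
  | tau : Pre

mutual
/-- Processes whose restrictions `ν(x : τ)` carry an annotation `τ : α`. The restriction `res`
binds index `0`. A replication is applied to a choice only. -/
inductive Proc (α : Type) : Type
  | nil : Proc α
  | res (τ : α) (P : Proc α) : Proc α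
  | par (P Q : Proc α) : Proc α
  | sum (M : Choice α) : Proc α
  | bang (M : Choice α) : Proc α
/-- Choices: nonempty sums of prefixed processes. -/
inductive Choice (α : Type) : Type
  | pre (π : Pre) (P : Proc α) : Choice α
  | plus (M N : Choice α) : Choice α
end

/-- Ordinary terms: the annotations carry no information. -/
abbrev PiTerm : Type := Proc Unit

mutual
/-- Change every annotation by a function. -/
def Proc.mapAnn {α β : Type} (g : α → β) : Proc α → Proc β
  | .nil => .nil
  | .res τ P => .res (g τ) (Proc.mapAnn g P)
  | .par P Q => .par (Proc.mapAnn g P) (Proc.mapAnn g Q)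
  | .sum M => .sum (Choice.mapAnn g M)
  | .bang M => .bang (Choice.mapAnn g M)
def Choice.mapAnn {α β : Type} (g : α → β) : Choice α → Choice β
  | .pre π P => .pre π (Proc.mapAnn g P)
  | .plus M N => .plus (Choice.mapAnn g M) (Choice.mapAnn g N)
end

/-- Type erasure. `P'` is an annotation of `P` when `P'.erase = P`. -/
def Proc.erase {α : Type} (P : Proc α) : PiTerm := P.mapAnn (fun _ => ())

/-! ## Renaming, substitution, free names -/

/-- A renaming, pushed below one binder. -/
def lift (f : ℕ → ℕ) : ℕ → ℕ
  | 0 => 0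
  | i + 1 => f i + 1

/-- A renaming, pushed below `n` binders. -/
def liftN (n : ℕ) (f : ℕ → ℕ) : ℕ → ℕ := lift^[n] f

def Pre.rename (f : ℕ → ℕ) : Pre → Pre
  | .inp a => .inp (f a)
  | .out a b => .out (f a) (f b)
  | .tau => .tau

/-- The renaming that applies to the continuation of a prefix. -/
def Pre.under (f : ℕ → ℕ) : Pre → ℕ → ℕ
  | .inp _ => lift f
  | .out _ _ => f
  | .tau => f

mutual
/-- Simultaneous (capture-avoiding) renaming of the free names; `f` need not be injective. -/
def Proc.rename {α : Type} (f : ℕ → ℕ) : Proc α → Proc α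
  | .nil => .nil
  | .res τ P => .res τ (Proc.rename (lift f) P)
  | .par P Q => .par (Proc.rename f P) (Proc.rename f Q)
  | .sum M => .sum (Choice.rename f M)
  | .bang M => .bang (Choice.rename f M)
def Choice.rename {α : Type} (f : ℕ → ℕ) : Choice α → Choice α
  | .pre π P => .pre (π.rename f) (Proc.rename (π.under f) P)
  | .plus M N => .plus (Choice.rename f M) (Choice.rename f N)
end

/-- Weakening: view a term below one additional (unused) binder. -/
def Proc.shift {α : Type} (P : Proc α) : Proc α := P.rename Nat.succ

/-- The renaming behind the substitution of `b` for the variable of the outermost binder. -/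
def inst (b : ℕ) : ℕ → ℕ
  | 0 => b
  | i + 1 => i

/-- `P.subst b` is `P{x ↦ b}`, where `x` is the variable with index `0`. -/
def Proc.subst {α : Type} (b : ℕ) (P : Proc α) : Proc α := P.rename (inst b)

/-- Exchange the two innermost binders. -/
def swap01 : ℕ → ℕ
  | 0 => 1
  | 1 => 0
  | i + 2 => i + 2

mutual
/-- Free names. -/
def Proc.fn {α : Type} : Proc α → Set ℕ
  | .nil => ∅
  | .res _ P => {x | x + 1 ∈ Proc.fn P}
  | .par P Q => Proc.fn P ∪ Proc.fn Q
  | .sum M => Choice.fn M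
  | .bang M => Choice.fn M
def Choice.fn {α : Type} : Choice α → Set ℕ
  | .pre (.inp a) P => {a} ∪ {x | x + 1 ∈ Proc.fn P}
  | .pre (.out a b) P => {a, b} ∪ Proc.fn P
  | .pre .tau P => Proc.fn P
  | .plus M N => Choice.fn M ∪ Choice.fn N
end

mutual
/-- The annotations of all (active or inactive) restrictions. -/
def Proc.anns {α : Type} : Proc α → Set α
  | .nil => ∅
  | .res τ P => {τ} ∪ Proc.anns P
  | .par P Q => Proc.anns P ∪ Proc.anns Q
  | .sum M => Choice.anns M
  | .bang M => Choice.anns M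
def Choice.anns {α : Type} : Choice α → Set α
  | .pre _ P => Proc.anns P
  | .plus M N => Choice.anns M ∪ Choice.anns N
end

/-! ## Structural congruence -/

mutual
/-- Structural congruence: the least congruence with the laws below. -/
inductive Proc.Cong {α : Type} : Proc α → Proc α → Prop
  | refl (P : Proc α) : Proc.Cong P P
  | symm {P Q : Proc α} : Proc.Cong P Q → Proc.Cong Q P
  | trans {P Q R : Proc α} : Proc.Cong P Q → Proc.Cong Q R → Proc.Cong P R
  | res {P Q : Proc α} (τ : α) : Proc.Cong P Q → Proc.Cong (.res τ P) (.res τ Q)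
  | par {P P' Q Q' : Proc α} :
      Proc.Cong P P' → Proc.Cong Q Q' → Proc.Cong (.par P Q) (.par P' Q')
  | sum {M N : Choice α} : Choice.Cong M N → Proc.Cong (.sum M) (.sum N)
  | bang {M N : Choice α} : Choice.Cong M N → Proc.Cong (.bang M) (.bang N)
  | par_comm (P Q : Proc α) : Proc.Cong (.par P Q) (.par Q P)
  | par_assoc (P Q R : Proc α) : Proc.Cong (.par (.par P Q) R) (.par P (.par Q R))
  | par_nil (P : Proc α) : Proc.Cong (.par P .nil) P
  | res_nil (τ : α) : Proc.Cong (.res τ .nil) .nil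
  | res_swap (σ τ : α) (P : Proc α) :
      Proc.Cong (.res σ (.res τ P)) (.res τ (.res σ (P.rename swap01)))
  | unfold (M : Choice α) : Proc.Cong (.bang M) (.par (.sum M) (.bang M))
  | extrude (τ : α) (P Q : Proc α) :
      Proc.Cong (.par P (.res τ Q)) (.res τ (.par P.shift Q))
inductive Choice.Cong {α : Type} : Choice α → Choice α → Prop
  | refl (M : Choice α) : Choice.Cong M M
  | symm {M N : Choice α} : Choice.Cong M N → Choice.Cong N M
  | trans {M N O : Choice α} : Choice.Cong M N → Choice.Cong N O → Choice.Cong M O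
  | pre {P Q : Proc α} (π : Pre) : Proc.Cong P Q → Choice.Cong (.pre π P) (.pre π Q)
  | plus {M M' N N' : Choice α} :
      Choice.Cong M M' → Choice.Cong N N' → Choice.Cong (.plus M N) (.plus M' N')
  | plus_comm (M N : Choice α) : Choice.Cong (.plus M N) (.plus N M)
  | plus_assoc (M N O : Choice α) :
      Choice.Cong (.plus (.plus M N) O) (.plus M (.plus N O))
end

/-! ## Normal forms -/

/-- `ν x₁. ⋯ ν xₙ. P`; the last entry of the list is the innermost restriction. -/
def resList {α : Type} : List α → Proc α → Proc α
  | [], P => P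
  | τ :: X, P => .res τ (resList X P)

/-- `A₁ ∥ ⋯ ∥ Aₘ`, which is `0` for the empty list and `A₁` for `m = 1`. -/
def parList {α : Type} : List (Proc α) → Proc α
  | [] => .nil
  | [A] => A
  | A :: B :: L => .par A (parList (B :: L))

/-- Sequential processes. -/
def Proc.IsSeq {α : Type} : Proc α → Prop
  | .sum _ => True
  | .bang _ => True
  | _ => False

mutual
/-- Normal forms `ν x₁ ⋯ xₙ. (A₁ ∥ ⋯ ∥ Aₘ)`, hereditarily below prefixes. -/
inductive IsNF {α : Type} : Proc α → Prop
  | mk (X : List α) (L : List (Proc α)) :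
      (∀ A ∈ L, IsNFSeq A) → IsNF (resList X (parList L))
inductive IsNFSeq {α : Type} : Proc α → Prop
  | sum {M : Choice α} : IsNFChoice M → IsNFSeq (.sum M)
  | bang {M : Choice α} : IsNFChoice M → IsNFSeq (.bang M)
inductive IsNFChoice {α : Type} : Choice α → Prop
  | pre (π : Pre) {P : Proc α} : IsNF P → IsNFChoice (.pre π P)
  | plus {M N : Choice α} : IsNFChoice M → IsNFChoice N → IsNFChoice (.plus M N)
end

mutual
/-- The list of restrictions and the list of sequential processes of the normal form. -/
def Proc.nfData {α : Type} : Proc α → List α × List (Proc α)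
  | .nil => ([], [])
  | .res τ P => (τ :: (Proc.nfData P).1, (Proc.nfData P).2)
  | .par P Q =>
      ((Proc.nfData P).1 ++ (Proc.nfData Q).1,
        (Proc.nfData P).2.map (Proc.rename (· + (Proc.nfData Q).1.length)) ++
        (Proc.nfData Q).2.map
          (Proc.rename (liftN (Proc.nfData Q).1.length (· + (Proc.nfData P).1.length))))
  | .sum M => ([], [.sum (Choice.nf M)])
  | .bang M => ([], [.bang (Choice.nf M)])
def Choice.nf {α : Type} : Choice α → Choice α
  | .pre π P => .pre π (resList (Proc.nfData P).1 (parList (Proc.nfData P).2))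
  | .plus M N => .plus (Choice.nf M) (Choice.nf N)
end

/-- The normal form of a term. -/
def Proc.nf {α : Type} (P : Proc α) : Proc α := resList P.nfData.1 (parList P.nfData.2)

/-! ## Reduction semantics -/

/-- `M + M'`, where the second summand may be absent. -/
def Choice.plusOpt {α : Type} (M : Choice α) : Option (Choice α) → Choice α
  | none => M
  | some N => .plus M N

/-- Reduction. The restrictions `Ys`, `Yr`, `Y` activated by a step may get other annotations
`Ys'`, `Yr'`, `Y'`; for `α = Unit` the lists are necessarily equal, and this is the reduction of
ordinary terms. Up to scope extrusion, `ν W. (ν Ys. S' ∥ (ν Yr. R'){x ↦ b} ∥ C)` is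
`ν W Ys Yr. (S' ∥ R'{x ↦ b} ∥ C)`. -/
inductive Step {α : Type} : Proc α → Proc α → Prop
  | comm {P Q : Proc α} (W Ys Yr Ys' Yr' : List α) (S R C : List (Proc α))
      (Ms Mr : Option (Choice α)) (a b : ℕ)
      (hP : P.Cong (resList W (parList
        (.sum (Choice.plusOpt (.pre (.out a b) (resList Ys (parList S))) Ms) ::
         .sum (Choice.plusOpt (.pre (.inp a) (resList Yr (parList R))) Mr) :: C))))
      (hnf : IsNF (resList W (parList
        (.sum (Choice.plusOpt (.pre (.out a b) (resList Ys (parList S))) Ms) ::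
         .sum (Choice.plusOpt (.pre (.inp a) (resList Yr (parList R))) Mr) :: C))))
      (hs : Ys'.length = Ys.length) (hr : Yr'.length = Yr.length)
      (hQ : Q.Cong (resList W (.par (resList Ys' (parList S))
        (.par ((resList Yr' (parList R)).subst b) (parList C))))) :
      Step P Q
  | tau {P Q : Proc α} (W Y Y' : List α) (S C : List (Proc α))
      (hP : P.Cong (resList W (parList (.sum (.pre .tau (resList Y (parList S))) :: C))))
      (hnf : IsNF (resList W (parList (.sum (.pre .tau (resList Y (parList S))) :: C))))
      (hy : Y'.length = Y.length)
      (hQ : Q.Cong (resList W (.par (resList Y' (parList S)) (parList C)))) :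
      Step P Q

/-- `Q` is reachable from `P`. -/
def Reach (P Q : PiTerm) : Prop := Relation.ReflTransGen Step P Q

/-! ## Hierarchies and compatibility -/

/-- A finite forest of base types. -/
structure Hierarchy where
  Base : Type
  finite : Finite Base
  /-- `parent s t`: `s` is the parent of `t`. -/
  parent : Base → Base → Prop
  parent_unique : ∀ r s t, parent r t → parent s t → r = s
  acyclic : ∀ t, ¬ Relation.TransGen parent t t

/-- The strict order of the forest: `s` is a proper ancestor of `t`. -/
def Hierarchy.lt (T : Hierarchy) : T.Base → T.Base → Prop := Relation.TransGen T.parent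

/-- Labelled forests, generated from the empty forest by disjoint union and by `l[φ]`. -/
inductive LForest (L : Type) : Type
  | empty : LForest L
  | union (φ ψ : LForest L) : LForest L
  | node (l : L) (φ : LForest L) : LForest L

/-- Traces of the nonempty paths that start at a root. -/
inductive LForest.RootTrace {L : Type} : LForest L → List L → Prop
  | here (l : L) (φ : LForest L) : RootTrace (.node l φ) [l]
  | cons (l : L) {φ : LForest L} {w : List L} : RootTrace φ w → RootTrace (.node l φ) (l :: w)
  | left {φ : LForest L} (ψ : LForest L) {w : List L} : RootTrace φ w → RootTrace (.union φ ψ) w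
  | right (φ : LForest L) {ψ : LForest L} {w : List L} : RootTrace ψ w → RootTrace (.union φ ψ) w

/-- Traces of all nonempty paths. -/
inductive LForest.Trace {L : Type} : LForest L → List L → Prop
  | root {φ : LForest L} {w : List L} : RootTrace φ w → Trace φ w
  | sub (l : L) {φ : LForest L} {w : List L} : Trace φ w → Trace (.node l φ) w
  | left {φ : LForest L} (ψ : LForest L) {w : List L} : Trace φ w → Trace (.union φ ψ) w
  | right (φ : LForest L) {ψ : LForest L} {w : List L} : Trace ψ w → Trace (.union φ ψ) w

/-- The forest of a term. A restriction is labelled with the base type of its annotation (its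
bound name is the node itself), a sequential process with itself. -/
def Proc.forest {α β : Type} (base : α → β) : Proc α → LForest (β ⊕ Proc α)
  | .nil => .empty
  | .res τ P => .node (.inl (base τ)) (Proc.forest base P)
  | .par P Q => .union (Proc.forest base P) (Proc.forest base Q)
  | .sum M => .node (.inr (.sum M)) .empty
  | .bang M => .node (.inr (.bang M)) .empty

/-- The forests that represent the congruence class of `P`. -/
def Proc.forests {α β : Type} (base : α → β) (P : Proc α) : Set (LForest (β ⊕ Proc α)) :=
  {φ | ∃ Q : Proc α, Q.Cong P ∧ φ = Q.forest base}

/-- Along every trace `t₁ ⋯ tₖ A` the base types increase strictly. -/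
def Hierarchy.CompatForest (T : Hierarchy) {S : Type} (φ : LForest (T.Base ⊕ S)) : Prop :=
  ∀ (ts : List T.Base) (A : S), φ.Trace (ts.map Sum.inl ++ [Sum.inr A]) → ts.IsChain T.lt

/-- `T`-compatibility of an annotated term. -/
def Hierarchy.Compat (T : Hierarchy) {α : Type} (base : α → T.Base) (P : Proc α) : Prop :=
  ∃ φ ∈ P.forests base, T.CompatForest φ

/-- `Subterm Q P`: the process `Q` is a subterm of `P`. -/
inductive Subterm {α : Type} : Proc α → Proc α → Prop
  | refl (P : Proc α) : Subterm P P
  | res {Q P : Proc α} (τ : α) : Subterm Q P → Subterm Q (.res τ P)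
  | left {Q P : Proc α} (R : Proc α) : Subterm Q P → Subterm Q (.par P R)
  | right {Q P : Proc α} (R : Proc α) : Subterm Q P → Subterm Q (.par R P)
  | bang {Q : Proc α} {M : Choice α} : Subterm Q (.sum M) → Subterm Q (.bang M)
  | plusLeft {Q : Proc α} {M : Choice α} (N : Choice α) :
      Subterm Q (.sum M) → Subterm Q (.sum (.plus M N))
  | plusRight {Q : Proc α} {M : Choice α} (N : Choice α) :
      Subterm Q (.sum M) → Subterm Q (.sum (.plus N M))
  | pre {Q P : Proc α} (π : Pre) : Subterm Q P → Subterm Q (.sum (.pre π P))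

/-- A term is `T`-shaped if each of its subterms is `T`-compatible. -/
def Hierarchy.Shaped (T : Hierarchy) {α : Type} (base : α → T.Base) (P : Proc α) : Prop :=
  ∀ Q : Proc α, Subterm Q P → T.Compat base Q

/-! ## Hierarchical terms -/

/-- The transition system on annotated terms given by a function `δ` that chooses, for an
annotated term `R'` and a transition `erase R' → Q`, an annotated term `δ R' Q`. -/
def AnnStep {α : Type} (δ : Proc α → PiTerm → Proc α) (R' Q' : Proc α) : Prop :=
  ∃ Q : PiTerm, Step R'.erase Q ∧ Q' = δ R' Q

/-- `P'` with the choice function `δ` is a consistent annotation of the semantics of `P`: `P'` is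
an annotation of `P` and, from every annotated term `R'` that the choices lead to, each transition
`erase R' → Q` is lifted to a transition `R' → Q'` with `Q'` an annotation of `Q`. -/
def ConsistentAnn {α : Type} (P : PiTerm) (P' : Proc α) (δ : Proc α → PiTerm → Proc α) : Prop :=
  P'.erase = P ∧
  ∀ R' : Proc α, Relation.ReflTransGen (AnnStep δ) P' R' →
    ∀ Q : PiTerm, Step R'.erase Q → (δ R' Q).erase = Q ∧ Step R' (δ R' Q)

/-- Hierarchical terms. Types are base types here. -/
def Hierarchical (P : PiTerm) : Prop :=
  ∃ (T : Hierarchy) (P' : Proc T.Base) (δ : Proc T.Base → PiTerm → Proc T.Base),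
    ConsistentAnn P P' δ ∧
    ∀ R' : Proc T.Base, Relation.ReflTransGen (AnnStep δ) P' R' → T.Compat id R'

/-! ## The type system -/

/-- Types `t` and `t[τ]` over the base types `B`. -/
inductive Ty (B : Type) : Type
  | atom (t : B) : Ty B
  | chan (t : B) (τ : Ty B) : Ty B

def Ty.base {B : Type} : Ty B → B
  | .atom t => t
  | .chan t _ => t

/-- Typing environments: partial maps from names to types. -/
abbrev Env (B : Type) : Type := ℕ → Option (Ty B)

/-- Extension by a type for a new innermost bound name. -/
def Env.cons {B : Type} (Γ : Env B) (τ : Ty B) : Env B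
  | 0 => some τ
  | i + 1 => Γ i

/-- The environment below the restrictions `X` of `resList X P`. -/
def Env.extend {B : Type} (Γ : Env B) : List (Ty B) → Env B
  | [] => Γ
  | τ :: X => Env.extend (Γ.cons τ) X

/-- In `ν X. ∏ Aᵢ` with `n` restrictions, `Aᵢ` is linked to `Aⱼ`: they share a name of `X`. -/
def Linked {α : Type} (n : ℕ) (L : List (Proc α)) (i j : Fin L.length) : Prop :=
  ∃ x < n, x ∈ (L.get i).fn ∧ x ∈ (L.get j).fn

/-- `Aᵢ` is tied to `Aⱼ`. -/
def Tied {α : Type} (n : ℕ) (L : List (Proc α)) (i j : Fin L.length) : Prop :=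
  Relation.ReflTransGen (Linked n L) i j

/-- The name `y` is tied to `Aᵢ`. -/
def NameTied {α : Type} (n : ℕ) (L : List (Proc α)) (y : ℕ) (i : Fin L.length) : Prop :=
  ∃ j : Fin L.length, y ∈ (L.get j).fn ∧ Tied n L j i

/-- `Aᵢ` is migratable in `a(y). ν X. ∏ Aᵢ` with `n` restrictions: inside, `y` has index `n`. -/
def Migratable {α : Type} (n : ℕ) (L : List (Proc α)) (i : Fin L.length) : Prop :=
  NameTied n L n i

mutual
/-- Typing of normal forms over the hierarchy `T`. -/
inductive TyProc (T : Hierarchy) : Env T.Base → Proc (Ty T.Base) → Prop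
  | par (Γ : Env T.Base) (X : List (Ty T.Base)) (L : List (Proc (Ty T.Base)))
      (hA : ∀ A ∈ L, TySeq T (Γ.extend X) A)
      (hX : ∀ (i : Fin L.length) (x : ℕ) (σ : Ty T.Base),
        x < X.length → Γ.extend X x = some σ → NameTied X.length L x i →
        ∀ (y : ℕ) (ρ : Ty T.Base), y + X.length ∈ (L.get i).fn → Γ y = some ρ →
          T.lt ρ.base σ.base) :
      TyProc T Γ (resList X (parList L))
inductive TySeq (T : Hierarchy) : Env T.Base → Proc (Ty T.Base) → Prop
  | sum (Γ : Env T.Base) (M : Choice (Ty T.Base)) (hM : TyChoice T Γ M) : TySeq T Γ (.sum M)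
  | bang (Γ : Env T.Base) (M : Choice (Ty T.Base)) (hM : TyChoice T Γ M) : TySeq T Γ (.bang M)
inductive TyChoice (T : Hierarchy) : Env T.Base → Choice (Ty T.Base) → Prop
  | plus (Γ : Env T.Base) (M N : Choice (Ty T.Base))
      (hM : TyChoice T Γ M) (hN : TyChoice T Γ N) : TyChoice T Γ (.plus M N)
  | tau (Γ : Env T.Base) (P : Proc (Ty T.Base)) (hP : TyProc T Γ P) :
      TyChoice T Γ (.pre .tau P)
  | out (Γ : Env T.Base) (a b : ℕ) (t : T.Base) (σ : Ty T.Base) (P : Proc (Ty T.Base))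
      (ha : Γ a = some (.chan t σ)) (hb : Γ b = some σ) (hP : TyProc T Γ P) :
      TyChoice T Γ (.pre (.out a b) P)
  | inp (Γ : Env T.Base) (a : ℕ) (t : T.Base) (σ : Ty T.Base)
      (X : List (Ty T.Base)) (L : List (Proc (Ty T.Base)))
      (ha : Γ a = some (.chan t σ)) (hL : ∀ A ∈ L, A.IsSeq)
      (hP : TyProc T (Γ.cons σ) (resList X (parList L)))
      (hmig : T.lt σ.base t ∨
        ∀ i : Fin L.length, Migratable X.length L i →
          ∀ (y : ℕ) (ρ : Ty T.Base), y ≠ a → y + 1 + X.length ∈ (L.get i).fn → Γ y = some ρ →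
            T.lt ρ.base t) :
      TyChoice T Γ (.pre (.inp a) (resList X (parList L)))
end

/-- `Γ` is `P`-safe. -/
def Safe (T : Hierarchy) (Γ : Env T.Base) (P : Proc (Ty T.Base)) : Prop :=
  ∀ x ∈ P.fn, ∀ σ : Ty T.Base, Γ x = some σ → ∀ τ ∈ P.anns, T.lt σ.base τ.base

/-- Typably hierarchical terms: for some hierarchy, some annotation `P'` of the normal form is
`T`-shaped and typable in a `P'`-safe environment. -/
def TypablyHierarchical (P : PiTerm) : Prop :=
  ∃ (T : Hierarchy) (P' : Proc (Ty T.Base)) (Γ : Env T.Base),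
    P'.erase = P.nf ∧ Safe T Γ P' ∧ T.Shaped Ty.base P' ∧ TyProc T Γ P'

/-! ## The reachability problem -/

def Pre.code : Pre → ℕ
  | .tau => 0
  | .inp a => 2 * a + 1
  | .out a b => 2 * Nat.pair a b + 2

mutual
/-- A Gödel numbering of terms. -/
def Proc.code : Proc Unit → ℕ
  | .nil => 0
  | .res _ P => 4 * Proc.code P + 1
  | .par P Q => 4 * Nat.pair (Proc.code P) (Proc.code Q) + 2
  | .sum M => 4 * Choice.code M + 3
  | .bang M => 4 * Choice.code M + 4
def Choice.code : Choice Unit → ℕ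
  | .pre π P => 2 * Nat.pair π.code (Proc.code P)
  | .plus M N => 2 * Nat.pair (Choice.code M) (Choice.code N) + 1
end

theorem Pre.code_inj : ∀ {π ρ : Pre}, π.code = ρ.code → π = ρ
  | .tau, .tau, _ => rfl
  | .tau, .inp _, h => by simp only [Pre.code] at h; omega
  | .tau, .out _ _, h => by simp only [Pre.code] at h; omega
  | .inp _, .tau, h => by simp only [Pre.code] at h; omega
  | .inp a, .inp b, h => by
      simp only [Pre.code] at h
      have : a = b := by omega
      rw [this]
  | .inp _, .out _ _, h => by simp only [Pre.code] at h; omega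
  | .out _ _, .tau, h => by simp only [Pre.code] at h; omega
  | .out _ _, .inp _, h => by simp only [Pre.code] at h; omega
  | .out a b, .out c d, h => by
      simp only [Pre.code] at h
      have h' : Nat.pair a b = Nat.pair c d := by omega
      obtain ⟨h1, h2⟩ := Nat.pair_eq_pair.1 h'
      rw [h1, h2]

mutual
/-- Distinct terms have distinct numbers. -/
theorem Proc.code_inj : ∀ (P Q : Proc Unit), P.code = Q.code → P = Q
  | .nil, Q, h => by
      cases Q <;> simp only [Proc.code] at h <;> first | rfl | omega
  | .res _ P, Q, h => by
      cases Q with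
      | res _ Q =>
          simp only [Proc.code] at h
          rw [Proc.code_inj P Q (by omega)]
      | _ => simp only [Proc.code] at h; omega
  | .par P P', Q, h => by
      cases Q with
      | par Q Q' =>
          simp only [Proc.code] at h
          have h' : Nat.pair P.code P'.code = Nat.pair Q.code Q'.code := by omega
          obtain ⟨h1, h2⟩ := Nat.pair_eq_pair.1 h'
          rw [Proc.code_inj P Q h1, Proc.code_inj P' Q' h2]
      | _ => simp only [Proc.code] at h; omega
  | .sum M, Q, h => by
      cases Q with
      | sum N =>
          simp only [Proc.code] at h
          rw [Choice.code_inj M N (by omega)]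
      | _ => simp only [Proc.code] at h; omega
  | .bang M, Q, h => by
      cases Q with
      | bang N =>
          simp only [Proc.code] at h
          rw [Choice.code_inj M N (by omega)]
      | _ => simp only [Proc.code] at h; omega
theorem Choice.code_inj : ∀ (M N : Choice Unit), M.code = N.code → M = N
  | .pre π P, N, h => by
      cases N with
      | pre ρ Q =>
          simp only [Choice.code] at h
          have h' : Nat.pair π.code P.code = Nat.pair ρ.code Q.code := by omega
          obtain ⟨h1, h2⟩ := Nat.pair_eq_pair.1 h'
          rw [Pre.code_inj h1, Proc.code_inj P Q h2]
      | plus _ _ => simp only [Choice.code] at h; omega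
  | .plus M M', N, h => by
      cases N with
      | pre _ _ => simp only [Choice.code] at h; omega
      | plus N N' =>
          simp only [Choice.code] at h
          have h' : Nat.pair M.code M'.code = Nat.pair N.code N'.code := by omega
          obtain ⟨h1, h2⟩ := Nat.pair_eq_pair.1 h'
          rw [Choice.code_inj M N h1, Choice.code_inj M' N' h2]
end

/-- The reachability problem is decidable for the class `K`: some partial recursive function
answers the question "is `Q` reachable from `P`?" correctly, for all terms `P` in `K` and all
terms `Q` (its behaviour on other inputs, including divergence, is arbitrary). -/
def ReachabilityDecidableFor (K : PiTerm → Prop) : Prop :=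
  ∃ f : ℕ →. Bool, Partrec f ∧
    ∀ P Q : PiTerm, K P →
      (Reach P Q → true ∈ f (Nat.pair P.code Q.code)) ∧
      (¬ Reach P Q → false ∈ f (Nat.pair P.code Q.code))

/-! ## Minsky machines -/

/-- Instructions of a machine with `k` counters and `n` instructions. -/
inductive Instr (k n : ℕ) : Type
  | inc (i : Fin k) (j : Fin n) : Instr k n
  | dec (i : Fin k) (j₁ j₂ : Fin n) : Instr k n

/-- Minsky machines with `k` counters and the instructions `I₀, …, Iₙ₋₁`. -/
abbrev Machine (k n : ℕ) : Type := Fin n → Instr k n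

/-- Configurations: the values of the counters and the current instruction. -/
structure Config (k n : ℕ) where
  reg : Fin k → ℕ
  pc : Fin n

inductive Machine.Step {k n : ℕ} (M : Machine k n) : Config k n → Config k n → Prop
  | inc (c : Config k n) (i : Fin k) (j : Fin n) (h : M c.pc = .inc i j) :
      Machine.Step M c ⟨Function.update c.reg i (c.reg i + 1), j⟩
  | decPos (c : Config k n) (i : Fin k) (j₁ j₂ : Fin n) (h : M c.pc = .dec i j₁ j₂)
      (hpos : 0 < c.reg i) :
      Machine.Step M c ⟨Function.update c.reg i (c.reg i - 1), j₁⟩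
  | decZero (c : Config k n) (i : Fin k) (j₁ j₂ : Fin n) (h : M c.pc = .dec i j₁ j₂)
      (hzero : c.reg i = 0) :
      Machine.Step M c ⟨c.reg, j₂⟩

def Machine.Reach {k n : ℕ} (M : Machine k n) (c d : Config k n) : Prop :=
  Relation.ReflTransGen (Machine.Step M) c d

/-! ## The encoding of Minsky machines -/

/-- The free names of the encoding; they are pairwise distinct. -/
def nP (i : ℕ) : ℕ := 5 * i
def nInc (i : ℕ) : ℕ := 5 * i + 1
def nDec (i : ℕ) : ℕ := 5 * i + 2
def nRst (i : ℕ) : ℕ := 5 * i + 3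
def nLoc (m : ℕ) : ℕ := 5 * m + 4

/-- Nullary input `c.P`, i.e. `c(x).P` with `x` not free in `P`. -/
def inZ (c : ℕ) (P : PiTerm) : Choice Unit := .pre (.inp c) P.shift

/-- Nullary output, i.e. `ν x. c⟨x⟩.P` with `x` not free in `P`. -/
def outZ (c : ℕ) (P : PiTerm) : PiTerm := .res () (.sum (.pre (.out (c + 1) 0) P.shift))

/-- The choice of two nullary outputs, i.e. `ν x. (c⟨x⟩.P + d⟨x⟩.Q)` with `x` not free in
`P`, `Q`. -/
def outZ2 (c : ℕ) (P : PiTerm) (d : ℕ) (Q : PiTerm) : PiTerm :=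
  .res () (.sum (.plus (.pre (.out (c + 1) 0) P.shift) (.pre (.out (d + 1) 0) Q.shift)))

/-- The message `a⟨b⟩`. -/
def msg (a b : ℕ) : PiTerm := .sum (.pre (.out a b) .nil)

/-- The resettable counter
`! p(t). ( inc.(t̄ ∥ p⟨t⟩) + dec.(t.p⟨t⟩) + rst.(ν t'. p⟨t'⟩) )`.
In the body of the input, `t` has index `0`. -/
def counter (i : ℕ) : PiTerm :=
  .bang (.pre (.inp (nP i)) (.sum
    (.plus (inZ (nInc i + 1) (.par (outZ 0 .nil) (msg (nP i + 1) 0)))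
    (.plus (inZ (nDec i + 1) (.sum (inZ 0 (msg (nP i + 1) 0))))
           (inZ (nRst i + 1) (.res () (msg (nP i + 2) 0)))))))

/-- The encoding of the instruction with number `m`. -/
def encInstr {k n : ℕ} (m : Fin n) : Instr k n → PiTerm
  | .inc i j => .bang (inZ (nLoc m) (outZ (nInc i) (outZ (nLoc j) .nil)))
  | .dec i j₁ j₂ => .bang (inZ (nLoc m)
      (outZ2 (nDec i) (outZ (nLoc j₁) .nil) (nRst i) (outZ (nLoc j₂) .nil)))

/-- A counter cell with value `r`, i.e. `ν t. (p⟨t⟩ ∥ t̄ ∥ ⋯ ∥ t̄)` with `r` copies of `t̄`. -/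
def cell (i r : ℕ) : PiTerm :=
  .res () (.par (msg (nP i + 1) 0) (parList (List.replicate r (outZ 0 .nil))))

/-- The (garbage-free) encoding of a configuration of the machine `M`. -/
def encode {k n : ℕ} (M : Machine k n) (c : Config k n) : PiTerm :=
  .par (parList (List.ofFn fun i : Fin k => cell i (c.reg i)))
  (.par (parList (List.ofFn fun i : Fin k => counter i))
  (.par (outZ (nLoc c.pc) .nil)
        (parList (List.ofFn fun m : Fin n => encInstr m (M m)))))

end PiCalc

-- Processes modulo structural congruence as a commutative monoid with operators

namespace PiCalc

/-! ## Renamings -/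

-- The encoding of a machine is weak: nothing forces a conditional decrement to choose the right
-- branch. It may reset a counter that is positive, or request a decrement of a counter that is
-- zero. Both mistakes leave a permanent trace. A wrong reset abandons the tokens of the old cell
-- below a restriction where nobody listens, and a wrong decrement leaves the cell waiting for a
-- token that never comes. The encoding of a configuration shows neither trace, so a run that ends
-- exactly there has made no mistake. Reachability of an exact term is therefore faithful, although
-- single reductions are not.
--
-- To make this precise, the reducts of an encoding are described by the combinatorial transition
-- system `EncState`. That its steps are reductions (`EncState.Step.red`, `Red.step`) is a
-- calculation in the commutative monoid of congruence classes. Conversely, `Step` speaks of an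
-- arbitrary congruent normal form and cannot be inverted directly. Instead, labelled transitions
-- are defined by recursion on syntax, with congruence classes as derivatives; congruent terms have
-- literally the same transitions (`Proc.Cong.sameTransitions`), every reduction is an internal
-- transition (`Step.tau_q`), and those of a state are found by inspecting its components
-- (`EncState.step_of_tau`). A state must also be recovered from its congruence class: weights in
-- `ℕ∞` that respect all laws of congruence read off the modes, counter values, location and total
-- garbage (`EncState.eq_of_enc_eq`). The absence of traces is then transported backwards along a
-- run, and the run projects to a run of the machine (`EncState.Step.live`, `reach_encode_iff`).
--
-- For hierarchical annotations, the annotation of a restriction is computed from the plain term by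
-- a rule that respects congruence (`Proc.Cong.annotate`): cell names get a type `t`, names of
-- nullary messages a type `x` with `t < x`. The choice function simply annotates the target
-- canonically, and every reachable term has a representative with at most a `t` above an `x`
-- (`hierarchical_encode`). For typability, a chain of four base types orders requests and locations
-- below counter channels, these below cell names, and these below message names; the conditions on
-- tied names then reduce to comparisons in this chain (`typablyHierarchical_encode`).
--
-- For undecidability, primitive recursive functions are compiled to structured counter programs
-- (`compiles_of_primrec'`), an unbounded search is put on top (`exists_search`), and the program
-- becomes a machine whose locations are the programs that can remain (`exists_machine`). One fixed
-- machine searches for the number of steps after which a given code halts on input `0` and then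
-- clears its counters. Since the encoding of its start configuration has a code that is primitive
-- recursive in the input, a decision procedure for reachability would solve the halting problem.

@[simp] theorem lift_zero (f : ℕ → ℕ) : lift f 0 = 0 := rfl
@[simp] theorem lift_succ (f : ℕ → ℕ) (i : ℕ) : lift f (i + 1) = f i + 1 := rfl

theorem lift_comp (f g : ℕ → ℕ) : lift f ∘ lift g = lift (f ∘ g) := by
  funext i; cases i <;> rfl

theorem lift_id : lift id = id := by
  funext i; cases i <;> rfl

theorem Pre.rename_rename (f g : ℕ → ℕ) (π : Pre) :
    (π.rename g).rename f = π.rename (f ∘ g) := by cases π <;> rfl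

theorem Pre.under_comp (f g : ℕ → ℕ) (π : Pre) :
    (π.rename g).under f ∘ π.under g = π.under (f ∘ g) := by
  cases π <;> simp [Pre.under, Pre.rename, lift_comp]

mutual
theorem Proc.rename_rename {α : Type} (f g : ℕ → ℕ) :
    ∀ P : Proc α, (P.rename g).rename f = P.rename (f ∘ g)
  | .nil => rfl
  | .res τ P => by
      simp only [Proc.rename]; rw [Proc.rename_rename, lift_comp]
  | .par P Q => by
      simp only [Proc.rename]; rw [Proc.rename_rename f g P, Proc.rename_rename f g Q]
  | .sum M => by simp only [Proc.rename]; rw [Choice.rename_rename f g M]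
  | .bang M => by simp only [Proc.rename]; rw [Choice.rename_rename f g M]
theorem Choice.rename_rename {α : Type} (f g : ℕ → ℕ) :
    ∀ M : Choice α, (M.rename g).rename f = M.rename (f ∘ g)
  | .pre π P => by
      simp only [Choice.rename]
      rw [Proc.rename_rename, Pre.under_comp, Pre.rename_rename]
  | .plus M N => by
      simp only [Choice.rename]; rw [Choice.rename_rename f g M, Choice.rename_rename f g N]
end

theorem Pre.under_id (π : Pre) : π.under id = id := by
  cases π <;> simp [Pre.under, lift_id]

theorem Pre.rename_id (π : Pre) : π.rename id = π := by cases π <;> rfl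

mutual
theorem Proc.rename_id {α : Type} : ∀ P : Proc α, P.rename id = P
  | .nil => rfl
  | .res τ P => by simp only [Proc.rename]; rw [lift_id, Proc.rename_id P]
  | .par P Q => by simp only [Proc.rename]; rw [Proc.rename_id P, Proc.rename_id Q]
  | .sum M => by simp only [Proc.rename]; rw [Choice.rename_id M]
  | .bang M => by simp only [Proc.rename]; rw [Choice.rename_id M]
theorem Choice.rename_id {α : Type} : ∀ M : Choice α, M.rename id = M
  | .pre π P => by
      simp only [Choice.rename]; rw [Pre.under_id, Proc.rename_id P, Pre.rename_id]
  | .plus M N => by simp only [Choice.rename]; rw [Choice.rename_id M, Choice.rename_id N]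
end

theorem lift_comp_succ (f : ℕ → ℕ) : lift f ∘ Nat.succ = Nat.succ ∘ f := rfl

theorem inst_comp_lift (f : ℕ → ℕ) (b : ℕ) : inst (f b) ∘ lift f = f ∘ inst b := by
  funext i; cases i <;> rfl

theorem swap01_comp_swap01 : swap01 ∘ swap01 = id := by
  funext i; rcases i with _ | _ | i <;> rfl

theorem swap01_comp_lift_lift (f : ℕ → ℕ) :
    swap01 ∘ lift (lift f) = lift (lift f) ∘ swap01 := by
  funext i; rcases i with _ | _ | i <;> rfl

theorem swap01_injective : Function.Injective swap01 :=
  Function.LeftInverse.injective (g := swap01) (congrFun swap01_comp_swap01)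

theorem lift_injective {f : ℕ → ℕ} (hf : Function.Injective f) : Function.Injective (lift f) := by
  intro i j h
  cases i <;> cases j <;> simp_all
  exact hf h

/-! ## Congruence and renaming -/

/-- No injectivity is needed, because binders are never affected by a renaming of free names. This
matters: substitution is the non-injective renaming `inst b`, and it has to act on congruence
classes. -/
theorem Proc.Cong.rename {α : Type} {P Q : Proc α} (h : P.Cong Q) :
    ∀ f : ℕ → ℕ, (P.rename f).Cong (Q.rename f) := by
  refine Proc.Cong.rec (motive_1 := fun P Q _ => ∀ f, (P.rename f).Cong (Q.rename f))
    (motive_2 := fun M N _ => ∀ f, (M.rename f).Cong (N.rename f))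
    ?_ ?_ ?_ ?_ ?_ ?_ ?_ ?_ ?_ ?_ ?_ ?_ ?_ ?_ ?_ ?_ ?_ ?_ ?_ ?_ ?_ h
  · exact fun P f => .refl _
  · exact fun _ ih f => (ih f).symm
  · exact fun _ _ ih ih' f => (ih f).trans (ih' f)
  · exact fun τ _ ih f => .res τ (ih _)
  · exact fun _ _ ih ih' f => .par (ih f) (ih' f)
  · exact fun _ ih f => .sum (ih f)
  · exact fun _ ih f => .bang (ih f)
  · exact fun P Q f => .par_comm _ _
  · exact fun P Q R f => .par_assoc _ _ _
  · exact fun P f => .par_nil _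
  · exact fun τ f => .res_nil _
  · intro σ τ P f
    have := Proc.Cong.res_swap σ τ (P.rename (lift (lift f)))
    rw [Proc.rename_rename, swap01_comp_lift_lift, ← Proc.rename_rename] at this
    exact this
  · exact fun M f => .unfold _
  · intro τ P Q f
    have := Proc.Cong.extrude τ (P.rename f) (Q.rename (lift f))
    rw [Proc.shift, Proc.rename_rename, ← lift_comp_succ, ← Proc.rename_rename] at this
    exact this
  · exact fun P f => .refl _
  · exact fun _ ih f => (ih f).symm
  · exact fun _ _ ih ih' f => (ih f).trans (ih' f)
  · exact fun π _ ih f => .pre _ (ih _)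
  · exact fun _ _ ih ih' f => .plus (ih f) (ih' f)
  · exact fun P Q f => .plus_comm _ _
  · exact fun P Q R f => .plus_assoc _ _ _

/-! ## Processes modulo structural congruence -/

instance Proc.setoid (α : Type) : Setoid (Proc α) :=
  ⟨Proc.Cong, ⟨.refl, .symm, .trans⟩⟩

/-- Processes modulo structural congruence. -/
def ProcQ (α : Type) : Type := Quotient (Proc.setoid α)

/-- The congruence class of a process. -/
def Proc.q {α : Type} (P : Proc α) : ProcQ α := Quotient.mk _ P

theorem Proc.q_eq {α : Type} {P Q : Proc α} : P.q = Q.q ↔ P.Cong Q := Quotient.eq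

theorem ProcQ.ind {α : Type} {p : ProcQ α → Prop} (h : ∀ P : Proc α, p P.q) (x : ProcQ α) : p x :=
  Quotient.inductionOn x h

instance (α : Type) : Add (ProcQ α) :=
  ⟨Quotient.map₂ Proc.par fun _ _ h _ _ h' => .par h h'⟩

instance (α : Type) : Zero (ProcQ α) := ⟨Proc.nil.q⟩

theorem Proc.q_par {α : Type} (P Q : Proc α) : (Proc.par P Q).q = P.q + Q.q := rfl
theorem Proc.q_nil {α : Type} : (Proc.nil : Proc α).q = 0 := rfl

theorem ProcQ.add_comm' {α : Type} (a b : ProcQ α) : a + b = b + a := by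
  induction a using ProcQ.ind; induction b using ProcQ.ind
  exact Proc.q_eq.2 (.par_comm _ _)

theorem ProcQ.add_zero' {α : Type} (a : ProcQ α) : a + 0 = a := by
  induction a using ProcQ.ind
  exact Proc.q_eq.2 (.par_nil _)

/-- With parallel composition as addition, rearranging components is `abel`, and families of
components are sums over multisets. -/
instance (α : Type) : AddCommMonoid (ProcQ α) where
  add_assoc a b c := by
    induction a using ProcQ.ind; induction b using ProcQ.ind; induction c using ProcQ.ind
    exact Proc.q_eq.2 (.par_assoc _ _ _)
  zero_add a := by rw [ProcQ.add_comm', ProcQ.add_zero']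
  add_zero := ProcQ.add_zero'
  add_comm := ProcQ.add_comm'
  nsmul := nsmulRec

/-- Restriction on congruence classes. -/
def resQ {α : Type} (τ : α) : ProcQ α → ProcQ α := Quotient.map (Proc.res τ) fun _ _ h => .res τ h

theorem Proc.q_res {α : Type} (τ : α) (P : Proc α) : (Proc.res τ P).q = resQ τ P.q := rfl

/-- Renaming on congruence classes. -/
def renQ {α : Type} (f : ℕ → ℕ) : ProcQ α →+ ProcQ α where
  toFun := Quotient.map (Proc.rename f) fun _ _ h => Proc.Cong.rename h f
  map_zero' := rfl
  map_add' a b := by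
    induction a using ProcQ.ind; induction b using ProcQ.ind; rfl

theorem Proc.q_rename {α : Type} (f : ℕ → ℕ) (P : Proc α) : (P.rename f).q = renQ f P.q := rfl
theorem Proc.q_shift {α : Type} (P : Proc α) : P.shift.q = renQ Nat.succ P.q := rfl
theorem Proc.q_subst {α : Type} (b : ℕ) (P : Proc α) : (P.subst b).q = renQ (inst b) P.q := rfl

theorem renQ_renQ {α : Type} (f g : ℕ → ℕ) (p : ProcQ α) : renQ f (renQ g p) = renQ (f ∘ g) p := by
  induction p using ProcQ.ind with | _ P =>
  simp only [← Proc.q_rename, Proc.rename_rename]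

theorem renQ_id {α : Type} (p : ProcQ α) : renQ id p = p := by
  induction p using ProcQ.ind with | _ P =>
  simp only [← Proc.q_rename, Proc.rename_id]

theorem renQ_resQ {α : Type} (f : ℕ → ℕ) (τ : α) (p : ProcQ α) :
    renQ f (resQ τ p) = resQ τ (renQ (lift f) p) := by
  induction p using ProcQ.ind; rfl

theorem add_resQ {α : Type} (τ : α) (a p : ProcQ α) :
    a + resQ τ p = resQ τ (renQ Nat.succ a + p) := by
  induction a using ProcQ.ind; induction p using ProcQ.ind
  exact Proc.q_eq.2 (.extrude _ _ _)

theorem resQ_add {α : Type} (τ : α) (p a : ProcQ α) :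
    resQ τ p + a = resQ τ (p + renQ Nat.succ a) := by
  rw [add_comm, add_resQ, add_comm]

theorem resQ_zero {α : Type} (τ : α) : resQ τ (0 : ProcQ α) = 0 := Proc.q_eq.2 (.res_nil τ)

/-- Scope extrusion around the empty process, whose restriction vanishes, removes an unused
restriction. This disposes of the private object of a nullary message once it has been delivered. -/
theorem resQ_shift {α : Type} (τ : α) (p : ProcQ α) : resQ τ (renQ Nat.succ p) = p := by
  have := add_resQ τ p 0
  rwa [resQ_zero, add_zero, add_zero, eq_comm] at this

theorem resQ_swap {α : Type} (σ τ : α) (p : ProcQ α) :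
    resQ σ (resQ τ p) = resQ τ (resQ σ (renQ swap01 p)) := by
  induction p using ProcQ.ind
  exact Proc.q_eq.2 (.res_swap _ _ _)

theorem Proc.q_bang {α : Type} (M : Choice α) :
    (Proc.bang M).q = (Proc.sum M).q + (Proc.bang M).q := Proc.q_eq.2 (.unfold M)

theorem Proc.q_parList {α : Type} : ∀ L : List (Proc α), (parList L).q = (L.map Proc.q).sum
  | [] => rfl
  | [A] => by simp [parList]
  | A :: B :: L => by
      simp only [parList, Proc.q_par, Proc.q_parList (B :: L), List.map_cons, List.sum_cons]

/-- Several restrictions on congruence classes. -/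
def resListQ {α : Type} (X : List α) (p : ProcQ α) : ProcQ α := X.foldr resQ p

theorem Proc.q_resList {α : Type} (X : List α) (P : Proc α) :
    (resList X P).q = resListQ X P.q := by
  induction X with
  | nil => rfl
  | cons τ X ih => simp only [resList, Proc.q_res, ih, resListQ, List.foldr_cons]

theorem resListQ_append {α : Type} (X Y : List α) (p : ProcQ α) :
    resListQ (X ++ Y) p = resListQ X (resListQ Y p) := by simp [resListQ]

theorem liftN_succ (n : ℕ) (f : ℕ → ℕ) : liftN (n + 1) f = liftN n (lift f) := rfl

theorem renQ_resListQ {α : Type} (X : List α) (f : ℕ → ℕ) (p : ProcQ α) :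
    renQ f (resListQ X p) = resListQ X (renQ (liftN X.length f) p) := by
  induction X generalizing f with
  | nil => rfl
  | cons τ X ih =>
      simp only [resListQ, List.foldr_cons, List.length_cons, liftN_succ] at ih ⊢
      rw [renQ_resQ, ih]

theorem rename_resList {α : Type} (X : List α) (f : ℕ → ℕ) (P : Proc α) :
    (resList X P).rename f = resList X (P.rename (liftN X.length f)) := by
  induction X generalizing f with
  | nil => rfl
  | cons τ X ih => simp only [resList, Proc.rename, List.length_cons, liftN_succ, ih]

theorem rename_parList {α : Type} (f : ℕ → ℕ) : ∀ L : List (Proc α),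
    (parList L).rename f = parList (L.map (Proc.rename f))
  | [] => rfl
  | [A] => rfl
  | A :: B :: L => by
      simp only [parList, Proc.rename, List.map_cons, rename_parList f (B :: L)]

theorem resListQ_add {α : Type} (X : List α) (p a : ProcQ α) :
    resListQ X p + a = resListQ X (p + renQ (· + X.length) a) := by
  induction X generalizing a with
  | nil =>
      have : (fun x : ℕ => x + ([] : List α).length) = id := rfl
      rw [this, renQ_id]; rfl
  | cons τ X ih =>
      simp only [resListQ, List.foldr_cons] at ih ⊢
      rw [resQ_add, ih, renQ_renQ]
      congr 5
      funext x; simp [Function.comp]; omega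

theorem add_resListQ {α : Type} (X : List α) (p a : ProcQ α) :
    a + resListQ X p = resListQ X (renQ (· + X.length) a + p) := by
  rw [add_comm, resListQ_add, add_comm]

/-! ## The normal form of a term is a congruent normal form -/

theorem renQ_list_sum {α : Type} (f : ℕ → ℕ) (L : List (Proc α)) :
    ((L.map (Proc.rename f)).map Proc.q).sum = renQ f (L.map Proc.q).sum := by
  rw [map_list_sum, List.map_map, List.map_map]; rfl

mutual
-- In the parallel case the restrictions of `P` are extruded first and those of `Q` below them; the
-- shifts made by `nfData` are exactly those that the two extrusions produce.
theorem Proc.nf_cong {α : Type} : ∀ P : Proc α, P.nf.Cong P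
  | .nil => .refl _
  | .res τ P => .res τ (Proc.nf_cong P)
  | .par P Q => by
      have hP := Proc.q_eq.2 (Proc.nf_cong P)
      have hQ := Proc.q_eq.2 (Proc.nf_cong Q)
      rw [Proc.nf, Proc.q_resList, Proc.q_parList] at hP hQ
      refine Proc.q_eq.1 ?_
      rw [Proc.nf, Proc.q_resList, Proc.q_parList, Proc.q_par]
      conv_rhs => rw [← hP, ← hQ]
      simp only [Proc.nfData, List.map_append, List.sum_append, resListQ_append]
      rw [renQ_list_sum, renQ_list_sum, resListQ_add, renQ_resListQ, add_resListQ]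
  | .sum M => .sum (Choice.nf_cong M)
  | .bang M => .bang (Choice.nf_cong M)
theorem Choice.nf_cong {α : Type} : ∀ M : Choice α, M.nf.Cong M
  | .pre π P => .pre π (Proc.nf_cong P)
  | .plus M N => .plus (Choice.nf_cong M) (Choice.nf_cong N)
end

theorem Proc.q_nf {α : Type} (P : Proc α) : P.nf.q = P.q := Proc.q_eq.2 P.nf_cong

theorem IsNFSeq.rename_of {α : Type} {A : Proc α} (h : IsNFSeq A) :
    ∀ f : ℕ → ℕ, IsNFSeq (A.rename f) := by
  refine IsNFSeq.rec (motive_1 := fun P _ => ∀ f, IsNF (P.rename f))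
    (motive_2 := fun P _ => ∀ f, IsNFSeq (P.rename f))
    (motive_3 := fun M _ => ∀ f, IsNFChoice (M.rename f)) ?_ ?_ ?_ ?_ ?_ h
  · intro X L _ ih f
    rw [rename_resList, rename_parList]
    refine .mk _ _ fun A hA => ?_
    obtain ⟨B, hB, rfl⟩ := List.mem_map.1 hA
    exact ih B hB _
  · exact fun _ ih f => .sum (ih f)
  · exact fun _ ih f => .bang (ih f)
  · exact fun π _ _ ih f => .pre _ (ih _)
  · exact fun _ _ ih ih' f => .plus (ih f) (ih' f)

mutual
theorem Proc.isNFSeq_nfData {α : Type} : ∀ (P : Proc α), ∀ A ∈ P.nfData.2, IsNFSeq A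
  | .nil => by simp [Proc.nfData]
  | .res τ P => Proc.isNFSeq_nfData P
  | .par P Q => by
      intro A hA
      simp only [Proc.nfData, List.mem_append, List.mem_map] at hA
      rcases hA with ⟨B, hB, rfl⟩ | ⟨B, hB, rfl⟩
      · exact (Proc.isNFSeq_nfData P B hB).rename_of _
      · exact (Proc.isNFSeq_nfData Q B hB).rename_of _
  | .sum M => by
      simp only [Proc.nfData, List.mem_singleton, forall_eq]
      exact .sum (Choice.isNFChoice_nf M)
  | .bang M => by
      simp only [Proc.nfData, List.mem_singleton, forall_eq]
      exact .bang (Choice.isNFChoice_nf M)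
theorem Choice.isNFChoice_nf {α : Type} : ∀ M : Choice α, IsNFChoice M.nf
  | .pre π P => .pre π (.mk _ _ (Proc.isNFSeq_nfData P))
  | .plus M N => .plus (Choice.isNFChoice_nf M) (Choice.isNFChoice_nf N)
end

end PiCalc

-- Contextual communication and its realisation by reductions

namespace PiCalc

/-! ## Reduction on congruence classes -/

theorem Choice.plusOpt_rename {α : Type} (f : ℕ → ℕ) (M : Choice α) (N : Option (Choice α)) :
    (M.plusOpt N).rename f = (M.rename f).plusOpt (N.map (Choice.rename f)) := by
  cases N <;> rfl

theorem Choice.plusOpt_nf {α : Type} (M : Choice α) (N : Option (Choice α)) :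
    (M.plusOpt N).nf = M.nf.plusOpt (N.map Choice.nf) := by
  cases N <;> rfl

/-- Communications on congruence classes, closed under evaluation contexts. -/
inductive Red {α : Type} : ProcQ α → ProcQ α → Prop
  | react (a b : ℕ) (P₁ P₂ : Proc α) (Ms Mr : Option (Choice α)) :
      Red ((Proc.sum ((Choice.pre (.out a b) P₁).plusOpt Ms)).q +
        (Proc.sum ((Choice.pre (.inp a) P₂).plusOpt Mr)).q) (P₁.q + (P₂.subst b).q)
  | par {p p' : ProcQ α} (r : ProcQ α) : Red p p' → Red (p + r) (p' + r)
  | res {p p' : ProcQ α} (τ : α) : Red p p' → Red (resQ τ p) (resQ τ p')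

/-- Scope extrusion moves every bystander below the restrictions collected so far, so a contextual
derivation flattens into the shape that `Step` displays. -/
theorem Red.exists_context {α : Type} {p p' : ProcQ α} (h : Red p p') :
    ∃ (W : List α) (a b : ℕ) (P₁ P₂ : Proc α) (Ms Mr : Option (Choice α)) (C : ProcQ α),
      p = resListQ W ((Proc.sum ((Choice.pre (.out a b) P₁).plusOpt Ms)).q +
        ((Proc.sum ((Choice.pre (.inp a) P₂).plusOpt Mr)).q + C)) ∧
      p' = resListQ W (P₁.q + ((P₂.subst b).q + C)) := by
  induction h with
  | react a b P₁ P₂ Ms Mr =>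
      exact ⟨[], a, b, P₁, P₂, Ms, Mr, 0, by simp [resListQ], by simp [resListQ]⟩
  | par r _ ih =>
      obtain ⟨W, a, b, P₁, P₂, Ms, Mr, C, rfl, rfl⟩ := ih
      refine ⟨W, a, b, P₁, P₂, Ms, Mr, C + renQ (· + W.length) r, ?_, ?_⟩ <;>
        simp only [resListQ_add, add_assoc]
  | res τ _ ih =>
      obtain ⟨W, a, b, P₁, P₂, Ms, Mr, C, rfl, rfl⟩ := ih
      exact ⟨τ :: W, a, b, P₁, P₂, Ms, Mr, C, rfl, rfl⟩

/-- `Step` asks for a normal form, so both continuations, the other summands and the bystanders are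
normalised separately; congruence reconnects them with `P` and `Q`. The activated restrictions keep
their annotations. -/
theorem Red.step {α : Type} {P Q : Proc α} (h : Red P.q Q.q) : Step P Q := by
  obtain ⟨W, a, b, P₁, P₂, Ms, Mr, C, hP, hQ⟩ := h.exists_context
  induction C using ProcQ.ind with | _ C =>
  set X := C.nfData.1
  set L := C.nfData.2
  -- The restrictions of the normalised bystanders are extruded over the two partners, which are
  -- weakened accordingly.
  set f : ℕ → ℕ := (· + X.length)
  have hC : C.q = resListQ X (L.map Proc.q).sum := by
    rw [← C.q_nf, Proc.nf, Proc.q_resList, Proc.q_parList]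
  have hnf : ∀ M : Choice α, (Proc.sum M.nf).q = (Proc.sum M).q :=
    fun M => Proc.q_eq.2 (.sum (Choice.nf_cong M))
  have e₁ := Choice.plusOpt_nf ((Choice.pre (.out a b) P₁).rename f) (Ms.map (Choice.rename f))
  have e₂ := Choice.plusOpt_nf ((Choice.pre (.inp a) P₂).rename f) (Mr.map (Choice.rename f))
  refine Step.comm (W ++ X) (P₁.rename f).nfData.1 (P₂.rename (lift f)).nfData.1
    (P₁.rename f).nfData.1 (P₂.rename (lift f)).nfData.1
    (P₁.rename f).nfData.2 (P₂.rename (lift f)).nfData.2 L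
    ((Ms.map (Choice.rename f)).map Choice.nf) ((Mr.map (Choice.rename f)).map Choice.nf)
    (f a) (f b) ?_ ?_ rfl rfl ?_
  · refine Proc.q_eq.1 ?_
    rw [hP, hC, Proc.q_resList, Proc.q_parList, resListQ_append]
    simp only [List.map_cons, List.sum_cons, add_resListQ]
    congr 2
    refine congrArg₂ _ ?_ (congrArg₂ _ ?_ rfl)
    · refine Eq.trans ?_ (congrArg (fun M => (Proc.sum M).q) e₁)
      rw [hnf, ← Choice.plusOpt_rename]; rfl
    · refine Eq.trans ?_ (congrArg (fun M => (Proc.sum M).q) e₂)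
      rw [hnf, ← Choice.plusOpt_rename]; rfl
  · refine .mk _ _ ?_
    simp only [List.mem_cons, forall_eq_or_imp]
    refine ⟨.sum (e₁ ▸ Choice.isNFChoice_nf _), .sum (e₂ ▸ Choice.isNFChoice_nf _),
      Proc.isNFSeq_nfData C⟩
  · refine Proc.q_eq.1 ?_
    rw [hQ, hC, Proc.q_resList, resListQ_append]
    simp only [Proc.q_par, Proc.q_parList L, add_resListQ]
    congr 2
    refine congrArg₂ _ ?_ (congrArg₂ _ ?_ rfl)
    · exact ((P₁.rename f).q_nf).symm
    · rw [Proc.q_subst, renQ_renQ]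
      have : (resList (P₂.rename (lift f)).nfData.1 (parList (P₂.rename (lift f)).nfData.2)).q =
        (P₂.rename (lift f)).q := (P₂.rename (lift f)).q_nf
      rw [Proc.q_subst, this, Proc.q_rename, renQ_renQ, inst_comp_lift]

end PiCalc

-- A labelled transition system invariant under structural congruence

namespace PiCalc

/-! ## Labelled transitions

The derivatives are congruence classes. The derivative of an input and of a bound output lives
below one additional binder, whose variable is the object of the communication. -/

def Choice.In : Choice Unit → ℕ → ProcQ Unit → Prop
  | .pre (.inp c) P, a, r => c = a ∧ r = P.q
  | .pre (.out _ _) _, _, _ => False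
  | .pre .tau _, _, _ => False
  | .plus M N, a, r => Choice.In M a r ∨ Choice.In N a r

def Choice.Out : Choice Unit → ℕ → ℕ → ProcQ Unit → Prop
  | .pre (.inp _) _, _, _, _ => False
  | .pre (.out c d) P, a, b, r => c = a ∧ d = b ∧ r = P.q
  | .pre .tau _, _, _, _ => False
  | .plus M N, a, b, r => Choice.Out M a b r ∨ Choice.Out N a b r

def Choice.Tau : Choice Unit → ProcQ Unit → Prop
  | .pre (.inp _) _, _ => False
  | .pre (.out _ _) _, _ => False
  | .pre .tau P, r => r = P.q
  | .plus M N, r => Choice.Tau M r ∨ Choice.Tau N r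

/-- Input. -/
def Proc.In : PiTerm → ℕ → ProcQ Unit → Prop
  | .nil, _, _ => False
  | .res _ P, a, r => ∃ p, Proc.In P (a + 1) p ∧ r = resQ () (renQ swap01 p)
  | .par P Q, a, r =>
      (∃ p, Proc.In P a p ∧ r = p + renQ Nat.succ Q.q) ∨
      (∃ p, Proc.In Q a p ∧ r = p + renQ Nat.succ P.q)
  | .sum M, a, r => M.In a r
  | .bang M, a, r => ∃ p, M.In a p ∧ r = p + renQ Nat.succ (Proc.bang M).q

/-- Free output. -/
def Proc.Out : PiTerm → ℕ → ℕ → ProcQ Unit → Prop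
  | .nil, _, _, _ => False
  | .res _ P, a, b, r => ∃ p, Proc.Out P (a + 1) (b + 1) p ∧ r = resQ () p
  | .par P Q, a, b, r =>
      (∃ p, Proc.Out P a b p ∧ r = p + Q.q) ∨ (∃ p, Proc.Out Q a b p ∧ r = p + P.q)
  | .sum M, a, b, r => M.Out a b r
  | .bang M, a, b, r => ∃ p, M.Out a b p ∧ r = p + (Proc.bang M).q

/-- Bound output. -/
def Proc.BOut : PiTerm → ℕ → ProcQ Unit → Prop
  | .nil, _, _ => False
  | .res _ P, a, r => Proc.Out P (a + 1) 0 r ∨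
      ∃ p, Proc.BOut P (a + 1) p ∧ r = resQ () (renQ swap01 p)
  | .par P Q, a, r =>
      (∃ p, Proc.BOut P a p ∧ r = p + renQ Nat.succ Q.q) ∨
      (∃ p, Proc.BOut Q a p ∧ r = p + renQ Nat.succ P.q)
  | .sum _, _, _ => False
  | .bang _, _, _ => False

/-- A message of `P` is received by `Q`. -/
def Proc.Comm (P Q : PiTerm) (r : ProcQ Unit) : Prop :=
  (∃ a b p q, P.Out a b p ∧ Q.In a q ∧ r = p + renQ (inst b) q) ∨
  (∃ a p q, P.BOut a p ∧ Q.In a q ∧ r = resQ () (p + q))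

/-- Internal transitions. -/
def Proc.Tau : PiTerm → ProcQ Unit → Prop
  | .nil, _ => False
  | .res _ P, r => ∃ p, Proc.Tau P p ∧ r = resQ () p
  | .par P Q, r =>
      (∃ p, Proc.Tau P p ∧ r = p + Q.q) ∨ (∃ p, Proc.Tau Q p ∧ r = p + P.q) ∨
      P.Comm Q r ∨ Q.Comm P r
  | .sum M, r => M.Tau r
  | .bang M, r => (∃ p, M.Tau p ∧ r = p + (Proc.bang M).q) ∨
      ∃ a b p q, M.Out a b p ∧ M.In a q ∧ r = p + renQ (inst b) q + (Proc.bang M).q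

/-! ### Transitions of renamed terms -/

theorem renQ_lift_succ {α : Type} (f : ℕ → ℕ) (p : ProcQ α) :
    renQ (lift f) (renQ Nat.succ p) = renQ Nat.succ (renQ f p) := by
  rw [renQ_renQ, renQ_renQ, lift_comp_succ]

theorem renQ_lift_swap {α : Type} (f : ℕ → ℕ) (τ : α) (p : ProcQ α) :
    renQ (lift f) (resQ τ (renQ swap01 p)) = resQ τ (renQ swap01 (renQ (lift (lift f)) p)) := by
  rw [renQ_resQ, renQ_renQ, renQ_renQ, swap01_comp_lift_lift]

theorem Choice.In_rename (f : ℕ → ℕ) : ∀ (M : Choice Unit) (a : ℕ) (r : ProcQ Unit),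
    (M.rename f).In a r ↔ ∃ a' r', f a' = a ∧ M.In a' r' ∧ r = renQ (lift f) r'
  | .pre (.inp c) P, a, r => by
      simp [Choice.rename, Choice.In, Pre.rename, Pre.under, Proc.q_rename]
  | .pre (.out _ _) P, a, r => by simp [Choice.rename, Choice.In, Pre.rename]
  | .pre .tau P, a, r => by simp [Choice.rename, Choice.In, Pre.rename]
  | .plus M N, a, r => by
      simp only [Choice.rename, Choice.In, Choice.In_rename f M, Choice.In_rename f N]
      grind

theorem Choice.Out_rename (f : ℕ → ℕ) : ∀ (M : Choice Unit) (a b : ℕ) (r : ProcQ Unit),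
    (M.rename f).Out a b r ↔ ∃ a' b' r', f a' = a ∧ f b' = b ∧ M.Out a' b' r' ∧ r = renQ f r'
  | .pre (.out c d) P, a, b, r => by
      simp [Choice.rename, Choice.Out, Pre.rename, Pre.under, Proc.q_rename]
  | .pre (.inp _) P, a, b, r => by simp [Choice.rename, Choice.Out, Pre.rename]
  | .pre .tau P, a, b, r => by simp [Choice.rename, Choice.Out, Pre.rename]
  | .plus M N, a, b, r => by
      simp only [Choice.rename, Choice.Out, Choice.Out_rename f M, Choice.Out_rename f N]
      grind

theorem Choice.Tau_rename (f : ℕ → ℕ) : ∀ (M : Choice Unit) (r : ProcQ Unit),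
    (M.rename f).Tau r ↔ ∃ r', M.Tau r' ∧ r = renQ f r'
  | .pre .tau P, r => by
      simp [Choice.rename, Choice.Tau, Pre.rename, Pre.under, Proc.q_rename]
  | .pre (.inp _) P, r => by simp [Choice.rename, Choice.Tau, Pre.rename]
  | .pre (.out _ _) P, r => by simp [Choice.rename, Choice.Tau, Pre.rename]
  | .plus M N, r => by
      simp only [Choice.rename, Choice.Tau, Choice.Tau_rename f M, Choice.Tau_rename f N]
      grind

theorem lift_eq_succ {f : ℕ → ℕ} {i a : ℕ} : lift f i = a + 1 ↔ ∃ j, i = j + 1 ∧ f j = a := by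
  cases i <;> simp

theorem lift_eq_zero {f : ℕ → ℕ} {i : ℕ} : lift f i = 0 ↔ i = 0 := by
  cases i <;> simp

theorem Proc.In_rename : ∀ (P : PiTerm) (f : ℕ → ℕ) (a : ℕ) (r : ProcQ Unit),
    (P.rename f).In a r ↔ ∃ a' r', f a' = a ∧ P.In a' r' ∧ r = renQ (lift f) r'
  | .nil, f, a, r => by simp [Proc.rename, Proc.In]
  | .res τ P, f, a, r => by
      simp only [Proc.rename, Proc.In, Proc.In_rename P, lift_eq_succ]
      constructor
      · rintro ⟨_, ⟨_, p, ⟨j, rfl, rfl⟩, h, rfl⟩, rfl⟩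
        exact ⟨j, _, rfl, ⟨p, h, rfl⟩, (renQ_lift_swap _ _ _).symm⟩
      · rintro ⟨j, _, rfl, ⟨p, h, rfl⟩, rfl⟩
        exact ⟨_, ⟨_, p, ⟨j, rfl, rfl⟩, h, rfl⟩, renQ_lift_swap _ _ _⟩
  | .par P Q, f, a, r => by
      simp only [Proc.rename, Proc.In, Proc.In_rename P, Proc.In_rename Q, Proc.q_rename]
      constructor
      · rintro (⟨_, ⟨j, p, rfl, h, rfl⟩, rfl⟩ | ⟨_, ⟨j, p, rfl, h, rfl⟩, rfl⟩)
        · exact ⟨j, _, rfl, .inl ⟨p, h, rfl⟩, by rw [map_add, renQ_lift_succ]⟩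
        · exact ⟨j, _, rfl, .inr ⟨p, h, rfl⟩, by rw [map_add, renQ_lift_succ]⟩
      · rintro ⟨j, _, rfl, ⟨p, h, rfl⟩ | ⟨p, h, rfl⟩, rfl⟩
        · exact .inl ⟨_, ⟨j, p, rfl, h, rfl⟩, by rw [map_add, renQ_lift_succ]⟩
        · exact .inr ⟨_, ⟨j, p, rfl, h, rfl⟩, by rw [map_add, renQ_lift_succ]⟩
  | .sum M, f, a, r => M.In_rename f a r
  | .bang M, f, a, r => by
      have e : (Proc.bang (M.rename f)).q = renQ f (Proc.bang M).q := rfl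
      simp only [Proc.rename, Proc.In, Choice.In_rename, e]
      constructor
      · rintro ⟨_, ⟨j, p, rfl, h, rfl⟩, rfl⟩
        exact ⟨j, _, rfl, ⟨p, h, rfl⟩, by rw [map_add, renQ_lift_succ]⟩
      · rintro ⟨j, _, rfl, ⟨p, h, rfl⟩, rfl⟩
        exact ⟨_, ⟨j, p, rfl, h, rfl⟩, by rw [map_add, renQ_lift_succ]⟩

theorem Proc.Out_rename : ∀ (P : PiTerm) (f : ℕ → ℕ) (a b : ℕ) (r : ProcQ Unit),
    (P.rename f).Out a b r ↔ ∃ a' b' r', f a' = a ∧ f b' = b ∧ P.Out a' b' r' ∧ r = renQ f r'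
  | .nil, f, a, b, r => by simp [Proc.rename, Proc.Out]
  | .res τ P, f, a, b, r => by
      simp only [Proc.rename, Proc.Out, Proc.Out_rename P, lift_eq_succ]
      constructor
      · rintro ⟨_, ⟨_, _, p, ⟨i, rfl, rfl⟩, ⟨j, rfl, rfl⟩, h, rfl⟩, rfl⟩
        exact ⟨i, j, _, rfl, rfl, ⟨p, h, rfl⟩, (renQ_resQ _ _ _).symm⟩
      · rintro ⟨i, j, _, rfl, rfl, ⟨p, h, rfl⟩, rfl⟩
        exact ⟨_, ⟨_, _, p, ⟨i, rfl, rfl⟩, ⟨j, rfl, rfl⟩, h, rfl⟩, renQ_resQ _ _ _⟩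
  | .par P Q, f, a, b, r => by
      simp only [Proc.rename, Proc.Out, Proc.Out_rename P, Proc.Out_rename Q, Proc.q_rename]
      constructor
      · rintro (⟨_, ⟨i, j, p, rfl, rfl, h, rfl⟩, rfl⟩ | ⟨_, ⟨i, j, p, rfl, rfl, h, rfl⟩, rfl⟩)
        · exact ⟨i, j, _, rfl, rfl, .inl ⟨p, h, rfl⟩, by rw [map_add]⟩
        · exact ⟨i, j, _, rfl, rfl, .inr ⟨p, h, rfl⟩, by rw [map_add]⟩
      · rintro ⟨i, j, _, rfl, rfl, ⟨p, h, rfl⟩ | ⟨p, h, rfl⟩, rfl⟩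
        · exact .inl ⟨_, ⟨i, j, p, rfl, rfl, h, rfl⟩, by rw [map_add]⟩
        · exact .inr ⟨_, ⟨i, j, p, rfl, rfl, h, rfl⟩, by rw [map_add]⟩
  | .sum M, f, a, b, r => M.Out_rename f a b r
  | .bang M, f, a, b, r => by
      have e : (Proc.bang (M.rename f)).q = renQ f (Proc.bang M).q := rfl
      simp only [Proc.rename, Proc.Out, Choice.Out_rename, e]
      constructor
      · rintro ⟨_, ⟨i, j, p, rfl, rfl, h, rfl⟩, rfl⟩
        exact ⟨i, j, _, rfl, rfl, ⟨p, h, rfl⟩, by rw [map_add]⟩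
      · rintro ⟨i, j, _, rfl, rfl, ⟨p, h, rfl⟩, rfl⟩
        exact ⟨_, ⟨i, j, p, rfl, rfl, h, rfl⟩, by rw [map_add]⟩

theorem Proc.BOut_rename : ∀ (P : PiTerm) (f : ℕ → ℕ) (a : ℕ) (r : ProcQ Unit),
    (P.rename f).BOut a r ↔ ∃ a' r', f a' = a ∧ P.BOut a' r' ∧ r = renQ (lift f) r'
  | .nil, f, a, r => by simp [Proc.rename, Proc.BOut]
  | .res τ P, f, a, r => by
      simp only [Proc.rename, Proc.BOut, Proc.BOut_rename P, Proc.Out_rename, lift_eq_succ,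
        lift_eq_zero]
      constructor
      · rintro (⟨_, _, p, ⟨j, rfl, rfl⟩, rfl, h, rfl⟩ | ⟨_, ⟨_, p, ⟨j, rfl, rfl⟩, h, rfl⟩, rfl⟩)
        · exact ⟨j, _, rfl, .inl h, rfl⟩
        · exact ⟨j, _, rfl, .inr ⟨p, h, rfl⟩, (renQ_lift_swap _ _ _).symm⟩
      · rintro ⟨j, _, rfl, h | ⟨p, h, rfl⟩, rfl⟩
        · exact .inl ⟨_, _, _, ⟨j, rfl, rfl⟩, rfl, h, rfl⟩
        · exact .inr ⟨_, ⟨_, p, ⟨j, rfl, rfl⟩, h, rfl⟩, renQ_lift_swap _ _ _⟩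
  | .par P Q, f, a, r => by
      simp only [Proc.rename, Proc.BOut, Proc.BOut_rename P, Proc.BOut_rename Q, Proc.q_rename]
      constructor
      · rintro (⟨_, ⟨j, p, rfl, h, rfl⟩, rfl⟩ | ⟨_, ⟨j, p, rfl, h, rfl⟩, rfl⟩)
        · exact ⟨j, _, rfl, .inl ⟨p, h, rfl⟩, by rw [map_add, renQ_lift_succ]⟩
        · exact ⟨j, _, rfl, .inr ⟨p, h, rfl⟩, by rw [map_add, renQ_lift_succ]⟩
      · rintro ⟨j, _, rfl, ⟨p, h, rfl⟩ | ⟨p, h, rfl⟩, rfl⟩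
        · exact .inl ⟨_, ⟨j, p, rfl, h, rfl⟩, by rw [map_add, renQ_lift_succ]⟩
        · exact .inr ⟨_, ⟨j, p, rfl, h, rfl⟩, by rw [map_add, renQ_lift_succ]⟩
  | .sum M, f, a, r => by simp [Proc.rename, Proc.BOut]
  | .bang M, f, a, r => by simp [Proc.rename, Proc.BOut]

theorem renQ_inst_lift {α : Type} (f : ℕ → ℕ) (b : ℕ) (p : ProcQ α) :
    renQ (inst (f b)) (renQ (lift f) p) = renQ f (renQ (inst b) p) := by
  rw [renQ_renQ, renQ_renQ, inst_comp_lift]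

/-- Injectivity enters here: identifying the subjects of an output and of an input would create a
communication that the original terms do not have. The laws treated below only rename injectively.
-/
theorem Proc.Comm_rename {f : ℕ → ℕ} (hf : Function.Injective f) (P Q : PiTerm) (r : ProcQ Unit) :
    (P.rename f).Comm (Q.rename f) r ↔ ∃ r', P.Comm Q r' ∧ r = renQ f r' := by
  simp only [Proc.Comm, Proc.In_rename, Proc.Out_rename, Proc.BOut_rename]
  constructor
  · rintro (⟨_, _, _, _, ⟨a, b, p, rfl, rfl, h, rfl⟩, ⟨a', q, e, h', rfl⟩, rfl⟩ |
      ⟨_, _, _, ⟨a, p, rfl, h, rfl⟩, ⟨a', q, e, h', rfl⟩, rfl⟩)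
    · obtain rfl := hf e
      exact ⟨_, .inl ⟨_, _, _, _, h, h', rfl⟩, by rw [map_add, renQ_inst_lift]⟩
    · obtain rfl := hf e
      exact ⟨_, .inr ⟨_, _, _, h, h', rfl⟩, by rw [renQ_resQ, map_add]⟩
  · rintro ⟨_, ⟨a, b, p, q, h, h', rfl⟩ | ⟨a, p, q, h, h', rfl⟩, rfl⟩
    · exact .inl ⟨_, _, _, _, ⟨_, _, _, rfl, rfl, h, rfl⟩, ⟨_, _, rfl, h', rfl⟩,
        by rw [map_add, renQ_inst_lift]⟩
    · exact .inr ⟨_, _, _, ⟨_, _, rfl, h, rfl⟩, ⟨_, _, rfl, h', rfl⟩,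
        by rw [renQ_resQ, map_add]⟩

theorem Proc.Tau_rename : ∀ (P : PiTerm) {f : ℕ → ℕ} (_ : Function.Injective f) (r : ProcQ Unit),
    (P.rename f).Tau r ↔ ∃ r', P.Tau r' ∧ r = renQ f r'
  | .nil, f, hf, r => by simp [Proc.rename, Proc.Tau]
  | .res τ P, f, hf, r => by
      simp only [Proc.rename, Proc.Tau, Proc.Tau_rename P (lift_injective hf)]
      constructor
      · rintro ⟨_, ⟨p, h, rfl⟩, rfl⟩
        exact ⟨_, ⟨p, h, rfl⟩, (renQ_resQ _ _ _).symm⟩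
      · rintro ⟨_, ⟨p, h, rfl⟩, rfl⟩
        exact ⟨_, ⟨p, h, rfl⟩, renQ_resQ _ _ _⟩
  | .par P Q, f, hf, r => by
      simp only [Proc.rename, Proc.Tau, Proc.Tau_rename P hf, Proc.Tau_rename Q hf, Proc.q_rename,
        Proc.Comm_rename hf]
      constructor
      · rintro (⟨_, ⟨p, h, rfl⟩, rfl⟩ | ⟨_, ⟨p, h, rfl⟩, rfl⟩ | ⟨p, h, rfl⟩ | ⟨p, h, rfl⟩)
        · exact ⟨_, .inl ⟨p, h, rfl⟩, by rw [map_add]⟩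
        · exact ⟨_, .inr (.inl ⟨p, h, rfl⟩), by rw [map_add]⟩
        · exact ⟨_, .inr (.inr (.inl h)), rfl⟩
        · exact ⟨_, .inr (.inr (.inr h)), rfl⟩
      · rintro ⟨_, ⟨p, h, rfl⟩ | ⟨p, h, rfl⟩ | h | h, rfl⟩
        · exact .inl ⟨_, ⟨p, h, rfl⟩, by rw [map_add]⟩
        · exact .inr (.inl ⟨_, ⟨p, h, rfl⟩, by rw [map_add]⟩)
        · exact .inr (.inr (.inl ⟨_, h, rfl⟩))
        · exact .inr (.inr (.inr ⟨_, h, rfl⟩))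
  | .sum M, f, hf, r => M.Tau_rename f r
  | .bang M, f, hf, r => by
      have e : (Proc.bang (M.rename f)).q = renQ f (Proc.bang M).q := rfl
      simp only [Proc.rename, Proc.Tau, Choice.Tau_rename, Choice.In_rename, Choice.Out_rename, e]
      constructor
      · rintro (⟨_, ⟨p, h, rfl⟩, rfl⟩ |
          ⟨_, _, _, _, ⟨a, b, p, rfl, rfl, h, rfl⟩, ⟨a', q, e, h', rfl⟩, rfl⟩)
        · exact ⟨_, .inl ⟨p, h, rfl⟩, by rw [map_add]⟩
        · obtain rfl := hf e
          exact ⟨_, .inr ⟨_, _, _, _, h, h', rfl⟩, by rw [map_add, map_add, renQ_inst_lift]⟩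
      · rintro ⟨_, ⟨p, h, rfl⟩ | ⟨a, b, p, q, h, h', rfl⟩, rfl⟩
        · exact .inl ⟨_, ⟨p, h, rfl⟩, by rw [map_add]⟩
        · exact .inr ⟨_, _, _, _, ⟨_, _, _, rfl, rfl, h, rfl⟩, ⟨_, _, rfl, h', rfl⟩,
            by rw [map_add, map_add, renQ_inst_lift]⟩

/-! ### Communication and the operators -/

theorem Proc.Comm_par_left (P Q R : PiTerm) (r : ProcQ Unit) :
    (Proc.par P Q).Comm R r ↔
      (∃ x, P.Comm R x ∧ r = x + Q.q) ∨ (∃ x, Q.Comm R x ∧ r = x + P.q) := by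
  simp only [Proc.Comm, Proc.Out, Proc.BOut]
  constructor
  · rintro (⟨a, b, _, q, ⟨p, h, rfl⟩ | ⟨p, h, rfl⟩, h', rfl⟩ |
      ⟨a, _, q, ⟨p, h, rfl⟩ | ⟨p, h, rfl⟩, h', rfl⟩)
    · exact .inl ⟨_, .inl ⟨_, _, _, _, h, h', rfl⟩, add_right_comm _ _ _⟩
    · exact .inr ⟨_, .inl ⟨_, _, _, _, h, h', rfl⟩, add_right_comm _ _ _⟩
    · exact .inl ⟨_, .inr ⟨_, _, _, h, h', rfl⟩, by rw [resQ_add, add_right_comm]⟩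
    · exact .inr ⟨_, .inr ⟨_, _, _, h, h', rfl⟩, by rw [resQ_add, add_right_comm]⟩
  · rintro (⟨_, ⟨a, b, p, q, h, h', rfl⟩ | ⟨a, p, q, h, h', rfl⟩, rfl⟩ |
      ⟨_, ⟨a, b, p, q, h, h', rfl⟩ | ⟨a, p, q, h, h', rfl⟩, rfl⟩)
    · exact .inl ⟨_, _, _, _, .inl ⟨_, h, rfl⟩, h', add_right_comm _ _ _⟩
    · exact .inr ⟨_, _, _, .inl ⟨_, h, rfl⟩, h', by rw [resQ_add, add_right_comm]⟩
    · exact .inl ⟨_, _, _, _, .inr ⟨_, h, rfl⟩, h', add_right_comm _ _ _⟩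
    · exact .inr ⟨_, _, _, .inr ⟨_, h, rfl⟩, h', by rw [resQ_add, add_right_comm]⟩

theorem renQ_inst_succ {α : Type} (b : ℕ) (p : ProcQ α) : renQ (inst b) (renQ Nat.succ p) = p := by
  rw [renQ_renQ]; exact renQ_id p

theorem Proc.Comm_par_right (P Q R : PiTerm) (r : ProcQ Unit) :
    R.Comm (Proc.par P Q) r ↔
      (∃ x, R.Comm P x ∧ r = x + Q.q) ∨ (∃ x, R.Comm Q x ∧ r = x + P.q) := by
  simp only [Proc.Comm, Proc.In]
  constructor
  · rintro (⟨a, b, p, _, h, ⟨q, h', rfl⟩ | ⟨q, h', rfl⟩, rfl⟩ |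
      ⟨a, p, _, h, ⟨q, h', rfl⟩ | ⟨q, h', rfl⟩, rfl⟩)
    · exact .inl ⟨_, .inl ⟨_, _, _, _, h, h', rfl⟩, by rw [map_add, renQ_inst_succ, add_assoc]⟩
    · exact .inr ⟨_, .inl ⟨_, _, _, _, h, h', rfl⟩, by rw [map_add, renQ_inst_succ, add_assoc]⟩
    · exact .inl ⟨_, .inr ⟨_, _, _, h, h', rfl⟩, by rw [resQ_add, add_assoc]⟩
    · exact .inr ⟨_, .inr ⟨_, _, _, h, h', rfl⟩, by rw [resQ_add, add_assoc]⟩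
  · rintro (⟨_, ⟨a, b, p, q, h, h', rfl⟩ | ⟨a, p, q, h, h', rfl⟩, rfl⟩ |
      ⟨_, ⟨a, b, p, q, h, h', rfl⟩ | ⟨a, p, q, h, h', rfl⟩, rfl⟩)
    · exact .inl ⟨_, _, _, _, h, .inl ⟨_, h', rfl⟩, by rw [map_add, renQ_inst_succ, add_assoc]⟩
    · exact .inr ⟨_, _, _, h, .inl ⟨_, h', rfl⟩, by rw [resQ_add, add_assoc]⟩
    · exact .inl ⟨_, _, _, _, h, .inr ⟨_, h', rfl⟩, by rw [map_add, renQ_inst_succ, add_assoc]⟩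
    · exact .inr ⟨_, _, _, h, .inr ⟨_, h', rfl⟩, by rw [resQ_add, add_assoc]⟩

theorem swap01_comp_lift_succ : swap01 ∘ lift Nat.succ = Nat.succ := by
  funext i; rcases i with _ | i <;> rfl

theorem lift_inst_comp_swap01 (b : ℕ) : lift (inst b) ∘ swap01 = inst (b + 1) := by
  funext i; rcases i with _ | _ | i <;> rfl

/-- A restriction of one partner may be extruded before or after the scope of the transmitted name
is closed; the two orders differ by an exchange of binders. -/
theorem res_close (p q : ProcQ Unit) :
    resQ () (p + resQ () (renQ swap01 q)) = resQ () (resQ () (renQ (lift Nat.succ) p + q)) := by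
  rw [add_resQ, resQ_swap () () (renQ (lift Nat.succ) p + q), map_add, renQ_renQ,
    swap01_comp_lift_succ]

theorem res_comm (b : ℕ) (p q : ProcQ Unit) :
    p + renQ (inst b) (resQ () (renQ swap01 q)) =
      resQ () (renQ Nat.succ p + renQ (inst (b + 1)) q) := by
  rw [renQ_resQ, renQ_renQ, lift_inst_comp_swap01, add_resQ]

theorem Proc.Comm_res_right (P Q : PiTerm) (τ : Unit) (r : ProcQ Unit) :
    P.Comm (Proc.res τ Q) r ↔ ∃ x, P.shift.Comm Q x ∧ r = resQ () x := by
  simp only [Proc.Comm, Proc.In, Proc.shift, Proc.Out_rename, Proc.BOut_rename]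
  constructor
  · rintro (⟨a, b, p, _, h, ⟨q, h', rfl⟩, rfl⟩ | ⟨a, p, _, h, ⟨q, h', rfl⟩, rfl⟩)
    · exact ⟨_, .inl ⟨_, _, _, _, ⟨_, _, _, rfl, rfl, h, rfl⟩, h', rfl⟩, res_comm _ _ _⟩
    · exact ⟨_, .inr ⟨_, _, _, ⟨_, _, rfl, h, rfl⟩, h', rfl⟩, res_close _ _⟩
  · rintro ⟨_, ⟨_, _, _, q, ⟨a, b, p, rfl, rfl, h, rfl⟩, h', rfl⟩ |
      ⟨_, _, q, ⟨a, p, rfl, h, rfl⟩, h', rfl⟩, rfl⟩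
    · exact .inl ⟨_, _, _, _, h, ⟨_, h', rfl⟩, (res_comm _ _ _).symm⟩
    · exact .inr ⟨_, _, _, h, ⟨_, h', rfl⟩, (res_close _ _).symm⟩

theorem inst_zero_comp_lift_succ : inst 0 ∘ lift Nat.succ = id := by
  funext i; rcases i with _ | i <;> rfl

/-- There are three ways in which the restriction takes part: it does not bind the object of a free
output, it binds that object, or the sender opens another scope below it. The equations `e₁`, `e₂`,
`e₃` treat them in turn. -/
theorem Proc.Comm_res_left (P Q : PiTerm) (τ : Unit) (r : ProcQ Unit) :
    (Proc.res τ Q).Comm P r ↔ ∃ x, Q.Comm P.shift x ∧ r = resQ () x := by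
  have e₁ : ∀ (b : ℕ) (p q : ProcQ Unit), resQ () p + renQ (inst b) q =
      resQ () (p + renQ (inst (b + 1)) (renQ (lift Nat.succ) q)) := by
    intro b p q
    rw [resQ_add, show b + 1 = Nat.succ b from rfl, renQ_inst_lift]
  have e₂ : ∀ (p q : ProcQ Unit), resQ () (p + q) =
      resQ () (p + renQ (inst 0) (renQ (lift Nat.succ) q)) := by
    intro p q
    rw [renQ_renQ, inst_zero_comp_lift_succ, renQ_id]
  have e₃ : ∀ (p q : ProcQ Unit), resQ () (resQ () (renQ swap01 p) + q) =
      resQ () (resQ () (p + renQ (lift Nat.succ) q)) := by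
    intro p q
    rw [add_comm, res_close, add_comm p]
  simp only [Proc.Comm, Proc.Out, Proc.BOut, Proc.shift, Proc.In_rename]
  constructor
  · rintro (⟨a, b, _, q, ⟨p, h, rfl⟩, h', rfl⟩ | ⟨a, p, q, h | ⟨p, h, rfl⟩, h', rfl⟩)
    · exact ⟨_, .inl ⟨_, _, _, _, h, ⟨_, _, rfl, h', rfl⟩, rfl⟩, e₁ _ _ _⟩
    · exact ⟨_, .inl ⟨_, _, _, _, h, ⟨_, _, rfl, h', rfl⟩, rfl⟩, e₂ _ _⟩
    · exact ⟨_, .inr ⟨_, _, _, h, ⟨_, _, rfl, h', rfl⟩, rfl⟩, e₃ _ _⟩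
  · rintro ⟨_, ⟨_, b, p, _, h, ⟨a, q, rfl, h', rfl⟩, rfl⟩ |
      ⟨_, p, _, h, ⟨a, q, rfl, h', rfl⟩, rfl⟩, rfl⟩
    -- Object `0` is the restricted name itself: what is a free output inside is a bound output
    -- outside.
    · cases b with
      | zero => exact .inr ⟨_, _, _, .inl h, h', (e₂ _ _).symm⟩
      | succ b => exact .inl ⟨_, _, _, _, ⟨_, h, rfl⟩, h', (e₁ _ _ _).symm⟩
    · exact .inr ⟨_, _, _, .inr ⟨_, h, rfl⟩, h', (e₃ _ _).symm⟩

/-! ### Congruent terms have the same transitions -/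

/-- The two terms have the same transitions. -/
def SameTransitions (P Q : PiTerm) : Prop :=
  P.In = Q.In ∧ P.Out = Q.Out ∧ P.BOut = Q.BOut ∧ P.Tau = Q.Tau

theorem SameTransitions.comm {P P' Q Q' : PiTerm} (h : SameTransitions P P')
    (h' : SameTransitions Q Q') : P.Comm Q = P'.Comm Q' := by
  funext r
  simp only [Proc.Comm, h.2.1, h.2.2.1, h'.1]

theorem sameTransitions_par_comm (P Q : PiTerm) : SameTransitions (.par P Q) (.par Q P) := by
  refine ⟨?_, ?_, ?_, ?_⟩
  · funext a r; exact propext or_comm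
  · funext a b r; exact propext or_comm
  · funext a r; exact propext or_comm
  · funext r
    simp only [Proc.Tau]
    ac_rfl

theorem exists_add_exists {p : ProcQ Unit → Prop} {r y z : ProcQ Unit} :
    (∃ x, (∃ w, p w ∧ x = w + y) ∧ r = x + z) ↔ ∃ w, p w ∧ r = w + (y + z) := by
  constructor
  · rintro ⟨_, ⟨w, h, rfl⟩, rfl⟩; exact ⟨w, h, add_assoc _ _ _⟩
  · rintro ⟨w, h, rfl⟩; exact ⟨_, ⟨w, h, rfl⟩, (add_assoc _ _ _).symm⟩

theorem sameTransitions_par_assoc (P Q R : PiTerm) :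
    SameTransitions (.par (.par P Q) R) (.par P (.par Q R)) := by
  refine ⟨?_, ?_, ?_, ?_⟩
  · funext a r
    simp only [Proc.In, or_and_right, exists_or, exists_add_exists, Proc.q_par, map_add, or_assoc,
      add_comm]
  · funext a b r
    simp only [Proc.Out, or_and_right, exists_or, exists_add_exists, Proc.q_par, or_assoc, add_comm]
  · funext a r
    simp only [Proc.BOut, or_and_right, exists_or, exists_add_exists, Proc.q_par, map_add, or_assoc,
      add_comm]
  · funext r
    simp only [Proc.Tau, Proc.Comm_par_left, Proc.Comm_par_right, or_and_right, exists_or,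
      exists_add_exists, Proc.q_par]
    simp only [add_comm]
    ac_rfl

theorem sameTransitions_par_nil (P : PiTerm) : SameTransitions (.par P .nil) P := by
  refine ⟨?_, ?_, ?_, ?_⟩
  · funext a r; simp [Proc.In, Proc.q_nil]
  · funext a b r; simp [Proc.Out, Proc.q_nil]
  · funext a r; simp [Proc.BOut, Proc.q_nil]
  · funext r; simp [Proc.Tau, Proc.q_nil, Proc.Comm, Proc.In, Proc.Out, Proc.BOut]

theorem sameTransitions_res_nil (τ : Unit) : SameTransitions (.res τ .nil) .nil := by
  refine ⟨?_, ?_, ?_, ?_⟩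
  · funext a r; simp [Proc.In]
  · funext a b r; simp [Proc.Out]
  · funext a r; simp [Proc.BOut, Proc.Out]
  · funext r; simp [Proc.Tau]

theorem lift_swap01_swap (p : ProcQ Unit) :
    resQ () (renQ swap01 (resQ () (renQ swap01 p))) =
      resQ () (renQ swap01 (resQ () (renQ swap01 (renQ (lift swap01) p)))) := by
  simp only [renQ_resQ, renQ_renQ]
  rw [resQ_swap, renQ_renQ]
  congr 3
  congr 1
  funext i; rcases i with _ | _ | _ | i <;> rfl

theorem swap01_swap01 (i : ℕ) : swap01 (swap01 i) = i := congrFun swap01_comp_swap01 i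

theorem swap01_eq_iff {i j : ℕ} : swap01 i = j ↔ i = swap01 j := by
  constructor
  · rintro rfl; rw [swap01_swap01]
  · rintro rfl; rw [swap01_swap01]

theorem sameTransitions_res_swap (σ τ : Unit) (P : PiTerm) :
    SameTransitions (.res σ (.res τ P)) (.res τ (.res σ (P.rename swap01))) := by
  have e : ∀ i : ℕ, swap01 (i + 2) = i + 2 := fun _ => rfl
  refine ⟨?_, ?_, ?_, ?_⟩
  · funext a r
    simp only [Proc.In, Proc.In_rename, swap01_eq_iff, add_assoc, Nat.reduceAdd, e, eq_iff_iff]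
    constructor
    · rintro ⟨_, ⟨p, h, rfl⟩, rfl⟩
      exact ⟨_, ⟨_, ⟨_, _, rfl, h, rfl⟩, rfl⟩, lift_swap01_swap p⟩
    · rintro ⟨_, ⟨_, ⟨_, p, rfl, h, rfl⟩, rfl⟩, rfl⟩
      exact ⟨_, ⟨p, h, rfl⟩, (lift_swap01_swap p).symm⟩
  · funext a b r
    simp only [Proc.Out, Proc.Out_rename, swap01_eq_iff, add_assoc, Nat.reduceAdd, e, eq_iff_iff]
    constructor
    · rintro ⟨_, ⟨p, h, rfl⟩, rfl⟩
      exact ⟨_, ⟨_, ⟨_, _, _, rfl, rfl, h, rfl⟩, rfl⟩, resQ_swap _ _ _⟩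
    · rintro ⟨_, ⟨_, ⟨_, _, p, rfl, rfl, h, rfl⟩, rfl⟩, rfl⟩
      exact ⟨_, ⟨p, h, rfl⟩, (resQ_swap _ _ _).symm⟩
  -- The name that is sent may belong to either restriction, so exchanging them interchanges opening
  -- the outer scope with opening the inner one.
  · have e₀ : swap01 0 = 1 := rfl
    have e₁ : swap01 (0 + 1) = 0 := rfl
    have key : ∀ p : ProcQ Unit, renQ swap01 (renQ swap01 p) = p := fun p => by
      rw [renQ_renQ, swap01_comp_swap01, renQ_id]
    funext a r
    simp only [Proc.BOut, Proc.Out, Proc.Out_rename, Proc.BOut_rename, swap01_eq_iff, add_assoc,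
      Nat.reduceAdd, e, eq_iff_iff, e₀, e₁]
    constructor
    · rintro (⟨p, h, rfl⟩ | ⟨_, h | ⟨p, h, rfl⟩, rfl⟩)
      · exact .inr ⟨_, .inl ⟨_, _, _, rfl, rfl, h, rfl⟩, by rw [key]⟩
      · exact .inl ⟨_, ⟨_, _, _, rfl, rfl, h, rfl⟩, rfl⟩
      · exact .inr ⟨_, .inr ⟨_, ⟨_, _, rfl, h, rfl⟩, rfl⟩, lift_swap01_swap p⟩
    · rintro (⟨_, ⟨_, _, p, rfl, rfl, h, rfl⟩, rfl⟩ |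
        ⟨_, ⟨_, _, p, rfl, rfl, h, rfl⟩ | ⟨_, ⟨_, p, rfl, h, rfl⟩, rfl⟩, rfl⟩)
      · exact .inr ⟨_, .inl h, rfl⟩
      · exact .inl ⟨_, h, by rw [key]⟩
      · exact .inr ⟨_, .inr ⟨p, h, rfl⟩, (lift_swap01_swap p).symm⟩
  · funext r
    simp only [Proc.Tau, Proc.Tau_rename _ swap01_injective, eq_iff_iff]
    constructor
    · rintro ⟨_, ⟨p, h, rfl⟩, rfl⟩
      exact ⟨_, ⟨_, ⟨_, h, rfl⟩, rfl⟩, resQ_swap _ _ _⟩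
    · rintro ⟨_, ⟨_, ⟨p, h, rfl⟩, rfl⟩, rfl⟩
      exact ⟨_, ⟨p, h, rfl⟩, (resQ_swap _ _ _).symm⟩

/-- Two unfolded copies of `M` may communicate, which is why internal transitions of a replication
include a self-communication. With that clause an additional copy offers nothing new, and a copy
that stays idle is absorbed again. -/
theorem sameTransitions_unfold (M : Choice Unit) :
    SameTransitions (.bang M) (.par (.sum M) (.bang M)) := by
  have hb := Proc.q_bang M
  set S := (Proc.sum M).q with hS
  set B := (Proc.bang M).q with hB
  have h₁ : ∀ x : ProcQ Unit, x + B + S = x + B := fun x => by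
    rw [add_assoc, add_comm B S, ← hb]
  have h₂ : ∀ x : ProcQ Unit, x + renQ Nat.succ B + renQ Nat.succ S = x + renQ Nat.succ B :=
    fun x => by rw [add_assoc, ← map_add, add_comm B S, ← hb]
  refine ⟨?_, ?_, ?_, ?_⟩
  · funext a r
    simp only [Proc.In, ← hS, ← hB, eq_iff_iff]
    constructor
    · exact .inl
    · rintro (h | ⟨_, ⟨p, h, rfl⟩, rfl⟩)
      · exact h
      · exact ⟨p, h, h₂ p⟩
  · funext a b r
    simp only [Proc.Out, ← hS, ← hB, eq_iff_iff]
    constructor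
    · exact .inl
    · rintro (h | ⟨_, ⟨p, h, rfl⟩, rfl⟩)
      · exact h
      · exact ⟨p, h, h₁ p⟩
  · funext a r
    simp [Proc.BOut]
  · funext r
    simp only [Proc.Tau, Proc.Comm, Proc.In, Proc.Out, Proc.BOut, ← hS, ← hB, eq_iff_iff]
    constructor
    · rintro (h | ⟨a, b, p, q, h, h', rfl⟩)
      · exact .inl h
      · refine .inr (.inr (.inl (.inl ⟨a, b, p, _, h, ⟨q, h', rfl⟩, ?_⟩)))
        rw [map_add, renQ_inst_succ, add_assoc]
    · rintro (h | ⟨_, ⟨p, h, rfl⟩ | ⟨a, b, p, q, h, h', rfl⟩, rfl⟩ |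
        (⟨a, b, p, _, h, ⟨q, h', rfl⟩, rfl⟩ | ⟨_, _, _, h, _⟩) |
        (⟨a, b, _, q, ⟨p, h, rfl⟩, h', rfl⟩ | ⟨_, _, _, h, _⟩))
      · exact .inl h
      · exact .inl ⟨p, h, h₁ p⟩
      · exact .inr ⟨a, b, p, q, h, h', h₁ _⟩
      · exact .inr ⟨a, b, p, q, h, h', by rw [map_add, renQ_inst_succ, add_assoc]⟩
      · exact h.elim
      · exact .inr ⟨a, b, p, q, h, h', add_right_comm _ _ _⟩
      · exact h.elim

theorem res_swap_add_shift (p q : ProcQ Unit) :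
    resQ () (renQ swap01 p) + renQ Nat.succ q =
      resQ () (renQ swap01 (p + renQ Nat.succ (renQ Nat.succ q))) := by
  rw [resQ_add, map_add, renQ_renQ, renQ_renQ]
  rfl

theorem resQ_swap_lift_succ (p q : ProcQ Unit) :
    p + renQ Nat.succ (resQ () q) =
      resQ () (renQ swap01 (renQ (lift Nat.succ) p + renQ Nat.succ q)) := by
  rw [renQ_resQ, add_resQ, map_add, renQ_renQ, renQ_renQ, swap01_comp_lift_succ]
  congr 3
  congr 1
  funext i; rcases i with _ | i <;> rfl

theorem sameTransitions_extrude (τ : Unit) (P Q : PiTerm) :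
    SameTransitions (.par P (.res τ Q)) (.res τ (.par P.shift Q)) := by
  refine ⟨?_, ?_, ?_, ?_⟩
  · funext a r
    simp only [Proc.In, Proc.shift, Proc.In_rename, Proc.q_rename, Proc.q_res, eq_iff_iff]
    constructor
    · rintro (⟨p, h, rfl⟩ | ⟨_, ⟨p, h, rfl⟩, rfl⟩)
      · exact ⟨_, .inl ⟨_, ⟨_, _, rfl, h, rfl⟩, rfl⟩, resQ_swap_lift_succ _ _⟩
      · exact ⟨_, .inr ⟨_, h, rfl⟩, res_swap_add_shift _ _⟩
    · rintro ⟨_, ⟨_, ⟨a', p, e, h, rfl⟩, rfl⟩ | ⟨p, h, rfl⟩, rfl⟩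
      · obtain rfl := Nat.succ_injective e
        exact .inl ⟨p, h, (resQ_swap_lift_succ _ _).symm⟩
      · exact .inr ⟨_, ⟨p, h, rfl⟩, (res_swap_add_shift _ _).symm⟩
  · funext a b r
    simp only [Proc.Out, Proc.shift, Proc.Out_rename, Proc.q_rename, Proc.q_res, eq_iff_iff]
    constructor
    · rintro (⟨p, h, rfl⟩ | ⟨_, ⟨p, h, rfl⟩, rfl⟩)
      · exact ⟨_, .inl ⟨_, ⟨_, _, _, rfl, rfl, h, rfl⟩, rfl⟩, add_resQ _ _ _⟩
      · exact ⟨_, .inr ⟨_, h, rfl⟩, resQ_add _ _ _⟩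
    · rintro ⟨_, ⟨_, ⟨a', b', p, e, e', h, rfl⟩, rfl⟩ | ⟨p, h, rfl⟩, rfl⟩
      · obtain rfl := Nat.succ_injective e
        obtain rfl := Nat.succ_injective e'
        exact .inl ⟨p, h, (add_resQ _ _ _).symm⟩
      · exact .inr ⟨_, ⟨p, h, rfl⟩, (resQ_add _ _ _).symm⟩
  · funext a r
    simp only [Proc.BOut, Proc.Out, Proc.shift, Proc.Out_rename, Proc.BOut_rename, Proc.q_rename,
      Proc.q_res, eq_iff_iff]
    constructor
    · rintro (⟨p, h, rfl⟩ | ⟨_, h | ⟨p, h, rfl⟩, rfl⟩)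
      · exact .inr ⟨_, .inl ⟨_, ⟨_, _, rfl, h, rfl⟩, rfl⟩, resQ_swap_lift_succ _ _⟩
      · exact .inl (.inr ⟨_, h, rfl⟩)
      · exact .inr ⟨_, .inr ⟨_, h, rfl⟩, res_swap_add_shift _ _⟩
    · rintro ((⟨_, ⟨a', b', p, e, e', h, rfl⟩, rfl⟩ | ⟨p, h, rfl⟩) |
        ⟨_, ⟨_, ⟨a', p, e, h, rfl⟩, rfl⟩ | ⟨p, h, rfl⟩, rfl⟩)
      · exact absurd e' (Nat.succ_ne_zero _)
      · exact .inr ⟨_, .inl h, rfl⟩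
      · obtain rfl := Nat.succ_injective e
        exact .inl ⟨p, h, (resQ_swap_lift_succ _ _).symm⟩
      · exact .inr ⟨_, .inr ⟨p, h, rfl⟩, (res_swap_add_shift _ _).symm⟩
  · funext r
    simp only [Proc.Tau, Proc.Comm_res_left, Proc.Comm_res_right, eq_iff_iff]
    simp only [Proc.shift, Proc.Tau_rename _ Nat.succ_injective, Proc.q_rename, Proc.q_res]
    constructor
    · rintro (⟨p, h, rfl⟩ | ⟨_, ⟨p, h, rfl⟩, rfl⟩ | ⟨p, h, rfl⟩ | ⟨p, h, rfl⟩)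
      · exact ⟨_, .inl ⟨_, ⟨_, h, rfl⟩, rfl⟩, add_resQ _ _ _⟩
      · exact ⟨_, .inr (.inl ⟨_, h, rfl⟩), resQ_add _ _ _⟩
      · exact ⟨_, .inr (.inr (.inl h)), rfl⟩
      · exact ⟨_, .inr (.inr (.inr h)), rfl⟩
    · rintro ⟨_, ⟨_, ⟨p, h, rfl⟩, rfl⟩ | ⟨p, h, rfl⟩ | h | h, rfl⟩
      · exact .inl ⟨_, h, (add_resQ _ _ _).symm⟩
      · exact .inr (.inl ⟨_, ⟨_, h, rfl⟩, (resQ_add _ _ _).symm⟩)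
      · exact .inr (.inr (.inl ⟨_, h, rfl⟩))
      · exact .inr (.inr (.inr ⟨_, h, rfl⟩))

/-- The two choices have the same transitions. -/
def Choice.SameTransitions (M N : Choice Unit) : Prop :=
  M.In = N.In ∧ M.Out = N.Out ∧ M.Tau = N.Tau

/-- Because derivatives are taken modulo congruence, the usual bisimulation argument becomes an
equality of relations, and it suffices to check each law once. In the parallel case equal inputs and
outputs yield equal communications. -/
theorem Proc.Cong.sameTransitions {P Q : PiTerm} (h : P.Cong Q) : SameTransitions P Q := by
  refine Proc.Cong.rec (motive_1 := fun P Q _ => PiCalc.SameTransitions P Q)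
    (motive_2 := fun M N _ => Choice.SameTransitions M N)
    ?_ ?_ ?_ ?_ ?_ ?_ ?_ ?_ ?_ ?_ ?_ ?_ ?_ ?_ ?_ ?_ ?_ ?_ ?_ ?_ ?_ h
  · exact fun P => ⟨rfl, rfl, rfl, rfl⟩
  · exact fun _ ih => ⟨ih.1.symm, ih.2.1.symm, ih.2.2.1.symm, ih.2.2.2.symm⟩
  · exact fun _ _ ih ih' => ⟨ih.1.trans ih'.1, ih.2.1.trans ih'.2.1, ih.2.2.1.trans ih'.2.2.1,
      ih.2.2.2.trans ih'.2.2.2⟩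
  · rintro P Q τ _ ⟨h₁, h₂, h₃, h₄⟩
    refine ⟨?_, ?_, ?_, ?_⟩
    · funext a r; simp only [Proc.In, h₁]
    · funext a b r; simp only [Proc.Out, h₂]
    · funext a r; simp only [Proc.BOut, h₂, h₃]
    · funext r; simp only [Proc.Tau, h₄]
  · rintro P P' Q Q' e e' h h'
    have e := Proc.q_eq.2 e
    have e' := Proc.q_eq.2 e'
    refine ⟨?_, ?_, ?_, ?_⟩
    · funext a r; simp only [Proc.In, h.1, h'.1, e, e']
    · funext a b r; simp only [Proc.Out, h.2.1, h'.2.1, e, e']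
    · funext a r; simp only [Proc.BOut, h.2.2.1, h'.2.2.1, e, e']
    · funext r; simp only [Proc.Tau, h.2.2.2, h'.2.2.2, e, e', h.comm h', h'.comm h]
  · rintro M N _ ⟨h₁, h₂, h₃⟩
    exact ⟨h₁, h₂, rfl, h₃⟩
  · rintro M N e ⟨h₁, h₂, h₃⟩
    have e : (Proc.bang M).q = (Proc.bang N).q := Proc.q_eq.2 (.bang e)
    refine ⟨?_, ?_, rfl, ?_⟩
    · funext a r; simp only [Proc.In, h₁, e]
    · funext a b r; simp only [Proc.Out, h₂, e]
    · funext r; simp only [Proc.Tau, h₁, h₂, h₃, e]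
  · exact sameTransitions_par_comm
  · exact sameTransitions_par_assoc
  · exact sameTransitions_par_nil
  · exact sameTransitions_res_nil
  · exact sameTransitions_res_swap
  · exact sameTransitions_unfold
  · exact sameTransitions_extrude
  · exact fun P => ⟨rfl, rfl, rfl⟩
  · exact fun _ ih => ⟨ih.1.symm, ih.2.1.symm, ih.2.2.symm⟩
  · exact fun _ _ ih ih' => ⟨ih.1.trans ih'.1, ih.2.1.trans ih'.2.1, ih.2.2.trans ih'.2.2⟩
  · intro P Q π h _
    have e := Proc.q_eq.2 h
    cases π <;> refine ⟨?_, ?_, ?_⟩ <;> funext <;> simp only [Choice.In, Choice.Out, Choice.Tau, e]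
  · rintro M M' N N' _ _ ⟨h₁, h₂, h₃⟩ ⟨h₁', h₂', h₃'⟩
    refine ⟨?_, ?_, ?_⟩
    · funext a r; simp only [Choice.In, h₁, h₁']
    · funext a b r; simp only [Choice.Out, h₂, h₂']
    · funext r; simp only [Choice.Tau, h₃, h₃']
  · intro M N
    refine ⟨?_, ?_, ?_⟩
    · funext a r; exact propext or_comm
    · funext a b r; exact propext or_comm
    · funext r; exact propext or_comm
  · intro M N O
    refine ⟨?_, ?_, ?_⟩
    · funext a r; exact propext or_assoc
    · funext a b r; exact propext or_assoc
    · funext r; exact propext or_assoc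

/-! ### Transitions of congruence classes -/

def ProcQ.In (p : ProcQ Unit) : ℕ → ProcQ Unit → Prop :=
  Quotient.lift Proc.In (fun _ _ h => (Proc.Cong.sameTransitions h).1) p
def ProcQ.Out (p : ProcQ Unit) : ℕ → ℕ → ProcQ Unit → Prop :=
  Quotient.lift Proc.Out (fun _ _ h => (Proc.Cong.sameTransitions h).2.1) p
def ProcQ.BOut (p : ProcQ Unit) : ℕ → ProcQ Unit → Prop :=
  Quotient.lift Proc.BOut (fun _ _ h => (Proc.Cong.sameTransitions h).2.2.1) p
def ProcQ.Tau (p : ProcQ Unit) : ProcQ Unit → Prop :=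
  Quotient.lift Proc.Tau (fun _ _ h => (Proc.Cong.sameTransitions h).2.2.2) p

/-- A message of `x` is received by `y`. -/
def ProcQ.Comm (x y r : ProcQ Unit) : Prop :=
  (∃ a b p q, x.Out a b p ∧ y.In a q ∧ r = p + renQ (inst b) q) ∨
  (∃ a p q, x.BOut a p ∧ y.In a q ∧ r = resQ () (p + q))

theorem ProcQ.Tau_add (x y r : ProcQ Unit) : (x + y).Tau r ↔
    (∃ p, x.Tau p ∧ r = p + y) ∨ (∃ p, y.Tau p ∧ r = p + x) ∨ x.Comm y r ∨ y.Comm x r := by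
  induction x using ProcQ.ind; induction y using ProcQ.ind
  exact Iff.rfl

theorem ProcQ.Comm_add_left (x y z r : ProcQ Unit) : (x + y).Comm z r ↔
    (∃ p, x.Comm z p ∧ r = p + y) ∨ (∃ p, y.Comm z p ∧ r = p + x) := by
  induction x using ProcQ.ind; induction y using ProcQ.ind; induction z using ProcQ.ind
  exact Proc.Comm_par_left _ _ _ _

theorem ProcQ.Comm_add_right (x y z r : ProcQ Unit) : z.Comm (x + y) r ↔
    (∃ p, z.Comm x p ∧ r = p + y) ∨ (∃ p, z.Comm y p ∧ r = p + x) := by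
  induction x using ProcQ.ind; induction y using ProcQ.ind; induction z using ProcQ.ind
  exact Proc.Comm_par_right _ _ _ _

theorem ProcQ.not_tau_zero (r : ProcQ Unit) : ¬ (0 : ProcQ Unit).Tau r := id

theorem ProcQ.not_comm_zero_left (x r : ProcQ Unit) : ¬ (0 : ProcQ Unit).Comm x r := by
  rintro (⟨_, _, _, _, h, _⟩ | ⟨_, _, _, h, _⟩) <;> exact h

theorem ProcQ.not_comm_zero_right (x r : ProcQ Unit) : ¬ x.Comm 0 r := by
  rintro (⟨_, _, _, _, _, h, _⟩ | ⟨_, _, _, _, h, _⟩) <;> exact h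

theorem ProcQ.comm_sum_right {x r : ProcQ Unit} {s : Multiset (ProcQ Unit)} (h : x.Comm s.sum r) :
    ∃ y t z, s = y ::ₘ t ∧ x.Comm y z ∧ r = z + t.sum := by
  induction s using Multiset.induction generalizing r with
  | empty => exact absurd h (ProcQ.not_comm_zero_right _ _)
  | cons y s ih =>
      rw [Multiset.sum_cons, ProcQ.Comm_add_right] at h
      rcases h with ⟨p, h, rfl⟩ | ⟨p, h, rfl⟩
      · exact ⟨y, s, p, rfl, h, rfl⟩
      · obtain ⟨z, t, w, rfl, h', rfl⟩ := ih h
        exact ⟨z, y ::ₘ t, w, Multiset.cons_swap _ _ _, h', by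
          rw [Multiset.sum_cons, add_assoc, add_comm y]⟩

theorem ProcQ.comm_sum_left {x r : ProcQ Unit} {s : Multiset (ProcQ Unit)} (h : s.sum.Comm x r) :
    ∃ y t z, s = y ::ₘ t ∧ y.Comm x z ∧ r = z + t.sum := by
  induction s using Multiset.induction generalizing r with
  | empty => exact absurd h (ProcQ.not_comm_zero_left _ _)
  | cons y s ih =>
      rw [Multiset.sum_cons, ProcQ.Comm_add_left] at h
      rcases h with ⟨p, h, rfl⟩ | ⟨p, h, rfl⟩
      · exact ⟨y, s, p, rfl, h, rfl⟩
      · obtain ⟨z, t, w, rfl, h', rfl⟩ := ih h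
        exact ⟨z, y ::ₘ t, w, Multiset.cons_swap _ _ _, h', by
          rw [Multiset.sum_cons, add_assoc, add_comm y]⟩

/-- An internal transition of a parallel composition is an internal transition of a component, or
a communication of two components. -/
theorem ProcQ.tau_sum {r : ProcQ Unit} {s : Multiset (ProcQ Unit)} (h : s.sum.Tau r) :
    (∃ x t z, s = x ::ₘ t ∧ x.Tau z ∧ r = z + t.sum) ∨
    (∃ x y t z, s = x ::ₘ y ::ₘ t ∧ x.Comm y z ∧ r = z + t.sum) := by
  induction s using Multiset.induction generalizing r with
  | empty => exact absurd h (ProcQ.not_tau_zero _)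
  | cons x s ih =>
      rw [Multiset.sum_cons, ProcQ.Tau_add] at h
      rcases h with ⟨p, h, rfl⟩ | ⟨p, h, rfl⟩ | h | h
      · exact .inl ⟨x, s, p, rfl, h, rfl⟩
      · rcases ih h with ⟨y, t, z, rfl, h', rfl⟩ | ⟨y, w, t, z, rfl, h', rfl⟩
        · exact .inl ⟨y, x ::ₘ t, z, Multiset.cons_swap _ _ _, h', by
            rw [Multiset.sum_cons, add_assoc, add_comm x]⟩
        · refine .inr ⟨y, w, x ::ₘ t, z, ?_, h', by
            rw [Multiset.sum_cons, add_assoc, add_comm x]⟩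
          rw [Multiset.cons_swap x y, Multiset.cons_swap x w]
      · obtain ⟨y, t, z, rfl, h', rfl⟩ := ProcQ.comm_sum_right h
        exact .inr ⟨x, y, t, z, rfl, h', rfl⟩
      · obtain ⟨y, t, z, rfl, h', rfl⟩ := ProcQ.comm_sum_left h
        exact .inr ⟨y, x, t, z, Multiset.cons_swap _ _ _, h', rfl⟩

/-! ### Reductions are internal transitions -/

theorem Proc.tau_resList (W : List Unit) (P : PiTerm) (p : ProcQ Unit) (h : P.Tau p) :
    (resList W P).Tau (resListQ W p) := by
  induction W with
  | nil => exact h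
  | cons τ W ih => exact ⟨_, ih, rfl⟩

/-- The normal form hidden in `Step` performs the transition visibly, and transitions do not depend
on the representative. Reductions of a concrete term can thus be inverted by inspecting its syntax.
-/
theorem Step.tau_q {P Q : PiTerm} (h : Step P Q) : P.q.Tau Q.q := by
  -- Without annotations there is nothing to change in the activated restrictions.
  have e : ∀ Y Y' : List Unit, Y'.length = Y.length → Y' = Y := fun Y Y' h =>
    List.ext_getElem h fun _ _ _ => rfl
  cases h with
  | comm W Ys Yr Ys' Yr' S R C Ms Mr a b hP hnf hs hr hQ =>
      rw [Proc.q_eq.2 hP, Proc.q_eq.2 hQ, e _ _ hs, e _ _ hr]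
      set P₁ := resList Ys (parList S)
      set P₂ := resList Yr (parList R)
      rw [Proc.q_resList, Proc.q_resList, Proc.q_parList, List.map_cons, List.map_cons,
        List.sum_cons, List.sum_cons, ← Proc.q_parList, ← Proc.q_par, ← Proc.q_par,
        ← Proc.q_resList]
      refine Proc.tau_resList _ _ _ ?_
      have h₁ : (Proc.sum ((Choice.pre (.out a b) P₁).plusOpt Ms)).Out a b P₁.q := by
        cases Ms
        · exact ⟨rfl, rfl, rfl⟩
        · exact .inl ⟨rfl, rfl, rfl⟩
      have h₂ : (Proc.sum ((Choice.pre (.inp a) P₂).plusOpt Mr)).In a P₂.q := by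
        cases Mr
        · exact ⟨rfl, rfl⟩
        · exact .inl ⟨rfl, rfl⟩
      refine .inr (.inr (.inl (.inl ⟨a, b, _, _, h₁, .inl ⟨_, h₂, rfl⟩, ?_⟩)))
      rw [map_add, renQ_inst_succ]; rfl
  | tau W Y Y' S C hP hnf hy hQ =>
      rw [Proc.q_eq.2 hP, Proc.q_eq.2 hQ, e _ _ hy, Proc.q_resList, Proc.q_resList, Proc.q_parList,
        List.map_cons, List.sum_cons, ← Proc.q_parList, ← Proc.q_par, ← Proc.q_resList]
      exact Proc.tau_resList _ _ _ (.inl ⟨_, rfl, rfl⟩)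

end PiCalc

-- The states of the encoding and the reductions between them

namespace PiCalc

/-! ## Annotated encodings

The restrictions of counter cells are annotated by `t`, all other restrictions by `x`. -/

section Encoding
variable {α : Type} (t x : α)

/-- The type of annotations is left open: `Unit` gives the encoding itself, base types serve for
hierarchical annotations, and the types `Ty` for typing. -/
def inZA (c : ℕ) (P : Proc α) : Choice α := .pre (.inp c) P.shift

def outZA (c : ℕ) (P : Proc α) : Proc α := .res x (.sum (.pre (.out (c + 1) 0) P.shift))

def outZ2A (c : ℕ) (P : Proc α) (d : ℕ) (Q : Proc α) : Proc α :=
  .res x (.sum (.plus (.pre (.out (c + 1) 0) P.shift) (.pre (.out (d + 1) 0) Q.shift)))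

def msgA (a b : ℕ) : Proc α := .sum (.pre (.out a b) .nil)

/-- The body of a counter below its parameter. -/
def counterBodyA (i : ℕ) : Choice α :=
  .plus (inZA (nInc i + 1) (.par (outZA x 0 .nil) (msgA (nP i + 1) 0)))
    (.plus (inZA (nDec i + 1) (.sum (inZA 0 (msgA (nP i + 1) 0))))
      (inZA (nRst i + 1) (.res t (msgA (nP i + 2) 0))))

def counterA (i : ℕ) : Proc α := .bang (.pre (.inp (nP i)) (.sum (counterBodyA t x i)))

/-- What an instruction does after it has been fetched. -/
def bodyA {k n : ℕ} : Instr k n → Proc α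
  | .inc i j => outZA x (nInc i) (outZA x (nLoc j) .nil)
  | .dec i j₁ j₂ => outZ2A x (nDec i) (outZA x (nLoc j₁) .nil) (nRst i) (outZA x (nLoc j₂) .nil)

def instrA {k n : ℕ} (m : Fin n) (I : Instr k n) : Proc α :=
  .bang (inZA (nLoc m) (bodyA x I))

def cellA (i r : ℕ) : Proc α :=
  .res t (.par (msgA (nP i + 1) 0) (parList (List.replicate r (outZA x 0 .nil))))

def encodeA {k n : ℕ} (M : Machine k n) (c : Config k n) : Proc α :=
  .par (parList (List.ofFn fun i : Fin k => cellA t x i (c.reg i)))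
  (.par (parList (List.ofFn fun i : Fin k => counterA t x i))
  (.par (outZA x (nLoc c.pc) .nil)
        (parList (List.ofFn fun m : Fin n => instrA x m (M m)))))

end Encoding

theorem encode_eq {k n : ℕ} (M : Machine k n) (c : Config k n) :
    encode M c = encodeA () () M c := by
  have h : ∀ m : Fin n, encInstr m (M m) = instrA () m (M m) := by
    intro m; cases h : M m <;> rfl
  simp only [encode, h]; rfl

/-! ## States of the encoding -/

/-- The states of a counter cell: its parameter is offered to the counter; the counter has the
parameter and waits for a request; a decrement is waiting for a token. -/
inductive Mode : Type
  | ready | choosing | waiting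

/-- States that the encoding of a machine can reach: the current instruction, whether it has been
fetched already, the states and values of the counter cells, and the values of the cells that have
been reset. -/
structure EncState (k n : ℕ) where
  fetched : Bool
  pc : Fin n
  mode : Fin k → Mode
  reg : Fin k → ℕ
  garbage : Multiset ℕ

/-- The state that represents a configuration. -/
def Config.state {k n : ℕ} (c : Config k n) : EncState k n :=
  ⟨false, c.pc, fun _ => .ready, c.reg, 0⟩

open Function in
/-- Reductions of the encoding. -/
inductive EncState.Step {k n : ℕ} (M : Machine k n) : EncState k n → EncState k n → Prop
  | fetch (s : EncState k n) (h : s.fetched = false) :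
      Step M s ⟨true, s.pc, s.mode, s.reg, s.garbage⟩
  | offer (s : EncState k n) (i : Fin k) (h : s.mode i = .ready) :
      Step M s ⟨s.fetched, s.pc, update s.mode i .choosing, s.reg, s.garbage⟩
  | inc (s : EncState k n) (i : Fin k) (j : Fin n) (h : s.fetched = true) (h' : M s.pc = .inc i j)
      (hi : s.mode i = .choosing) :
      Step M s ⟨false, j, update s.mode i .ready, update s.reg i (s.reg i + 1), s.garbage⟩
  | dec (s : EncState k n) (i : Fin k) (j₁ j₂ : Fin n) (h : s.fetched = true)
      (h' : M s.pc = .dec i j₁ j₂) (hi : s.mode i = .choosing) :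
      Step M s ⟨false, j₁, update s.mode i .waiting, s.reg, s.garbage⟩
  | rst (s : EncState k n) (i : Fin k) (j₁ j₂ : Fin n) (h : s.fetched = true)
      (h' : M s.pc = .dec i j₁ j₂) (hi : s.mode i = .choosing) :
      Step M s ⟨false, j₂, update s.mode i .ready, update s.reg i 0, s.reg i ::ₘ s.garbage⟩
  | token (s : EncState k n) (i : Fin k) (r : ℕ) (h : s.mode i = .waiting) (hr : s.reg i = r + 1) :
      Step M s ⟨s.fetched, s.pc, update s.mode i .ready, update s.reg i r, s.garbage⟩

section Components
variable {α : Type} (t x : α)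

def headA (i : ℕ) : Mode → Proc α
  | .ready => msgA (nP i + 1) 0
  | .choosing => .sum (counterBodyA t x i)
  | .waiting => .sum (inZA 0 (msgA (nP i + 1) 0))

/-- The tokens of a counter cell with value `r`. -/
def tokensQ (r : ℕ) : ProcQ α := r • (outZA x 0 .nil).q

def cellQ (i : ℕ) (m : Mode) (r : ℕ) : ProcQ α := resQ t ((headA t x i m).q + tokensQ x r)

def garbageQ (r : ℕ) : ProcQ α := resQ t (tokensQ x r)

def controlA {k n : ℕ} (M : Machine k n) (pc : Fin n) : Bool → Proc α
  | false => outZA x (nLoc pc) .nil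
  | true => bodyA x (M pc)

variable {k n : ℕ} (M : Machine k n) (s : EncState k n)

/-- The components other than the counter cells and the control. -/
def EncState.others : Multiset (ProcQ α) :=
  (Finset.univ : Finset (Fin k)).val.map (fun i : Fin k => (counterA t x i).q) +
  ((Finset.univ : Finset (Fin n)).val.map (fun m : Fin n => (instrA x m (M m)).q) +
    s.garbage.map (garbageQ t x))

def EncState.cells (mode : Fin k → Mode) (reg : Fin k → ℕ) : Multiset (ProcQ α) :=
  (Finset.univ : Finset (Fin k)).val.map (fun i : Fin k => cellQ t x i (mode i) (reg i))

/-- The parallel components of a state. -/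
def EncState.comps : Multiset (ProcQ α) :=
  (controlA x M s.pc s.fetched).q ::ₘ (EncState.cells t x s.mode s.reg + s.others t x M)

/-- The process that a state stands for. -/
def EncState.enc : ProcQ α := (s.comps t x M).sum

def otherCells (mode : Fin k → Mode) (reg : Fin k → ℕ) (i : Fin k) : Multiset (ProcQ α) :=
  ((Finset.univ : Finset (Fin k)).erase i).val.map (fun j : Fin k => cellQ t x j (mode j) (reg j))

theorem cells_eq (mode : Fin k → Mode) (reg : Fin k → ℕ) (i : Fin k) :
    EncState.cells t x mode reg = cellQ t x i (mode i) (reg i) ::ₘ otherCells t x mode reg i := by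
  have h : (Finset.univ : Finset (Fin k)).val = i ::ₘ (Finset.univ.erase i).val := by
    rw [Finset.erase_val, Multiset.cons_erase (Finset.mem_univ i)]
  rw [EncState.cells, h, Multiset.map_cons]; rfl

theorem otherCells_congr (mode mode' : Fin k → Mode) (reg reg' : Fin k → ℕ) (i : Fin k)
    (h : ∀ j, j ≠ i → mode j = mode' j) (h' : ∀ j, j ≠ i → reg j = reg' j) :
    otherCells t x mode reg i = otherCells t x mode' reg' i := by
  refine Multiset.map_congr rfl fun j hj => ?_
  rw [Finset.mem_val] at hj
  have hj : j ≠ i := Finset.ne_of_mem_erase hj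
  rw [h j hj, h' j hj]

open Function in
theorem cells_update (mode : Fin k → Mode) (reg : Fin k → ℕ) (i : Fin k) (m : Mode) (r : ℕ) :
    EncState.cells t x (update mode i m) (update reg i r) =
      cellQ t x i m r ::ₘ otherCells t x mode reg i := by
  rw [cells_eq t x _ _ i, update_self, update_self]
  congr 1
  exact otherCells_congr t x _ _ _ _ _ (fun j hj => update_of_ne hj _ _)
    fun j hj => update_of_ne hj _ _

open Function in
theorem cells_update_mode (mode : Fin k → Mode) (reg : Fin k → ℕ) (i : Fin k) (m : Mode) :
    EncState.cells t x (update mode i m) reg =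
      cellQ t x i m (reg i) ::ₘ otherCells t x mode reg i := by
  rw [← cells_update, update_eq_self]

def otherCounters (i : Fin k) : Multiset (ProcQ α) :=
  ((Finset.univ : Finset (Fin k)).erase i).val.map (fun j : Fin k => (counterA t x j).q)

theorem counters_eq (i : Fin k) :
    (Finset.univ : Finset (Fin k)).val.map (fun i : Fin k => (counterA t x i).q) =
      (counterA t x i).q ::ₘ otherCounters t x i := by
  have h : (Finset.univ : Finset (Fin k)).val = i ::ₘ (Finset.univ.erase i).val := by
    rw [Finset.erase_val, Multiset.cons_erase (Finset.mem_univ i)]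
  rw [h, Multiset.map_cons]; rfl

def otherInstrs (m : Fin n) : Multiset (ProcQ α) :=
  ((Finset.univ : Finset (Fin n)).erase m).val.map (fun j : Fin n => (instrA x j (M j)).q)

theorem instrs_eq (m : Fin n) :
    (Finset.univ : Finset (Fin n)).val.map (fun m : Fin n => (instrA x m (M m)).q) =
      (instrA x m (M m)).q ::ₘ otherInstrs x M m := by
  have h : (Finset.univ : Finset (Fin n)).val = m ::ₘ (Finset.univ.erase m).val := by
    rw [Finset.erase_val, Multiset.cons_erase (Finset.mem_univ m)]
  rw [h, Multiset.map_cons]; rfl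

/-- The components without the counter cell `i` and the counter `i`. -/
def EncState.restOffer (i : Fin k) : Multiset (ProcQ α) :=
  (controlA x M s.pc s.fetched).q ::ₘ (otherCells t x s.mode s.reg i + (otherCounters t x i +
    ((Finset.univ : Finset (Fin n)).val.map (fun m : Fin n => (instrA x m (M m)).q) +
    s.garbage.map (garbageQ t x))))

/-- Splitting a state into the components that react and a rest: as the step does not touch the
rest, the new state splits with the same rest, and the reaction can be studied in isolation. -/
theorem EncState.comps_offer (i : Fin k) : s.comps t x M =
    cellQ t x i (s.mode i) (s.reg i) ::ₘ (counterA t x i).q ::ₘ s.restOffer t x M i := by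
  rw [EncState.comps, cells_eq t x _ _ i, EncState.others, counters_eq t x i]
  simp only [Multiset.cons_add, Multiset.add_cons, EncState.restOffer]
  rw [Multiset.cons_swap (controlA x M s.pc s.fetched).q,
    Multiset.cons_swap (controlA x M s.pc s.fetched).q, Multiset.cons_swap (counterA t x i).q]

/-- The components without the control and the current instruction. -/
def EncState.restFetch : Multiset (ProcQ α) :=
  EncState.cells t x s.mode s.reg +
    ((Finset.univ : Finset (Fin k)).val.map (fun i : Fin k => (counterA t x i).q) +
    (otherInstrs x M s.pc + s.garbage.map (garbageQ t x)))

theorem EncState.comps_fetch : s.comps t x M =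
    (controlA x M s.pc s.fetched).q ::ₘ (instrA x s.pc (M s.pc)).q ::ₘ s.restFetch t x M := by
  rw [EncState.comps, EncState.others, instrs_eq x M s.pc]
  simp only [Multiset.cons_add, Multiset.add_cons, EncState.restFetch]

/-- The components without the control and the counter cell `i`. -/
def EncState.restCell (i : Fin k) : Multiset (ProcQ α) :=
  otherCells t x s.mode s.reg i + s.others t x M

theorem EncState.comps_cell (i : Fin k) : s.comps t x M =
    (controlA x M s.pc s.fetched).q ::ₘ cellQ t x i (s.mode i) (s.reg i) ::ₘ
      s.restCell t x M i := by
  rw [EncState.comps, cells_eq t x _ _ i, Multiset.cons_add]; rfl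

/-! ### The processes of the states after a step -/

open Function

theorem enc_offer (i : Fin k) : EncState.enc t x M
      ⟨s.fetched, s.pc, update s.mode i .choosing, s.reg, s.garbage⟩ =
    cellQ t x i .choosing (s.reg i) + (counterA t x i).q + (s.restOffer t x M i).sum := by
  have e : EncState.restOffer t x M
      ⟨s.fetched, s.pc, update s.mode i .choosing, s.reg, s.garbage⟩ i = s.restOffer t x M i := by
    rw [EncState.restOffer, EncState.restOffer]
    simp only
    rw [otherCells_congr t x (update s.mode i Mode.choosing) s.mode _ s.reg _
      (fun j hj => update_of_ne hj _ _) fun _ _ => rfl]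
  rw [EncState.enc, EncState.comps_offer t x M _ i, e]
  simp only [update_self, Multiset.sum_cons, add_assoc]

theorem enc_fetch : EncState.enc t x M ⟨true, s.pc, s.mode, s.reg, s.garbage⟩ =
    (bodyA x (M s.pc)).q + (instrA x s.pc (M s.pc)).q + (s.restFetch t x M).sum := by
  rw [EncState.enc, EncState.comps_fetch t x M _]
  simp only [Multiset.sum_cons, add_assoc]; rfl

theorem enc_inc (i : Fin k) (j : Fin n) : EncState.enc t x M
      ⟨false, j, update s.mode i .ready, update s.reg i (s.reg i + 1), s.garbage⟩ =
    (outZA x (nLoc j) .nil).q + cellQ t x i .ready (s.reg i + 1) + (s.restCell t x M i).sum := by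
  simp only [EncState.enc, EncState.comps, cells_update, EncState.restCell, Multiset.sum_cons,
    Multiset.cons_add, add_assoc]; rfl

theorem enc_dec (i : Fin k) (j : Fin n) : EncState.enc t x M
      ⟨false, j, update s.mode i .waiting, s.reg, s.garbage⟩ =
    (outZA x (nLoc j) .nil).q + cellQ t x i .waiting (s.reg i) + (s.restCell t x M i).sum := by
  simp only [EncState.enc, EncState.comps, cells_update_mode, EncState.restCell, Multiset.sum_cons,
    Multiset.cons_add, add_assoc]; rfl

theorem enc_rst (i : Fin k) (j : Fin n) : EncState.enc t x M
      ⟨false, j, update s.mode i .ready, update s.reg i 0, s.reg i ::ₘ s.garbage⟩ =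
    (outZA x (nLoc j) .nil).q + (garbageQ t x (s.reg i) + cellQ t x i .ready 0) +
      (s.restCell t x M i).sum := by
  simp only [EncState.enc, EncState.comps, cells_update, EncState.restCell, EncState.others,
    Multiset.sum_cons, Multiset.cons_add, Multiset.map_cons, Multiset.sum_add, controlA]
  abel

theorem enc_token (i : Fin k) (r : ℕ) : EncState.enc t x M
      ⟨s.fetched, s.pc, update s.mode i .ready, update s.reg i r, s.garbage⟩ =
    cellQ t x i .ready r + ((controlA x M s.pc s.fetched).q + (s.restCell t x M i).sum) := by
  simp only [EncState.enc, EncState.comps, cells_update, EncState.restCell, Multiset.sum_cons,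
    Multiset.cons_add]
  rw [add_left_comm]; rfl

end Components

/-! ## The steps of the states are reductions -/

section Forward
variable {α : Type} (t x : α)

theorem renQ_inst_lift_succ {α : Type} (p : ProcQ α) :
    renQ (inst 0) (renQ (lift Nat.succ) p) = p := by
  rw [renQ_renQ, inst_zero_comp_lift_succ, renQ_id]

theorem Proc.shift_rename_lift {α : Type} (f : ℕ → ℕ) (P : Proc α) :
    P.shift.rename (lift f) = (P.rename f).shift := by
  rw [Proc.shift, Proc.shift, Proc.rename_rename, Proc.rename_rename, lift_comp_succ]

/-- A nullary output meets a nullary input. -/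
theorem Red.handshake (c : ℕ) (P Q : Proc α) (Ms Mr : Option (Choice α)) :
    Red (resQ x (Proc.sum ((Choice.pre (.out (c + 1) 0) P.shift).plusOpt Ms)).q +
      (Proc.sum ((inZA c Q).plusOpt Mr)).q) (P.q + Q.q) := by
  have h := (Red.react (c + 1) 0 P.shift (Q.shift.rename (lift Nat.succ)) Ms
    (Mr.map (Choice.rename Nat.succ))).res x
  -- Neither continuation mentions the transmitted name, so both are weakenings and the restriction
  -- can be dropped.
  have e : (P.shift).q + ((Q.shift.rename (lift Nat.succ)).subst 0).q =
      renQ Nat.succ (P.q + Q.q) := by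
    rw [Proc.q_subst, Proc.q_rename, renQ_inst_lift_succ, Proc.q_shift, Proc.q_shift, map_add]
  rw [e, resQ_shift] at h
  rw [resQ_add, ← Proc.q_rename]
  simp only [Proc.rename, Choice.plusOpt_rename]
  exact h

theorem Red.fetch {k n : ℕ} (m : Fin n) (I : Instr k n) :
    Red ((outZA x (nLoc m) .nil).q + (instrA x m I).q) ((bodyA x I).q + (instrA x m I).q) := by
  have h := (Red.handshake x (nLoc m) .nil (bodyA x I) none none).par (instrA x m I).q
  rw [Proc.q_nil, zero_add, add_assoc] at h
  have e : (instrA x m I).q = (Proc.sum (inZA (nLoc m) (bodyA x I))).q + (instrA x m I).q :=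
    Proc.q_bang _
  nth_rw 1 [e]
  exact h

/-- One copy of the counter is unfolded and moved, with the replication, into the scope of the cell
name. It receives that name and stays there as the new head of the cell, while the replication moves
out again. -/
theorem Red.offer (i r : ℕ) : Red (cellQ t x i .ready r + (counterA t x i).q)
    (cellQ t x i .choosing r + (counterA t x i).q) := by
  have h := ((Red.react (nP i + 1) 0 .nil ((Proc.sum (counterBodyA t x i)).rename (lift Nat.succ))
    none none).par (tokensQ x r + renQ Nat.succ (counterA t x i).q)).res t
  rw [Proc.q_subst, Proc.q_rename, renQ_inst_lift_succ, Proc.q_nil, zero_add] at h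
  have e : (counterA t x i).q = (Proc.sum (.pre (.inp (nP i)) (.sum (counterBodyA t x i)))).q +
    (counterA t x i).q := Proc.q_bang _
  rw [cellQ, cellQ]
  nth_rw 1 [e]
  rw [resQ_add, resQ_add, map_add]
  rw [← add_assoc] at h
  convert h using 2
  · simp only [headA]
    rw [add_add_add_comm, ← add_assoc]
    rfl
  · rw [add_assoc]; rfl

/-- The request comes from outside the scope of the cell name, so the sender is moved into that
scope and its continuation leaves it afterwards. The hypothesis `h` lets any of the three branches
of the counter body be brought to the front by associativity and commutativity of choice. -/
theorem cellQ_handshake (i c r : ℕ) (P Q : Proc α) (Ms Mr : Option (Choice α))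
    (h : (Proc.sum (counterBodyA t x i)).q = (Proc.sum ((inZA (c + 1) Q).plusOpt Mr)).q) :
    Red (resQ x (Proc.sum ((Choice.pre (.out (c + 1) 0) P.shift).plusOpt Ms)).q +
      cellQ t x i .choosing r) (P.q + resQ t (Q.q + tokensQ x r)) := by
  have h' := ((Red.handshake x (c + 1) P.shift Q (Ms.map (Choice.rename (lift Nat.succ))) Mr).par
    (tokensQ x r)).res t
  have e : P.q + resQ t (Q.q + tokensQ x r) = resQ t (P.shift.q + Q.q + tokensQ x r) := by
    rw [add_resQ, Proc.q_shift, add_assoc]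
  rw [e]
  convert h' using 1
  rw [cellQ, add_resQ, renQ_resQ, ← Proc.q_rename, headA, h, add_assoc]
  simp only [Proc.rename, Choice.plusOpt_rename, Choice.rename, Pre.rename, Pre.under,
    Proc.shift_rename_lift]
  rfl

theorem Red.inc {k n : ℕ} (i : Fin k) (j : Fin n) (r : ℕ) :
    Red ((bodyA x (Instr.inc i j)).q + cellQ t x i .choosing r)
      ((outZA x (nLoc j) .nil).q + cellQ t x i .ready (r + 1)) := by
  have h := cellQ_handshake t x i (nInc i) r (outZA x (nLoc j) .nil)
    (.par (outZA x 0 .nil) (msgA (nP i + 1) 0)) none (some _) rfl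
  have e : cellQ t x i .ready (r + 1) =
      resQ t ((Proc.par (outZA x 0 .nil) (msgA (nP i + 1) 0)).q + tokensQ x r) := by
    rw [cellQ, Proc.q_par, tokensQ, tokensQ, succ_nsmul, headA]
    congr 1
    abel
  rw [e]
  exact h

theorem Red.dec {k n : ℕ} (i : Fin k) (j₁ j₂ : Fin n) (r : ℕ) :
    Red ((bodyA x (Instr.dec i j₁ j₂)).q + cellQ t x i .choosing r)
      ((outZA x (nLoc j₁) .nil).q + cellQ t x i .waiting r) := by
  refine cellQ_handshake t x i (nDec i) r (outZA x (nLoc j₁) .nil)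
    (.sum (inZA 0 (msgA (nP i + 1) 0))) (some _)
    (some (.plus (inZA (nRst i + 1) (.res t (msgA (nP i + 2) 0)))
      (inZA (nInc i + 1) (.par (outZA x 0 .nil) (msgA (nP i + 1) 0))))) ?_
  exact Proc.q_eq.2 (.sum ((Choice.Cong.plus_comm _ _).trans (.plus_assoc _ _ _)))

/-- After a reset the fresh cell does not mention the old cell name, and the tokens do not mention
the fresh one. The two scopes therefore separate, and the tokens are left without a head. -/
theorem garbage_add_cell (i r : ℕ) : resQ t ((Proc.res t (msgA (nP i + 2) 0)).q + tokensQ x r) =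
    garbageQ t x r + cellQ t x i .ready 0 := by
  have : (Proc.res t (msgA (nP i + 2) 0)).q = renQ Nat.succ (cellQ t x i .ready 0) := by
    rw [cellQ, tokensQ, zero_smul, add_zero, ← Proc.q_res, ← Proc.q_rename]; rfl
  rw [this, garbageQ, resQ_add, add_comm]

theorem Red.rst {k n : ℕ} (i : Fin k) (j₁ j₂ : Fin n) (r : ℕ) :
    Red ((bodyA x (Instr.dec i j₁ j₂)).q + cellQ t x i .choosing r)
      ((outZA x (nLoc j₂) .nil).q + (garbageQ t x r + cellQ t x i .ready 0)) := by
  rw [← garbage_add_cell]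
  have e : (bodyA x (Instr.dec i j₁ j₂)).q = resQ x (Proc.sum ((Choice.pre (.out (nRst i + 1) 0)
      (outZA x (nLoc j₂) .nil).shift).plusOpt (some (Choice.pre (.out (nDec i + 1) 0)
      (outZA x (nLoc j₁) .nil).shift)))).q :=
    Proc.q_eq.2 (.res _ (.sum (.plus_comm _ _)))
  rw [e]
  refine cellQ_handshake t x i (nRst i) r (outZA x (nLoc j₂) .nil) (.res t (msgA (nP i + 2) 0))
    (some _) (some (.plus (inZA (nInc i + 1) (.par (outZA x 0 .nil) (msgA (nP i + 1) 0)))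
      (inZA (nDec i + 1) (.sum (inZA 0 (msgA (nP i + 1) 0)))))) ?_
  exact Proc.q_eq.2 (.sum ((Choice.Cong.plus_assoc _ _ _).symm.trans (.plus_comm _ _)))

theorem Red.token (i r : ℕ) : Red (cellQ t x i .waiting (r + 1)) (cellQ t x i .ready r) := by
  have h := ((Red.handshake x 0 .nil (msgA (nP i + 1) 0) none none).par (tokensQ x r)).res t
  rw [Proc.q_nil, zero_add (msgA _ _).q] at h
  have e : cellQ t x i .waiting (r + 1) = resQ t ((outZA x 0 .nil).q +
      (Proc.sum (inZA 0 (msgA (nP i + 1) 0))).q + tokensQ x r) := by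
    rw [cellQ, tokensQ, tokensQ, succ_nsmul, headA]
    congr 1
    abel
  rw [e]
  exact h

theorem EncState.Step.red {k n : ℕ} {M : Machine k n} {s s' : EncState k n}
    (h : EncState.Step M s s') : Red (s.enc t x M) (s'.enc t x M) := by
  cases h with
  | fetch h =>
      rw [enc_fetch, EncState.enc, EncState.comps_fetch, Multiset.sum_cons, Multiset.sum_cons,
        ← add_assoc, h]
      exact (Red.fetch x _ _).par _
  | offer i h =>
      rw [enc_offer, EncState.enc, EncState.comps_offer t x M s i, Multiset.sum_cons,
        Multiset.sum_cons, ← add_assoc, h]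
      exact (Red.offer t x _ _).par _
  | inc i j h h' hi =>
      rw [enc_inc, EncState.enc, EncState.comps_cell t x M s i, Multiset.sum_cons,
        Multiset.sum_cons, ← add_assoc, h, hi, controlA, h']
      exact (Red.inc t x _ _ _).par _
  | dec i j₁ j₂ h h' hi =>
      rw [enc_dec, EncState.enc, EncState.comps_cell t x M s i, Multiset.sum_cons,
        Multiset.sum_cons, ← add_assoc, h, hi, controlA, h']
      exact (Red.dec t x _ _ _ _).par _
  | rst i j₁ j₂ h h' hi =>
      rw [enc_rst, EncState.enc, EncState.comps_cell t x M s i, Multiset.sum_cons,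
        Multiset.sum_cons, ← add_assoc, h, hi, controlA, h']
      exact (Red.rst t x _ _ _ _).par _
  | token i r h hr =>
      rw [enc_token, EncState.enc, EncState.comps_cell t x M s i, Multiset.sum_cons,
        Multiset.sum_cons, add_left_comm, h, hr]
      exact (Red.token t x _ _).par _

end Forward

/-- The encoding of a configuration is the process of its state. -/
theorem encodeA_q {α : Type} (t x : α) {k n : ℕ} (M : Machine k n) (c : Config k n) :
    (encodeA t x M c).q = c.state.enc t x M := by
  have h : ∀ i r : ℕ, (cellA t x i r).q = cellQ t x i .ready r := by
    intro i r
    rw [cellA, Proc.q_res, Proc.q_par, Proc.q_parList, List.map_replicate, List.sum_replicate]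
    rfl
  simp only [encodeA, Proc.q_par, Proc.q_parList, List.map_ofFn, List.sum_ofFn, Function.comp, h]
  rw [EncState.enc, EncState.comps, Multiset.sum_cons]
  simp only [EncState.cells, EncState.others, Multiset.sum_add, Config.state, Multiset.map_zero,
    add_zero, controlA]
  simp only [Finset.sum_eq_multiset_sum]
  abel

end PiCalc

-- Inversion of the reductions of a state

namespace PiCalc

/-! ## The reductions of a state are its steps -/

theorem ProcQ.In_add (x y : ProcQ Unit) (a : ℕ) (r : ProcQ Unit) : (x + y).In a r ↔
    (∃ p, x.In a p ∧ r = p + renQ Nat.succ y) ∨ (∃ p, y.In a p ∧ r = p + renQ Nat.succ x) := by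
  induction x using ProcQ.ind; induction y using ProcQ.ind
  exact Iff.rfl

theorem ProcQ.Out_add (x y : ProcQ Unit) (a b : ℕ) (r : ProcQ Unit) : (x + y).Out a b r ↔
    (∃ p, x.Out a b p ∧ r = p + y) ∨ (∃ p, y.Out a b p ∧ r = p + x) := by
  induction x using ProcQ.ind; induction y using ProcQ.ind
  exact Iff.rfl

theorem ProcQ.BOut_add (x y : ProcQ Unit) (a : ℕ) (r : ProcQ Unit) : (x + y).BOut a r ↔
    (∃ p, x.BOut a p ∧ r = p + renQ Nat.succ y) ∨ (∃ p, y.BOut a p ∧ r = p + renQ Nat.succ x) := by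
  induction x using ProcQ.ind; induction y using ProcQ.ind
  exact Iff.rfl

theorem ProcQ.In_res (τ : Unit) (x : ProcQ Unit) (a : ℕ) (r : ProcQ Unit) : (resQ τ x).In a r ↔
    ∃ p, x.In (a + 1) p ∧ r = resQ () (renQ swap01 p) := by
  induction x using ProcQ.ind
  exact Iff.rfl

theorem ProcQ.Out_res (τ : Unit) (x : ProcQ Unit) (a b : ℕ) (r : ProcQ Unit) :
    (resQ τ x).Out a b r ↔ ∃ p, x.Out (a + 1) (b + 1) p ∧ r = resQ () p := by
  induction x using ProcQ.ind
  exact Iff.rfl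

theorem ProcQ.BOut_res (τ : Unit) (x : ProcQ Unit) (a : ℕ) (r : ProcQ Unit) :
    (resQ τ x).BOut a r ↔
      x.Out (a + 1) 0 r ∨ ∃ p, x.BOut (a + 1) p ∧ r = resQ () (renQ swap01 p) := by
  induction x using ProcQ.ind
  exact Iff.rfl

theorem ProcQ.Tau_res (τ : Unit) (x : ProcQ Unit) (r : ProcQ Unit) : (resQ τ x).Tau r ↔
    ∃ p, x.Tau p ∧ r = resQ () p := by
  induction x using ProcQ.ind
  exact Iff.rfl

/-- A process without inputs and internal transitions whose only outputs are tokens on the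
innermost name. -/
theorem tokensQ_transitions (r : ℕ) :
    (∀ a p, ¬ (tokensQ () r).In a p) ∧ (∀ a b p, ¬ (tokensQ () r).Out a b p) ∧
    (∀ a p, (tokensQ () r).BOut a p →
      a = 0 ∧ ∃ r', r = r' + 1 ∧ p = renQ Nat.succ (tokensQ () r')) ∧
    ∀ p, ¬ (tokensQ () r).Tau p := by
  have h₁ : ∀ a p, ¬ ((outZA () 0 .nil).q).In a p := by
    rintro a p ⟨q, h, _⟩; exact h
  have h₂ : ∀ a b p, ¬ ((outZA () 0 .nil).q).Out a b p := by
    rintro a b p ⟨q, ⟨_, h, _⟩, _⟩; exact absurd h (by simp)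
  have h₃ : ∀ a p, ((outZA () 0 .nil).q).BOut a p → a = 0 ∧ p = 0 := by
    rintro a p (⟨h, _, h'⟩ | ⟨q, h, _⟩)
    · exact ⟨by omega, h'⟩
    · exact h.elim
  have h₄ : ∀ p, ¬ ((outZA () 0 .nil).q).Tau p := by
    rintro p ⟨q, h, _⟩; exact h
  induction r with
  | zero =>
      rw [tokensQ, zero_smul]
      exact ⟨fun _ _ => id, fun _ _ _ => id, fun _ _ h => h.elim, fun _ => id⟩
  | succ r ih =>
      obtain ⟨i₁, i₂, i₃, i₄⟩ := ih
      rw [show tokensQ () (r + 1) = tokensQ () r + (outZA () 0 .nil).q from succ_nsmul _ _]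
      refine ⟨?_, ?_, ?_, ?_⟩
      · intro a p h
        rcases (ProcQ.In_add _ _ _ _).1 h with ⟨q, h, _⟩ | ⟨q, h, _⟩
        · exact i₁ _ _ h
        · exact h₁ _ _ h
      · intro a b p h
        rcases (ProcQ.Out_add _ _ _ _ _).1 h with ⟨q, h, _⟩ | ⟨q, h, _⟩
        · exact i₂ _ _ _ h
        · exact h₂ _ _ _ h
      · intro a p h
        rcases (ProcQ.BOut_add _ _ _ _).1 h with ⟨q, g, rfl⟩ | ⟨q, g, rfl⟩
        · obtain ⟨rfl, r', rfl, rfl⟩ := i₃ _ _ g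
          refine ⟨rfl, _, rfl, ?_⟩
          rw [← map_add]; congr 1
        · obtain ⟨rfl, rfl⟩ := h₃ _ _ g
          exact ⟨rfl, _, rfl, zero_add _⟩
      · intro p h
        rcases (ProcQ.Tau_add _ _ _).1 h with ⟨q, h, _⟩ | ⟨q, h, _⟩ |
          (⟨_, _, _, _, h, _⟩ | ⟨_, _, _, _, h, _⟩) | (⟨_, _, _, _, h, _⟩ | ⟨_, _, _, _, h, _⟩)
        · exact i₄ _ h
        · exact h₄ _ h
        · exact i₂ _ _ _ h
        · exact h₁ _ _ h
        · exact h₂ _ _ _ h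
        · exact i₁ _ _ h

theorem swap01_comp_succ : swap01 ∘ Nat.succ = lift Nat.succ := by
  funext i; rcases i with _ | i <;> rfl

theorem resQ_swap_shift (p : ProcQ Unit) :
    resQ () (renQ swap01 (renQ Nat.succ p)) = renQ Nat.succ (resQ () p) := by
  rw [renQ_resQ, renQ_renQ, swap01_comp_succ]

theorem cellQ_not_out (i r : ℕ) (m : Mode) (a b : ℕ) (p : ProcQ Unit) :
    ¬ (cellQ () () i m r).Out a b p := by
  intro h
  obtain ⟨q, h, _⟩ := (ProcQ.Out_res _ _ _ _ _).1 h
  rcases (ProcQ.Out_add _ _ _ _ _).1 h with ⟨q, h, _⟩ | ⟨q, h, _⟩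
  · cases m
    · exact absurd h.2.1 (by simp)
    · rcases h with h | h | h <;> exact h
    · exact h
  · exact (tokensQ_transitions r).2.1 _ _ _ h

/-- Tokens have the cell name as their subject and are invisible from outside; the only message that
leaves the cell is sent by a ready head, and it opens the scope of the cell name. -/
theorem cellQ_bout {i r : ℕ} {m : Mode} {a : ℕ} {p : ProcQ Unit}
    (h : (cellQ () () i m r).BOut a p) : m = .ready ∧ a = nP i ∧ p = tokensQ () r := by
  rcases (ProcQ.BOut_res _ _ _ _).1 h with g | ⟨q, g, rfl⟩
  · rcases (ProcQ.Out_add _ _ _ _ _).1 g with ⟨q, g', rfl⟩ | ⟨q, g', rfl⟩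
    · cases m
      · obtain ⟨e, _, rfl⟩ := g'
        exact ⟨rfl, by omega, zero_add _⟩
      · exact absurd g' (by rintro (h | h | h) <;> exact h)
      · exact g'.elim
    · exact absurd g' ((tokensQ_transitions r).2.1 _ _ _)
  · rcases (ProcQ.BOut_add _ _ _ _).1 g with ⟨q, g', rfl⟩ | ⟨q, g', rfl⟩
    · cases m <;> exact g'.elim
    · exact absurd ((tokensQ_transitions r).2.2.1 _ _ g').1 (by simp)

/-- A waiting head listens on the cell name only, so requests are accepted by a choosing head alone.
The received object is never used, whence the weakened derivatives. -/
theorem cellQ_in {i r : ℕ} {m : Mode} {a : ℕ} {p : ProcQ Unit}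
    (h : (cellQ () () i m r).In a p) : m = .choosing ∧
      ((a = nInc i ∧ p = renQ Nat.succ (cellQ () () i .ready (r + 1))) ∨
       (a = nDec i ∧ p = renQ Nat.succ (cellQ () () i .waiting r)) ∨
       (a = nRst i ∧ p = renQ Nat.succ (garbageQ () () r + cellQ () () i .ready 0))) := by
  obtain ⟨q, g, rfl⟩ := (ProcQ.In_res _ _ _ _).1 h
  rcases (ProcQ.In_add _ _ _ _).1 g with ⟨q, u, rfl⟩ | ⟨q, u, _⟩
  · cases m
    · exact u.elim
    · refine ⟨rfl, ?_⟩
      rcases u with ⟨h, rfl⟩ | ⟨h, rfl⟩ | ⟨h, rfl⟩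
      · refine .inl ⟨by omega, ?_⟩
        rw [Proc.q_shift, ← map_add, resQ_swap_shift]
        congr 1
        rw [cellQ, Proc.q_par, tokensQ, tokensQ, succ_nsmul, headA]
        congr 1
        abel
      · refine .inr (.inl ⟨by omega, ?_⟩)
        rw [Proc.q_shift, ← map_add, resQ_swap_shift]; rfl
      · refine .inr (.inr ⟨by omega, ?_⟩)
        rw [Proc.q_shift, ← map_add, resQ_swap_shift, garbage_add_cell]
    · exact absurd u.1 (by simp)
  · exact absurd u ((tokensQ_transitions r).1 _ _)

/-- Inside the cell only tokens send on the cell name, and only a waiting head listens on it. -/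
theorem cellQ_tau {i r : ℕ} {m : Mode} {p : ProcQ Unit} (h : (cellQ () () i m r).Tau p) :
    m = .waiting ∧ ∃ r', r = r' + 1 ∧ p = cellQ () () i .ready r' := by
  obtain ⟨t₁, t₂, t₃, t₄⟩ := tokensQ_transitions r
  obtain ⟨q, g, rfl⟩ := (ProcQ.Tau_res _ _ _).1 h
  rcases (ProcQ.Tau_add _ _ _).1 g with ⟨q, u, _⟩ | ⟨q, u, _⟩ |
    (⟨_, _, _, _, _, u, _⟩ | ⟨_, _, _, _, u, _⟩) | (⟨_, _, _, _, u, _⟩ | ⟨a, p, q, u, h', rfl⟩)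
  · cases m
    · exact u.elim
    · exact absurd u (by rintro (h | h | h) <;> exact h)
    · exact u.elim
  · exact absurd u (t₄ _)
  · exact absurd u (t₁ _ _)
  · exact absurd u (t₁ _ _)
  · exact absurd u (t₂ _ _ _)
  · obtain ⟨rfl, r', rfl, rfl⟩ := t₃ _ _ u
    cases m
    · exact h'.elim
    · exact absurd h' (by rintro (h | h | h) <;> exact absurd h.1 (by simp))
    · obtain ⟨_, rfl⟩ := h'
      refine ⟨rfl, r', rfl, ?_⟩
      rw [Proc.q_shift, ← map_add, resQ_shift, add_comm]; rfl

theorem counterA_in {i a : ℕ} {p : ProcQ Unit} (h : (counterA () () i).q.In a p) :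
    a = nP i ∧ p = (Proc.sum (counterBodyA () () i)).q + renQ Nat.succ (counterA () () i).q := by
  obtain ⟨q, ⟨h, rfl⟩, rfl⟩ := h
  exact ⟨h.symm, rfl⟩

theorem instrA_in {k n : ℕ} {m : Fin n} {I : Instr k n} {a : ℕ} {p : ProcQ Unit}
    (h : (instrA () m I).q.In a p) :
    a = nLoc m ∧ p = renQ Nat.succ ((bodyA () I).q + (instrA () m I).q) := by
  obtain ⟨q, ⟨h, rfl⟩, rfl⟩ := h
  exact ⟨h.symm, by rw [map_add]; rfl⟩

theorem controlA_bout {k n : ℕ} {M : Machine k n} {pc : Fin n} {f : Bool} {a : ℕ}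
    {p : ProcQ Unit} (h : (controlA () M pc f).q.BOut a p) :
    (f = false ∧ a = nLoc pc ∧ p = 0) ∨
    (f = true ∧ ∃ i j, M pc = .inc i j ∧ a = nInc i ∧
      p = renQ Nat.succ (outZA () (nLoc j) .nil).q) ∨
    (f = true ∧ ∃ i j₁ j₂, M pc = .dec i j₁ j₂ ∧
      ((a = nDec i ∧ p = renQ Nat.succ (outZA () (nLoc j₁) .nil).q) ∨
        (a = nRst i ∧ p = renQ Nat.succ (outZA () (nLoc j₂) .nil).q))) := by
  cases f with
  | false =>
      rcases h with ⟨h, _, rfl⟩ | ⟨q, h, _⟩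
      · exact .inl ⟨rfl, by omega, rfl⟩
      · exact h.elim
  | true =>
      cases hM : M pc with
      | inc i j =>
          rw [controlA, hM] at h
          rcases h with ⟨h, _, rfl⟩ | ⟨q, h, _⟩
          · exact .inr (.inl ⟨rfl, _, _, rfl, by omega, rfl⟩)
          · exact h.elim
      | dec i j₁ j₂ =>
          rw [controlA, hM] at h
          rcases h with (⟨h, _, rfl⟩ | ⟨h, _, rfl⟩) | ⟨q, h, _⟩
          · exact .inr (.inr ⟨rfl, _, _, _, rfl, .inl ⟨by omega, rfl⟩⟩)
          · exact .inr (.inr ⟨rfl, _, _, _, rfl, .inr ⟨by omega, rfl⟩⟩)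
          · exact h.elim

theorem controlA_silent {k n : ℕ} (M : Machine k n) (pc : Fin n) (f : Bool) :
    (∀ a p, ¬ (controlA () M pc f).q.In a p) ∧ (∀ a b p, ¬ (controlA () M pc f).q.Out a b p) ∧
      ∀ p, ¬ (controlA () M pc f).q.Tau p := by
  cases f with
  | false =>
      refine ⟨?_, ?_, ?_⟩
      · rintro a p ⟨q, h, _⟩; exact h
      · rintro a b p ⟨q, ⟨_, h, _⟩, _⟩; exact absurd h (by simp)
      · rintro p ⟨q, h, _⟩; exact h
  | true =>
      cases hM : M pc with
      | inc i j =>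
          rw [controlA, hM]
          refine ⟨?_, ?_, ?_⟩
          · rintro a p ⟨q, h, _⟩; exact h
          · rintro a b p ⟨q, ⟨_, h, _⟩, _⟩; exact absurd h (by simp)
          · rintro p ⟨q, h, _⟩; exact h
      | dec i j₁ j₂ =>
          rw [controlA, hM]
          refine ⟨?_, ?_, ?_⟩
          · rintro a p ⟨q, h | h, _⟩ <;> exact h
          · rintro a b p ⟨q, ⟨_, h, _⟩ | ⟨_, h, _⟩, _⟩ <;> exact absurd h (by simp)
          · rintro p ⟨q, h | h, _⟩ <;> exact h

/-- All subjects of garbage are bound by its restriction, below which there is no receiver. Garbage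
can thus never be removed, which is what makes a wrong reset detectable. -/
theorem garbageQ_silent (r : ℕ) :
    (∀ a p, ¬ (garbageQ () () r).In a p) ∧ (∀ a b p, ¬ (garbageQ () () r).Out a b p) ∧
      (∀ a p, ¬ (garbageQ () () r).BOut a p) ∧ ∀ p, ¬ (garbageQ () () r).Tau p := by
  obtain ⟨t₁, t₂, t₃, t₄⟩ := tokensQ_transitions r
  refine ⟨?_, ?_, ?_, ?_⟩
  · intro a p h
    obtain ⟨q, h, _⟩ := (ProcQ.In_res _ _ _ _).1 h
    exact t₁ _ _ h
  · intro a b p h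
    obtain ⟨q, h, _⟩ := (ProcQ.Out_res _ _ _ _ _).1 h
    exact t₂ _ _ _ h
  · intro a p h
    rcases (ProcQ.BOut_res _ _ _ _).1 h with h | ⟨q, h, _⟩
    · exact t₂ _ _ _ h
    · exact absurd (t₃ _ _ h).1 (by simp)
  · intro p h
    obtain ⟨q, h, _⟩ := (ProcQ.Tau_res _ _ _).1 h
    exact t₄ _ h

theorem EncState.mem_comps {α : Type} {t x : α} {k n : ℕ} {M : Machine k n} {s : EncState k n}
    {y : ProcQ α} (h : y ∈ s.comps t x M) :
    y = (controlA x M s.pc s.fetched).q ∨ (∃ i : Fin k, y = cellQ t x i (s.mode i) (s.reg i)) ∨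
    (∃ i : Fin k, y = (counterA t x i).q) ∨ (∃ m : Fin n, y = (instrA x m (M m)).q) ∨
    ∃ r, y = garbageQ t x r := by
  simp only [EncState.comps, EncState.cells, EncState.others, Multiset.mem_cons, Multiset.mem_add,
    Multiset.mem_map] at h
  rcases h with h | ⟨i, _, h⟩ | ⟨i, _, h⟩ | ⟨m, _, h⟩ | ⟨r, _, h⟩
  · exact .inl h
  · exact .inr (.inl ⟨i, h.symm⟩)
  · exact .inr (.inr (.inl ⟨i, h.symm⟩))
  · exact .inr (.inr (.inr (.inl ⟨m, h.symm⟩)))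
  · exact .inr (.inr (.inr (.inr ⟨r, h.symm⟩)))

theorem EncState.comp_tau {k n : ℕ} {M : Machine k n} {s : EncState k n} {y z : ProcQ Unit}
    (h : y ∈ s.comps () () M) (hz : y.Tau z) :
    ∃ (i : Fin k) (r : ℕ), y = cellQ () () i (s.mode i) (s.reg i) ∧ s.mode i = .waiting ∧
      s.reg i = r + 1 ∧ z = cellQ () () i .ready r := by
  rcases mem_comps h with rfl | ⟨i, rfl⟩ | ⟨i, rfl⟩ | ⟨m, rfl⟩ | ⟨r, rfl⟩
  · exact absurd hz ((controlA_silent M _ _).2.2 _)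
  · obtain ⟨h, r, hr, e⟩ := cellQ_tau hz
    exact ⟨i, r, rfl, h, hr, e⟩
  · rcases hz with ⟨p, h, _⟩ | ⟨_, _, _, _, h, _⟩ <;> exact h.elim
  · rcases hz with ⟨p, h, _⟩ | ⟨_, _, _, _, h, _⟩ <;> exact h.elim
  · exact absurd hz ((garbageQ_silent r).2.2.2 _)

theorem EncState.comp_out {k n : ℕ} {M : Machine k n} {s : EncState k n} {y : ProcQ Unit}
    (h : y ∈ s.comps () () M) (a b : ℕ) (p : ProcQ Unit) : ¬ y.Out a b p := by
  intro hp
  rcases mem_comps h with rfl | ⟨i, rfl⟩ | ⟨i, rfl⟩ | ⟨m, rfl⟩ | ⟨r, rfl⟩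
  · exact (controlA_silent M _ _).2.1 _ _ _ hp
  · exact cellQ_not_out _ _ _ _ _ _ hp
  · obtain ⟨_, h, _⟩ := hp; exact h
  · obtain ⟨_, h, _⟩ := hp; exact h
  · exact (garbageQ_silent r).2.1 _ _ _ hp

theorem EncState.comp_bout {k n : ℕ} {M : Machine k n} {s : EncState k n} {y : ProcQ Unit}
    (h : y ∈ s.comps () () M) {a : ℕ} {p : ProcQ Unit} (hp : y.BOut a p) :
    (y = (controlA () M s.pc s.fetched).q) ∨
    ∃ i : Fin k, y = cellQ () () i (s.mode i) (s.reg i) ∧ s.mode i = .ready ∧ a = nP i ∧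
      p = tokensQ () (s.reg i) := by
  rcases mem_comps h with rfl | ⟨i, rfl⟩ | ⟨i, rfl⟩ | ⟨m, rfl⟩ | ⟨r, rfl⟩
  · exact .inl rfl
  · exact .inr ⟨i, rfl, cellQ_bout hp⟩
  · exact hp.elim
  · exact hp.elim
  · exact absurd hp ((garbageQ_silent r).2.2.1 _ _)

theorem EncState.comp_in {k n : ℕ} {M : Machine k n} {s : EncState k n} {y : ProcQ Unit}
    (h : y ∈ s.comps () () M) {a : ℕ} {p : ProcQ Unit} (hp : y.In a p) :
    (∃ i : Fin k, y = cellQ () () i (s.mode i) (s.reg i)) ∨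
    (∃ i : Fin k, y = (counterA () () i).q) ∨ (∃ m : Fin n, y = (instrA () m (M m)).q) := by
  rcases mem_comps h with rfl | ⟨i, rfl⟩ | ⟨i, rfl⟩ | ⟨m, rfl⟩ | ⟨r, rfl⟩
  · exact absurd hp ((controlA_silent M _ _).1 _ _)
  · exact .inl ⟨i, rfl⟩
  · exact .inr (.inl ⟨i, rfl⟩)
  · exact .inr (.inr ⟨m, rfl⟩)
  · exact absurd hp ((garbageQ_silent r).1 _ _)

/-- Only a waiting cell reduces on its own. In a communication all messages are bound outputs, sent
by the control or by a ready cell; the residues modulo five of the names separate their roles, and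
the quotients identify the counter or instruction. The pairings that survive are exactly the steps.
-/
theorem EncState.step_of_tau {k n : ℕ} {M : Machine k n} {s : EncState k n} {r : ProcQ Unit}
    (h : (s.enc () () M).Tau r) : ∃ s', EncState.Step M s s' ∧ r = s'.enc () () M := by
  rcases ProcQ.tau_sum h with ⟨y, t, z, e, hz, rfl⟩ | ⟨y, y', t, z, e, hz, rfl⟩
  · obtain ⟨i, r, rfl, hi, hr, rfl⟩ := comp_tau (M := M) (e ▸ Multiset.mem_cons_self _ _) hz
    refine ⟨_, .token s i r hi hr, ?_⟩
    rw [comps_cell () () M s i, Multiset.cons_swap, Multiset.cons_inj_right] at e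
    rw [enc_token, ← e, Multiset.sum_cons]
  · have m₁ : y ∈ s.comps () () M := e ▸ Multiset.mem_cons_self _ _
    have m₂ : y' ∈ s.comps () () M := e ▸ Multiset.mem_cons_of_mem (Multiset.mem_cons_self _ _)
    rcases hz with ⟨a, b, p, q, g, _⟩ | ⟨a, p, q, g, h', rfl⟩
    · exact absurd g (comp_out m₁ _ _ _)
    -- Multisets cancel, so the bystanders are determined by the two reacting components.
    have key : ∀ {x₁ x₂ : ProcQ Unit} {u : Multiset (ProcQ Unit)}, y = x₁ → y' = x₂ →
        s.comps () () M = x₁ ::ₘ x₂ ::ₘ u → t = u := by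
      rintro x₁ x₂ u rfl rfl h
      rw [h, Multiset.cons_inj_right, Multiset.cons_inj_right] at e
      exact e.symm
    rcases comp_bout m₁ g with rfl | ⟨i, rfl, hi, rfl, rfl⟩
    · rcases controlA_bout g with ⟨hf, rfl, rfl⟩ | ⟨hf, i, j, hM, rfl, rfl⟩ |
        ⟨hf, i, j₁, j₂, hM, ⟨rfl, rfl⟩ | ⟨rfl, rfl⟩⟩
      · rcases comp_in m₂ h' with ⟨i', rfl⟩ | ⟨i', rfl⟩ | ⟨m, rfl⟩
        · obtain ⟨_, ⟨e', _⟩ | ⟨e', _⟩ | ⟨e', _⟩⟩ := cellQ_in h' <;>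
            simp only [nInc, nDec, nRst, nLoc] at e' <;> omega
        · have e' := (counterA_in h').1
          simp only [nP, nLoc] at e'; omega
        · obtain ⟨e', rfl⟩ := instrA_in h'
          have : s.pc = m := Fin.ext (by simp only [nLoc] at e'; omega)
          subst this
          refine ⟨_, .fetch s hf, ?_⟩
          rw [enc_fetch, key rfl rfl (comps_fetch () () M s), zero_add, resQ_shift]
      · rcases comp_in m₂ h' with ⟨i', rfl⟩ | ⟨i', rfl⟩ | ⟨m, rfl⟩
        · obtain ⟨hi, ⟨e', rfl⟩ | ⟨e', rfl⟩ | ⟨e', rfl⟩⟩ := cellQ_in h'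
          · have : i = i' := Fin.ext (by simp only [nInc] at e'; omega)
            subst this
            refine ⟨_, .inc s i j hf hM hi, ?_⟩
            rw [enc_inc, key rfl rfl (comps_cell () () M s i), ← map_add, resQ_shift]
          · simp only [nInc, nDec] at e'; omega
          · simp only [nInc, nRst] at e'; omega
        · have e' := (counterA_in h').1
          simp only [nP, nInc] at e'; omega
        · have e' := (instrA_in h').1
          simp only [nLoc, nInc] at e'; omega
      · rcases comp_in m₂ h' with ⟨i', rfl⟩ | ⟨i', rfl⟩ | ⟨m, rfl⟩
        · obtain ⟨hi, ⟨e', rfl⟩ | ⟨e', rfl⟩ | ⟨e', rfl⟩⟩ := cellQ_in h'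
          · simp only [nInc, nDec] at e'; omega
          · have : i = i' := Fin.ext (by simp only [nDec] at e'; omega)
            subst this
            refine ⟨_, .dec s i j₁ j₂ hf hM hi, ?_⟩
            rw [enc_dec, key rfl rfl (comps_cell () () M s i), ← map_add, resQ_shift]
          · simp only [nDec, nRst] at e'; omega
        · have e' := (counterA_in h').1
          simp only [nP, nDec] at e'; omega
        · have e' := (instrA_in h').1
          simp only [nLoc, nDec] at e'; omega
      · rcases comp_in m₂ h' with ⟨i', rfl⟩ | ⟨i', rfl⟩ | ⟨m, rfl⟩
        · obtain ⟨hi, ⟨e', rfl⟩ | ⟨e', rfl⟩ | ⟨e', rfl⟩⟩ := cellQ_in h'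
          · simp only [nInc, nRst] at e'; omega
          · simp only [nDec, nRst] at e'; omega
          · have : i = i' := Fin.ext (by simp only [nRst] at e'; omega)
            subst this
            refine ⟨_, .rst s i j₁ j₂ hf hM hi, ?_⟩
            rw [enc_rst, key rfl rfl (comps_cell () () M s i), ← map_add, resQ_shift]
        · have e' := (counterA_in h').1
          simp only [nP, nRst] at e'; omega
        · have e' := (instrA_in h').1
          simp only [nLoc, nRst] at e'; omega
    · rcases comp_in m₂ h' with ⟨i', rfl⟩ | ⟨i', rfl⟩ | ⟨m, rfl⟩
      · obtain ⟨_, ⟨e', _⟩ | ⟨e', _⟩ | ⟨e', _⟩⟩ := cellQ_in h' <;>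
          simp only [nInc, nDec, nRst, nP] at e' <;> omega
      · obtain ⟨e', rfl⟩ := counterA_in h'
        have : i = i' := Fin.ext (by simp only [nP] at e'; omega)
        subst this
        refine ⟨_, .offer s i hi, ?_⟩
        rw [enc_offer, key rfl rfl (comps_offer () () M s i), ← add_assoc,
          ← resQ_add, add_comm (tokensQ () (s.reg i))]
        rfl
      · have e' := (instrA_in h').1
        simp only [nLoc, nP] at e'; omega

theorem EncState.step_of_step {k n : ℕ} {M : Machine k n} {s : EncState k n} {P Q : PiTerm}
    (hP : P.q = s.enc () () M) (h : PiCalc.Step P Q) :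
    ∃ s', EncState.Step M s s' ∧ Q.q = s'.enc () () M :=
  step_of_tau (hP ▸ h.tau_q)

end PiCalc

-- Numerical invariants of congruence, and faithfulness of reachability

namespace PiCalc

/-! ## Weights of processes

The names are coloured, and active outputs have weights that depend on the colours of their subject
and object. The weight of a restriction is the least weight for the colours of its name. -/

/-- The colouring below a binder whose name has the colour `v`. -/
def colour (v : Bool) (ρ : ℕ → Option Bool) : ℕ → Option Bool
  | 0 => some v
  | i + 1 => ρ i

theorem colour_comp_lift (v : Bool) (ρ : ℕ → Option Bool) (f : ℕ → ℕ) :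
    colour v ρ ∘ lift f = colour v (ρ ∘ f) := by
  funext i; cases i <;> rfl

section Weights
variable (g : Option Bool → Option Bool → ℕ∞)

noncomputable def Choice.wt (ρ : ℕ → Option Bool) : Choice Unit → ℕ∞
  | .pre (.inp _) _ => 0
  | .pre (.out a b) _ => g (ρ a) (ρ b)
  | .pre .tau _ => 0
  | .plus M N => max (Choice.wt ρ M) (Choice.wt ρ N)

noncomputable def Proc.wt : (ℕ → Option Bool) → PiTerm → ℕ∞
  | _, .nil => 0
  | ρ, .res _ P => min (Proc.wt (colour true ρ) P) (Proc.wt (colour false ρ) P)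
  | ρ, .par P Q => Proc.wt ρ P + Proc.wt ρ Q
  | ρ, .sum M => M.wt g ρ
  | ρ, .bang M => ⊤ * M.wt g ρ

theorem Choice.wt_rename (f : ℕ → ℕ) (ρ : ℕ → Option Bool) :
    ∀ M : Choice Unit, (M.rename f).wt g ρ = M.wt g (ρ ∘ f)
  | .pre (.inp _) _ => rfl
  | .pre (.out a b) _ => rfl
  | .pre .tau _ => rfl
  | .plus M N => by
      simp only [Choice.rename, Choice.wt, Choice.wt_rename f ρ M, Choice.wt_rename f ρ N]

theorem Proc.wt_rename : ∀ (P : PiTerm) (f : ℕ → ℕ) (ρ : ℕ → Option Bool),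
    (P.rename f).wt g ρ = P.wt g (ρ ∘ f)
  | .nil, f, ρ => rfl
  | .res _ P, f, ρ => by
      simp only [Proc.rename, Proc.wt, Proc.wt_rename P, colour_comp_lift]
  | .par P Q, f, ρ => by simp only [Proc.rename, Proc.wt, Proc.wt_rename P, Proc.wt_rename Q]
  | .sum M, f, ρ => M.wt_rename g f ρ
  | .bang M, f, ρ => by simp only [Proc.rename, Proc.wt, Choice.wt_rename]

/-- Every law becomes an identity in `ℕ∞`: parallel composition is a sum, choice a maximum, and
replication a multiplication by `⊤`, which absorbs one more copy. A restriction is a minimum over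
the colours of its name; minima commute, which gives the exchange of restrictions, and addition
distributes over them, which gives extrusion. Continuations play no role. -/
theorem Proc.Cong.wt_eq {P Q : PiTerm} (h : P.Cong Q) : ∀ ρ, P.wt g ρ = Q.wt g ρ := by
  refine Proc.Cong.rec (motive_1 := fun P Q _ => ∀ ρ, P.wt g ρ = Q.wt g ρ)
    (motive_2 := fun M N _ => ∀ ρ, M.wt g ρ = N.wt g ρ)
    ?_ ?_ ?_ ?_ ?_ ?_ ?_ ?_ ?_ ?_ ?_ ?_ ?_ ?_ ?_ ?_ ?_ ?_ ?_ ?_ ?_ h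
  · exact fun _ _ => rfl
  · exact fun _ ih ρ => (ih ρ).symm
  · exact fun _ _ ih ih' ρ => (ih ρ).trans (ih' ρ)
  · intro P Q τ _ ih ρ; simp only [Proc.wt, ih]
  · intro P P' Q Q' _ _ ih ih' ρ; simp only [Proc.wt, ih, ih']
  · exact fun _ ih ρ => ih ρ
  · intro M N _ ih ρ; simp only [Proc.wt, ih]
  · exact fun P Q ρ => add_comm _ _
  · exact fun P Q R ρ => add_assoc _ _ _
  · exact fun P ρ => add_zero _
  · exact fun τ ρ => min_self _
  · intro σ τ P ρ
    have h : ∀ u v, colour u (colour v ρ) ∘ swap01 = colour v (colour u ρ) := by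
      intro u v; funext i; rcases i with _ | _ | i <;> rfl
    simp only [Proc.wt, Proc.wt_rename, h]
    exact min_min_min_comm _ _ _ _
  · intro M ρ
    simp only [Proc.wt]
    conv_lhs => rw [← top_add (1 : ℕ∞), add_comm, add_mul, one_mul]
  · intro τ P Q ρ
    have h : ∀ v, colour v ρ ∘ Nat.succ = ρ := fun v => rfl
    simp only [Proc.wt, Proc.shift, Proc.wt_rename, h]
    exact (min_add_add_left _ _ _).symm
  · exact fun _ _ => rfl
  · exact fun _ ih ρ => (ih ρ).symm
  · exact fun _ _ ih ih' ρ => (ih ρ).trans (ih' ρ)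
  · intro P Q π _ _ ρ; cases π <;> rfl
  · intro M M' N N' _ _ ih ih' ρ; simp only [Choice.wt, ih, ih']
  · exact fun M N ρ => max_comm _ _
  · exact fun M N O ρ => max_assoc _ _ _

/-- The weight of a congruence class. -/
noncomputable def wtQ (ρ : ℕ → Option Bool) : ProcQ Unit →+ ℕ∞ where
  toFun := Quotient.lift (Proc.wt g ρ) fun _ _ h => Proc.Cong.wt_eq g h ρ
  map_zero' := rfl
  map_add' a b := by
    induction a using ProcQ.ind; induction b using ProcQ.ind; rfl

theorem wtQ_q (ρ : ℕ → Option Bool) (P : PiTerm) : wtQ g ρ P.q = P.wt g ρ := rfl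

theorem wtQ_resQ (ρ : ℕ → Option Bool) (τ : Unit) (p : ProcQ Unit) :
    wtQ g ρ (resQ τ p) = min (wtQ g (colour true ρ) p) (wtQ g (colour false ρ) p) := by
  induction p using ProcQ.ind; rfl

variable (ρ : ℕ → Option Bool)

theorem wtQ_outZA (c : ℕ) (P : PiTerm) :
    wtQ g ρ (outZA () c P).q = min (g (ρ c) (some true)) (g (ρ c) (some false)) := rfl

theorem wtQ_tokensQ (r : ℕ) : wtQ g ρ (tokensQ () r) =
    r • min (g (ρ 0) (some true)) (g (ρ 0) (some false)) := by
  rw [tokensQ, map_nsmul, wtQ_outZA]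

/-- The weight of the head of a counter cell whose name has colour `v`. -/
def Mode.wt (i : ℕ) (v : Bool) : Mode → ℕ∞
  | .ready => g (ρ (nP i)) (some v)
  | .choosing => 0
  | .waiting => 0

theorem wtQ_headA (i : ℕ) (m : Mode) (v : Bool) :
    wtQ g (colour v ρ) (headA () () i m).q = m.wt g ρ i v := by
  cases m
  · rfl
  · simp [headA, wtQ_q, Proc.wt, counterBodyA, Choice.wt, inZA, Mode.wt]
  · rfl

theorem wtQ_cellQ (i r : ℕ) (m : Mode) : wtQ g ρ (cellQ () () i m r) =
    min (m.wt g ρ i true + r • min (g (some true) (some true)) (g (some true) (some false)))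
      (m.wt g ρ i false + r • min (g (some false) (some true)) (g (some false) (some false))) := by
  rw [cellQ, wtQ_resQ, map_add, map_add, wtQ_headA, wtQ_headA, wtQ_tokensQ, wtQ_tokensQ]; rfl

theorem wtQ_garbageQ (r : ℕ) : wtQ g ρ (garbageQ () () r) =
    min (r • min (g (some true) (some true)) (g (some true) (some false)))
      (r • min (g (some false) (some true)) (g (some false) (some false))) := by
  rw [garbageQ, wtQ_resQ, wtQ_tokensQ, wtQ_tokensQ]; rfl

theorem wtQ_enc {k n : ℕ} (M : Machine k n) (s : EncState k n) :
    wtQ g ρ (s.enc () () M) = wtQ g ρ (controlA () M s.pc s.fetched).q +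
      (∑ i : Fin k, wtQ g ρ (cellQ () () i (s.mode i) (s.reg i)) +
        (s.garbage.map fun r => wtQ g ρ (garbageQ () () r)).sum) := by
  -- Replicated inputs weigh `⊤ * 0 = 0`.
  have h₁ : ∀ i : ℕ, wtQ g ρ (counterA () () i).q = 0 := fun i => mul_zero _
  have h₂ : ∀ m : Fin n, wtQ g ρ (instrA () m (M m)).q = 0 := fun m => mul_zero _
  rw [EncState.enc, map_multiset_sum, EncState.comps, EncState.cells, EncState.others]
  simp only [Multiset.map_cons, Multiset.map_add, Multiset.map_map, Multiset.sum_cons,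
    Multiset.sum_add, Function.comp_def, h₁, h₂, Finset.sum_eq_multiset_sum]
  simp

end Weights

/-! ### Weights that determine a state -/

/-- Marks the name `a`. -/
def markName (a n : ℕ) : Option Bool := if n = a then none else some false

theorem markName_of_ne {a n : ℕ} (h : n ≠ a) : markName a n = some false := if_neg h

/-- Counts the outputs on the marked name. -/
def countMarked : Option Bool → Option Bool → ℕ∞
  | none, _ => 1
  | some _, _ => 0

/-- Counts the outputs whose subject has the colour `true`, and forces the objects of outputs on
the marked name to have that colour. -/
def countLinked : Option Bool → Option Bool → ℕ∞
  | none, some false => ⊤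
  | none, _ => 0
  | some true, _ => 1
  | some false, _ => 0

section Determined
variable {k n : ℕ} (M : Machine k n) (s : EncState k n)

theorem wtQ_controlA_zero {g : Option Bool → Option Bool → ℕ∞} {ρ : ℕ → Option Bool}
    (hg : ∀ v, g (some false) v = 0) (h₁ : ∀ i : Fin k, ρ (nInc i) = some false)
    (h₂ : ∀ i : Fin k, ρ (nDec i) = some false) (h₃ : ∀ i : Fin k, ρ (nRst i) = some false)
    (h₄ : s.fetched = false → ρ (nLoc s.pc) = some false) :
    wtQ g ρ (controlA () M s.pc s.fetched).q = 0 := by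
  cases hf : s.fetched with
  | false => simp [controlA, wtQ_outZA, h₄ hf, hg]
  | true =>
      cases hM : M s.pc with
      | inc i j => simp [controlA, hM, bodyA, wtQ_outZA, h₁, hg]
      | dec i j₁ j₂ =>
          simp [controlA, hM, bodyA, wtQ_q, outZ2A, Proc.wt, Choice.wt, colour, h₂, h₃, hg]

/-- In a state, the only active output on the channel of counter `i` is the head of its cell, and
only if that cell is ready. -/
theorem weight_ready (i : Fin k) : wtQ countMarked (markName (nP i)) (s.enc () () M) =
    match s.mode i with
    | .ready => 1
    | _ => 0 := by
  rw [wtQ_enc, wtQ_controlA_zero M s (fun _ => rfl)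
    (by intro j; exact markName_of_ne (by simp only [nInc, nP]; omega)) (by intro j; exact markName_of_ne (by simp only [nDec, nP]; omega))
    (by intro j; exact markName_of_ne (by simp only [nRst, nP]; omega)) (by intro; exact markName_of_ne (by simp only [nLoc, nP]; omega))]
  have hc : ∀ j : Fin k, wtQ countMarked (markName (nP i)) (cellQ () () j (s.mode j) (s.reg j)) =
      if j = i then (match s.mode i with | .ready => 1 | _ => 0) else 0 := by
    intro j
    rw [wtQ_cellQ]
    split_ifs with h
    · subst h
      cases s.mode j <;> simp [Mode.wt, countMarked, markName]
    · have : markName (nP i) (nP j) = some false := markName_of_ne fun h' =>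
        h (Fin.ext (by simp only [nP] at h'; omega))
      cases s.mode j <;> simp [Mode.wt, countMarked, this]
  have hg : ∀ r, wtQ countMarked (markName (nP i)) (garbageQ () () r) = 0 := by
    intro r; simp [wtQ_garbageQ, countMarked]
  simp [hc, hg]

/-- The head of cell `i` makes the colour `false` infinitely expensive for its name, so the minimum
is taken at `true`, where each token of this cell counts one. The other cells and the garbage are
free to choose `false` and weigh nothing. -/
theorem weight_reg (i : Fin k) (hi : s.mode i = .ready) :
    wtQ countLinked (markName (nP i)) (s.enc () () M) = s.reg i := by
  rw [wtQ_enc, wtQ_controlA_zero M s (fun v => by cases v <;> rfl)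
    (by intro j; exact markName_of_ne (by simp only [nInc, nP]; omega)) (by intro j; exact markName_of_ne (by simp only [nDec, nP]; omega))
    (by intro j; exact markName_of_ne (by simp only [nRst, nP]; omega)) (by intro; exact markName_of_ne (by simp only [nLoc, nP]; omega))]
  have hc : ∀ j : Fin k, wtQ countLinked (markName (nP i)) (cellQ () () j (s.mode j) (s.reg j)) =
      if j = i then (s.reg i : ℕ∞) else 0 := by
    intro j
    rw [wtQ_cellQ]
    split_ifs with h
    · subst h
      simp [hi, Mode.wt, countLinked, markName]
    · have : markName (nP i) (nP j) = some false := markName_of_ne fun h' =>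
        h (Fin.ext (by simp only [nP] at h'; omega))
      cases s.mode j <;> simp [Mode.wt, countLinked, this]
  have hg : ∀ r, wtQ countLinked (markName (nP i)) (garbageQ () () r) = 0 := by
    intro r; simp [wtQ_garbageQ, countLinked]
  simp [hc, hg]

theorem weight_loc (m : Fin n) : wtQ countMarked (markName (nLoc m)) (s.enc () () M) =
    if s.fetched = false ∧ s.pc = m then 1 else 0 := by
  have hc : ∀ j : Fin k, wtQ countMarked (markName (nLoc m)) (cellQ () () j (s.mode j) (s.reg j)) =
      0 := by
    intro j
    have : markName (nLoc m) (nP j) = some false := markName_of_ne (by simp only [nP, nLoc]; omega)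
    rw [wtQ_cellQ]
    cases s.mode j <;> simp [Mode.wt, countMarked, this]
  have hg : ∀ r, wtQ countMarked (markName (nLoc m)) (garbageQ () () r) = 0 := by
    intro r; simp [wtQ_garbageQ, countMarked]
  rw [wtQ_enc]
  split_ifs with h
  · obtain ⟨hf, rfl⟩ := h
    simp [hf, controlA, wtQ_outZA, hc, hg, markName, countMarked]
  · rw [wtQ_controlA_zero M s (fun v => by cases v <;> rfl)
      (by intro j; exact markName_of_ne (by simp only [nInc, nLoc]; omega))
      (by intro j; exact markName_of_ne (by simp only [nDec, nLoc]; omega))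
      (by intro j; exact markName_of_ne (by simp only [nRst, nLoc]; omega))]
    · simp [hc, hg]
    · intro hf
      exact markName_of_ne fun h' => h ⟨hf, Fin.ext (by simp only [nLoc] at h'; omega)⟩

/-- This counts all active outputs: the control, one head and the tokens of each cell, and the
tokens in the garbage. Once the counter values are known, the total of the garbage follows. -/
theorem weight_all (hr : ∀ i, s.mode i = .ready) (hf : s.fetched = false) :
    wtQ (fun _ _ => 1) (fun _ => none) (s.enc () () M) =
      ((1 + (∑ i, (1 + s.reg i) + s.garbage.sum) : ℕ) : ℕ∞) := by
  rw [wtQ_enc]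
  have hc : ∀ j : Fin k, wtQ (fun _ _ => 1) (fun _ => none)
      (cellQ () () j (s.mode j) (s.reg j)) = ((1 + s.reg j : ℕ) : ℕ∞) := by
    intro j; simp [wtQ_cellQ, hr, Mode.wt]
  have hg : (s.garbage.map fun r => wtQ (fun _ _ => 1) (fun _ => none) (garbageQ () () r)).sum =
      ((s.garbage.sum : ℕ) : ℕ∞) := by
    have : ∀ r, wtQ (fun _ _ => 1) (fun _ => none) (garbageQ () () r) = Nat.castAddMonoidHom ℕ∞ r := by
      intro r; simp [wtQ_garbageQ]
    simp only [this]
    exact (map_multiset_sum (Nat.castAddMonoidHom ℕ∞) s.garbage).symm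
  rw [hg]
  simp only [hc, hf, controlA, wtQ_outZA]
  push_cast
  simp

/-- A state whose process is the encoding of a configuration represents that configuration, up to
empty garbage. -/
theorem EncState.eq_of_enc_eq {c : Config k n} (h : s.enc () () M = c.state.enc () () M) :
    s.fetched = false ∧ s.pc = c.pc ∧ (∀ i, s.mode i = .ready) ∧ s.reg = c.reg ∧
      s.garbage.sum = 0 := by
  have h₁ : ∀ i, s.mode i = .ready := by
    intro i
    have := weight_ready M s i
    rw [h, weight_ready] at this
    cases hm : s.mode i <;> simp [hm, Config.state] at this ⊢
  have h₂ : s.reg = c.reg := by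
    funext i
    have := weight_reg M s i (h₁ i)
    rw [h, weight_reg _ _ _ rfl] at this
    exact_mod_cast this.symm
  have h₃ : s.fetched = false ∧ s.pc = c.pc := by
    have := weight_loc M s c.pc
    rw [h, weight_loc] at this
    by_contra hn
    simp [Config.state, hn] at this
  have h₄ := weight_all M s h₁ h₃.1
  rw [h, weight_all M c.state (fun _ => rfl) rfl, Nat.cast_inj, h₂] at h₄
  simp only [Config.state, Multiset.sum_zero] at h₄
  exact ⟨h₃.1, h₃.2, h₁, h₂, by omega⟩

end Determined

/-! ## Reachability of states and of configurations -/

open Function Relation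

section Simulation
variable {k n : ℕ} {M : Machine k n}

/-- Nothing has been lost, and no decrement waits in vain. -/
def EncState.Live (s : EncState k n) : Prop :=
  s.garbage.sum = 0 ∧ ∀ i, s.mode i = .waiting → 0 < s.reg i

/-- The configuration that a live state represents. -/
def EncState.config (s : EncState k n) : Config k n :=
  ⟨fun i => match s.mode i with
    | .waiting => s.reg i - 1
    | _ => s.reg i, s.pc⟩

theorem Config.ext' {c d : Config k n} (h : c.reg = d.reg) (h' : c.pc = d.pc) : c = d := by
  cases c; cases d; cases h; cases h'; rfl

/-- Liveness is inherited backwards: the garbage only grows, so a reset that ends without lost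
tokens was applied to a counter of value zero; and a decrement leaves its cell waiting, so liveness
of the target says that the counter is positive. Since `config` counts a pending decrement as
already executed, the machine moves at the request and stands still when the token is consumed. -/
theorem EncState.Step.live {s s' : EncState k n} (h : EncState.Step M s s') (hs' : s'.Live) :
    s.Live ∧ (s.config = s'.config ∨ Machine.Step M s.config s'.config) := by
  cases h with
  | fetch h => exact ⟨hs', .inl rfl⟩
  | offer i h =>
      refine ⟨⟨hs'.1, fun j hj => hs'.2 j ?_⟩, .inl (Config.ext' ?_ rfl)⟩
      · have : j ≠ i := by rintro rfl; simp [h] at hj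
        simpa [this] using hj
      · funext j
        by_cases hj : j = i
        · subst hj; simp [EncState.config, h]
        · simp [EncState.config, hj]
  | inc i j h h' hi =>
      refine ⟨⟨hs'.1, fun l hl => ?_⟩, .inr ?_⟩
      · have : l ≠ i := by rintro rfl; simp [hi] at hl
        have := hs'.2 l (by simpa [this] using hl)
        simpa [update_of_ne ‹l ≠ i›] using this
      · convert Machine.Step.inc s.config i j h' using 1
        refine Config.ext' ?_ rfl
        funext l
        by_cases hl : l = i
        · subst hl; simp [EncState.config, hi]
        · simp [EncState.config, hl]
  | dec i j₁ j₂ h h' hi =>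
      have hpos : 0 < s.reg i := hs'.2 i (by simp)
      refine ⟨⟨hs'.1, fun l hl => ?_⟩, .inr ?_⟩
      · have : l ≠ i := by rintro rfl; simp [hi] at hl
        exact hs'.2 l (by simpa [this] using hl)
      · convert Machine.Step.decPos s.config i j₁ j₂ h'
          (by simpa [EncState.config, hi] using hpos) using 1
        refine Config.ext' ?_ rfl
        funext l
        by_cases hl : l = i
        · subst hl; simp [EncState.config, hi]
        · simp [EncState.config, hl]
  | rst i j₁ j₂ h h' hi =>
      have hg := hs'.1
      simp only [Multiset.sum_cons, Nat.add_eq_zero_iff] at hg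
      refine ⟨⟨hg.2, fun l hl => ?_⟩, .inr ?_⟩
      · have : l ≠ i := by rintro rfl; simp [hi] at hl
        have := hs'.2 l (by simpa [this] using hl)
        simpa [update_of_ne ‹l ≠ i›] using this
      · convert Machine.Step.decZero s.config i j₁ j₂ h'
          (by simpa [EncState.config, hi] using hg.1) using 1
        refine Config.ext' ?_ rfl
        funext l
        by_cases hl : l = i
        · subst hl; simp [EncState.config, hi, hg.1]
        · simp [EncState.config, hl]
  | token i r h hr =>
      refine ⟨⟨hs'.1, fun l hl => ?_⟩, .inl (Config.ext' ?_ rfl)⟩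
      · by_cases hli : l = i
        · subst hli; omega
        · have := hs'.2 l (by simpa [hli] using hl)
          simpa [hli] using this
      · funext l
        by_cases hl : l = i
        · subst hl; simp [EncState.config, h, hr]
        · simp [EncState.config, hl]

/-- Liveness is required at the end of the run only; removing steps from the end carries it back to
the start. -/
theorem EncState.reach_config {s s' : EncState k n} (h : ReflTransGen (EncState.Step M) s s')
    (hs' : s'.Live) : Machine.Reach M s.config s'.config := by
  induction h with
  | refl => exact .refl
  | tail _ h ih =>
      obtain ⟨hl, h | h⟩ := h.live hs'
      · exact h ▸ ih hl
      · exact (ih hl).tail h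

/-- The state of a configuration, with empty garbage. -/
def Config.stateWith (c : Config k n) (j : ℕ) : EncState k n :=
  ⟨false, c.pc, fun _ => .ready, c.reg, Multiset.replicate j 0⟩

theorem Config.enc_stateWith (c : Config k n) (j : ℕ) :
    (c.stateWith j).enc () () M = c.state.enc () () M := by
  have h : garbageQ () () 0 = 0 := by rw [garbageQ, tokensQ, zero_smul, resQ_zero]
  simp only [EncState.enc, EncState.comps, Config.stateWith, Config.state, EncState.others,
    Multiset.map_replicate, h, Multiset.sum_cons, Multiset.sum_add, Multiset.sum_replicate,
    smul_zero, Multiset.map_zero, Multiset.sum_zero]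

/-- A correct reset abandons an empty cell, so the number of empty garbage cells may grow by one
although the represented process does not change. -/
theorem Machine.Step.simulated {c d : Config k n} (h : Machine.Step M c d) (g : ℕ) :
    ∃ g', ReflTransGen (EncState.Step M) (c.stateWith g) (d.stateWith g') := by
  have hu : ∀ (i : Fin k) (m : Mode), update (update (fun _ : Fin k => Mode.ready) i m) i .ready =
      fun _ => .ready := by
    intro i m; rw [update_idem, update_eq_self_iff]
  have hu' : ∀ (i : Fin k) (m m' : Mode),
      update (update (update (fun _ : Fin k => Mode.ready) i m) i m') i .ready =
      fun _ => .ready := by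
    intro i m m'; rw [update_idem, hu]
  -- Every instruction starts by being fetched and by the offer of the cell that it needs.
  have h₀ : ∀ i : Fin k, ReflTransGen (EncState.Step M) (c.stateWith g)
      ⟨true, c.pc, update (fun _ => .ready) i .choosing, c.reg, Multiset.replicate g 0⟩ := by
    intro i
    exact (ReflTransGen.single (.fetch (c.stateWith g) rfl)).tail
      (.offer ⟨true, c.pc, fun _ => .ready, c.reg, Multiset.replicate g 0⟩ i rfl)
  cases h with
  | inc i j h =>
      refine ⟨g, (h₀ i).tail ?_⟩
      have := EncState.Step.inc (M := M)
        ⟨true, c.pc, update (fun _ => .ready) i .choosing, c.reg, Multiset.replicate g 0⟩ i j rfl h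
        (by simp)
      simp only [hu] at this
      exact this
  | decPos i j₁ j₂ h hpos =>
      refine ⟨g, ((h₀ i).tail (EncState.Step.dec _ i j₁ j₂ rfl h (by simp))).tail ?_⟩
      have := EncState.Step.token (M := M)
        ⟨false, j₁, update (update (fun _ => .ready) i .choosing) i .waiting, c.reg,
          Multiset.replicate g 0⟩ i (c.reg i - 1) (by simp) (by simp only; omega)
      simp only [hu'] at this
      exact this
  | decZero i j₁ j₂ h hz =>
      refine ⟨g + 1, (h₀ i).tail ?_⟩
      have := EncState.Step.rst (M := M)
        ⟨true, c.pc, update (fun _ => .ready) i .choosing, c.reg, Multiset.replicate g 0⟩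
        i j₁ j₂ rfl h (by simp)
      simp only [hu, hz, ← Multiset.replicate_succ] at this
      rw [← hz, update_eq_self] at this
      rw [hz] at this
      exact this

theorem EncState.exists_reach {s s' : EncState k n} (h : ReflTransGen (EncState.Step M) s s')
    {P : PiTerm} (hP : P.q = s.enc () () M) : ∃ Q : PiTerm, Q.q = s'.enc () () M ∧ Reach P Q := by
  induction h with
  | refl => exact ⟨P, hP, .refl⟩
  | @tail s₁ s₂ _ h ih =>
      obtain ⟨Q, hQ, hPQ⟩ := ih
      obtain ⟨R, hR⟩ : ∃ R : PiTerm, R.q = s₂.enc () () M := Quotient.exists_rep _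
      exact ⟨R, hR, hPQ.tail (Red.step (hQ ▸ hR ▸ h.red () ()))⟩

theorem EncState.exists_of_reach {s : EncState k n} {P Q : PiTerm} (hP : P.q = s.enc () () M)
    (h : Reach P Q) : ∃ s', ReflTransGen (EncState.Step M) s s' ∧ Q.q = s'.enc () () M := by
  induction h with
  | refl => exact ⟨s, .refl, hP⟩
  | tail _ h ih =>
      obtain ⟨s₁, h₁, hQ⟩ := ih
      obtain ⟨s₂, h₂, hR⟩ := EncState.step_of_step hQ h
      exact ⟨s₂, h₁.tail h₂, hR⟩

theorem encode_q (M : Machine k n) (c : Config k n) :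
    (encode M c).q = c.state.enc () () M := by
  rw [encode_eq, encodeA_q]

theorem reach_encode_iff (M : Machine k n) (c d : Config k n) :
    Machine.Reach M c d ↔ Reach (encode M c) (encode M d) := by
  constructor
  · intro h
    have : ∃ g, ReflTransGen (EncState.Step M) (c.stateWith 0) (d.stateWith g) := by
      induction h with
      | refl => exact ⟨0, .refl⟩
      | tail _ h ih =>
          obtain ⟨g, hg⟩ := ih
          obtain ⟨g', hg'⟩ := h.simulated g
          exact ⟨g', hg.trans hg'⟩
    obtain ⟨g, hg⟩ := this
    -- The empty run reaches only the term itself, not the congruent ones. An empty run therefore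
    -- has to give `d = c`, and in any other run the last step is directed at the very term `encode
    -- M d`, which is possible because reduction is closed under congruence.
    rcases ReflTransGen.cases_tail hg with e | ⟨s, hs, hsd⟩
    · have : d = c := Config.ext' (congrArg EncState.reg e) (congrArg EncState.pc e)
      exact this ▸ .refl
    · obtain ⟨Q, hQ, hR⟩ := EncState.exists_reach (P := encode M c) hs
        (by rw [encode_q, Config.enc_stateWith])
      refine hR.tail (Red.step ?_)
      rw [hQ, encode_q, ← Config.enc_stateWith d g]
      exact hsd.red () ()
  · intro h
    obtain ⟨s, hs, e⟩ := EncState.exists_of_reach (encode_q M c) h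
    rw [encode_q] at e
    obtain ⟨-, hpc, hm, hr, hg⟩ := EncState.eq_of_enc_eq M s e.symm
    have hl : s.Live := ⟨hg, fun i hi => by simp [hm i] at hi⟩
    have := EncState.reach_config hs hl
    have e₁ : c.state.config = c := rfl
    have e₂ : s.config = d := Config.ext' (by funext i; simp [EncState.config, hm, hr]) hpc
    rwa [e₁, e₂] at this

end Simulation

end PiCalc

-- Annotations that respect congruence, and hierarchical encodings

namespace PiCalc

/-! ## Canonical annotations

Names are classified as channels of counters or other names. A restriction is annotated by `x` if
its name is sent on a channel that is not a channel of a counter, and by `t` otherwise. -/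

/-- Extension of a function on names by a value for a new innermost bound name. -/
def ncons {β : Type} (v : β) (ρ : ℕ → β) : ℕ → β
  | 0 => v
  | i + 1 => ρ i

section Ncons
variable {β : Type} (u v : β) (ρ : ℕ → β)

@[simp] theorem ncons_zero : ncons v ρ 0 = v := rfl
@[simp] theorem ncons_succ (i : ℕ) : ncons v ρ (i + 1) = ρ i := rfl

theorem ncons_comp_lift (f : ℕ → ℕ) : ncons v ρ ∘ lift f = ncons v (ρ ∘ f) := by
  funext i; cases i <;> rfl

theorem ncons_comp_succ : ncons v ρ ∘ Nat.succ = ρ := rfl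

theorem ncons_ncons_comp_swap01 : ncons u (ncons v ρ) ∘ swap01 = ncons v (ncons u ρ) := by
  funext i; rcases i with _ | _ | i <;> rfl

theorem comp_ncons {γ : Type} (h : β → γ) : h ∘ ncons v ρ = ncons (h v) (h ∘ ρ) := by
  funext i; cases i <;> rfl

end Ncons

mutual
/-- Some output in the term sends a name of colour `none` on a name whose colour is not
`some true`. -/
def Proc.sends {α : Type} (ρ : ℕ → Option Bool) : Proc α → Bool
  | .nil => false
  | .res _ P => Proc.sends (ncons (some false) ρ) P
  | .par P Q => Proc.sends ρ P || Proc.sends ρ Q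
  | .sum M => Choice.sends ρ M
  | .bang M => Choice.sends ρ M
def Choice.sends {α : Type} (ρ : ℕ → Option Bool) : Choice α → Bool
  | .pre (.inp _) P => Proc.sends (ncons (some false) ρ) P
  | .pre (.out a b) P => (ρ a != some true && ρ b == none) || Proc.sends ρ P
  | .pre .tau P => Proc.sends ρ P
  | .plus M N => Choice.sends ρ M || Choice.sends ρ N
end

mutual
theorem Proc.sends_rename {α : Type} (f : ℕ → ℕ) (ρ : ℕ → Option Bool) : ∀ P : Proc α,
    (P.rename f).sends ρ = P.sends (ρ ∘ f)
  | .nil => rfl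
  | .res _ P => by
      simp only [Proc.rename, Proc.sends, Proc.sends_rename (lift f) _ P, ncons_comp_lift]
  | .par P Q => by
      simp only [Proc.rename, Proc.sends, Proc.sends_rename f ρ P, Proc.sends_rename f ρ Q]
  | .sum M => Choice.sends_rename f ρ M
  | .bang M => Choice.sends_rename f ρ M
theorem Choice.sends_rename {α : Type} (f : ℕ → ℕ) (ρ : ℕ → Option Bool) : ∀ M : Choice α,
    (M.rename f).sends ρ = M.sends (ρ ∘ f)
  | .pre (.inp _) P => by
      simp only [Choice.rename, Pre.rename, Pre.under, Choice.sends,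
        Proc.sends_rename (lift f) _ P, ncons_comp_lift]
  | .pre (.out _ _) P => by
      simp only [Choice.rename, Pre.rename, Pre.under, Choice.sends, Proc.sends_rename f _ P,
        Function.comp_apply]
  | .pre .tau P => Proc.sends_rename f ρ P
  | .plus M N => by
      simp only [Choice.rename, Choice.sends, Choice.sends_rename f ρ M, Choice.sends_rename f ρ N]
end

mutual
theorem Proc.sends_eq_false {α : Type} (ρ : ℕ → Option Bool) (h : ∀ a, ρ a ≠ none) :
    ∀ P : Proc α, P.sends ρ = false
  | .nil => rfl
  | .res _ P => Proc.sends_eq_false _ (fun a => by cases a; exacts [nofun, h _]) P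
  | .par P Q => by simp only [Proc.sends, Proc.sends_eq_false ρ h P, Proc.sends_eq_false ρ h Q]; rfl
  | .sum M => Choice.sends_eq_false ρ h M
  | .bang M => Choice.sends_eq_false ρ h M
theorem Choice.sends_eq_false {α : Type} (ρ : ℕ → Option Bool) (h : ∀ a, ρ a ≠ none) :
    ∀ M : Choice α, M.sends ρ = false
  | .pre (.inp _) P => Proc.sends_eq_false _ (fun a => by cases a; exacts [nofun, h _]) P
  | .pre (.out a b) P => by
      have := Option.isSome_iff_ne_none.2 (h b)
      simp [Choice.sends, Proc.sends_eq_false ρ h P, this]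
  | .pre .tau P => Proc.sends_eq_false ρ h P
  | .plus M N => by
      simp only [Choice.sends, Choice.sends_eq_false ρ h M, Choice.sends_eq_false ρ h N]; rfl
end

theorem Proc.Cong.sends_eq {α : Type} {P Q : Proc α} (h : P.Cong Q) :
    ∀ ρ, P.sends ρ = Q.sends ρ := by
  refine Proc.Cong.rec (motive_1 := fun P Q _ => ∀ ρ, P.sends ρ = Q.sends ρ)
    (motive_2 := fun M N _ => ∀ ρ, M.sends ρ = N.sends ρ)
    ?_ ?_ ?_ ?_ ?_ ?_ ?_ ?_ ?_ ?_ ?_ ?_ ?_ ?_ ?_ ?_ ?_ ?_ ?_ ?_ ?_ h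
  · exact fun _ _ => rfl
  · exact fun _ ih ρ => (ih ρ).symm
  · exact fun _ _ ih ih' ρ => (ih ρ).trans (ih' ρ)
  · exact fun _ _ ih ρ => ih _
  · intro P P' Q Q' _ _ ih ih' ρ; simp only [Proc.sends, ih, ih']
  · exact fun _ ih ρ => ih ρ
  · exact fun _ ih ρ => ih ρ
  · exact fun P Q ρ => Bool.or_comm _ _
  · exact fun P Q R ρ => Bool.or_assoc _ _ _
  · exact fun P ρ => Bool.or_false _
  · exact fun τ ρ => rfl
  · intro σ τ P ρ
    simp only [Proc.sends, Proc.sends_rename, ncons_ncons_comp_swap01]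
  · exact fun M ρ => (Bool.or_self _).symm
  · intro τ P Q ρ
    simp only [Proc.sends, Proc.shift, Proc.sends_rename, ncons_comp_succ]
  · exact fun _ _ => rfl
  · exact fun _ ih ρ => (ih ρ).symm
  · exact fun _ _ ih ih' ρ => (ih ρ).trans (ih' ρ)
  · intro P Q π _ ih ρ; cases π <;> simp only [Choice.sends, ih]
  · intro M M' N N' _ _ ih ih' ρ; simp only [Choice.sends, ih, ih']
  · exact fun M N ρ => Bool.or_comm _ _
  · exact fun M N O ρ => Bool.or_assoc _ _ _

section Annotation
variable {α : Type} (t x : α)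

mutual
/-- The canonical annotation. The names with `c n = true` are the channels of the counters. -/
def Proc.annotate (c : ℕ → Bool) : PiTerm → Proc α
  | .nil => .nil
  | .res _ P => .res (if P.sends (ncons none (some ∘ c)) then x else t)
      (Proc.annotate (ncons false c) P)
  | .par P Q => .par (Proc.annotate c P) (Proc.annotate c Q)
  | .sum M => .sum (Choice.annotate c M)
  | .bang M => .bang (Choice.annotate c M)
def Choice.annotate (c : ℕ → Bool) : Choice Unit → Choice α
  | .pre (.inp a) P => .pre (.inp a) (Proc.annotate (ncons false c) P)
  | .pre (.out a b) P => .pre (.out a b) (Proc.annotate c P)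
  | .pre .tau P => .pre .tau (Proc.annotate c P)
  | .plus M N => .plus (Choice.annotate c M) (Choice.annotate c N)
end

mutual
theorem Proc.erase_annotate (c : ℕ → Bool) : ∀ P : PiTerm, (P.annotate t x c).erase = P
  | .nil => rfl
  | .res _ P => congrArg (Proc.res ()) (Proc.erase_annotate _ P)
  | .par P Q => congrArg₂ Proc.par (Proc.erase_annotate c P) (Proc.erase_annotate c Q)
  | .sum M => congrArg Proc.sum (Choice.erase_annotate c M)
  | .bang M => congrArg Proc.bang (Choice.erase_annotate c M)
theorem Choice.erase_annotate (c : ℕ → Bool) : ∀ M : Choice Unit,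
    (M.annotate t x c).mapAnn (fun _ => ()) = M
  | .pre (.inp a) P => congrArg (Choice.pre (.inp a)) (Proc.erase_annotate _ P)
  | .pre (.out a b) P => congrArg (Choice.pre (.out a b)) (Proc.erase_annotate _ P)
  | .pre .tau P => congrArg (Choice.pre .tau) (Proc.erase_annotate _ P)
  | .plus M N => congrArg₂ Choice.plus (Choice.erase_annotate c M) (Choice.erase_annotate c N)
end

mutual
theorem Proc.annotate_rename (f : ℕ → ℕ) (c : ℕ → Bool) : ∀ P : PiTerm,
    (P.rename f).annotate t x c = (P.annotate t x (c ∘ f)).rename f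
  | .nil => rfl
  | .res _ P => by
      simp only [Proc.rename, Proc.annotate, Proc.annotate_rename (lift f) _ P, ncons_comp_lift,
        Proc.sends_rename, Function.comp_assoc]
  | .par P Q => by
      simp only [Proc.rename, Proc.annotate, Proc.annotate_rename f c P,
        Proc.annotate_rename f c Q]
  | .sum M => congrArg Proc.sum (Choice.annotate_rename f c M)
  | .bang M => congrArg Proc.bang (Choice.annotate_rename f c M)
theorem Choice.annotate_rename (f : ℕ → ℕ) (c : ℕ → Bool) : ∀ M : Choice Unit,
    (M.rename f).annotate t x c = (M.annotate t x (c ∘ f)).rename f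
  | .pre (.inp _) P => by
      simp only [Choice.rename, Pre.rename, Pre.under, Choice.annotate,
        Proc.annotate_rename (lift f) _ P, ncons_comp_lift]
  | .pre (.out _ _) P => by
      simp only [Choice.rename, Pre.rename, Pre.under, Choice.annotate, Proc.annotate_rename f _ P]
  | .pre .tau P => congrArg (Choice.pre .tau) (Proc.annotate_rename f c P)
  | .plus M N => congrArg₂ Choice.plus (Choice.annotate_rename f c M) (Choice.annotate_rename f c N)
end

theorem some_comp_ne_none (c : ℕ → Bool) (a : ℕ) : (some ∘ c) a ≠ none := nofun

/-- The annotation of a restriction depends on its scope only through `sends`, which congruence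
preserves, and on the classification of the other names. Under extrusion the scope gains a process
that does not contain the bound name and hence never sends it. -/
theorem Proc.Cong.annotate {P Q : PiTerm} (h : P.Cong Q) :
    ∀ c, (P.annotate t x c).Cong (Q.annotate t x c) := by
  refine Proc.Cong.rec (motive_1 := fun P Q _ => ∀ c, (P.annotate t x c).Cong (Q.annotate t x c))
    (motive_2 := fun M N _ => ∀ c, (M.annotate t x c).Cong (N.annotate t x c))
    ?_ ?_ ?_ ?_ ?_ ?_ ?_ ?_ ?_ ?_ ?_ ?_ ?_ ?_ ?_ ?_ ?_ ?_ ?_ ?_ ?_ h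
  · exact fun _ _ => .refl _
  · exact fun _ ih c => (ih c).symm
  · exact fun _ _ ih ih' c => (ih c).trans (ih' c)
  · intro P Q τ h ih c
    simp only [Proc.annotate, h.sends_eq]
    exact .res _ (ih _)
  · exact fun _ _ ih ih' c => .par (ih c) (ih' c)
  · exact fun _ ih c => .sum (ih c)
  · exact fun _ ih c => .bang (ih c)
  · exact fun P Q c => .par_comm _ _
  · exact fun P Q R c => .par_assoc _ _ _
  · exact fun P c => .par_nil _
  · exact fun τ c => .res_nil _
  · intro σ τ P c
    simp only [Proc.annotate, Proc.sends, Proc.sends_rename, Proc.annotate_rename, comp_ncons,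
      ncons_ncons_comp_swap01]
    exact .res_swap _ _ _
  · exact fun M c => .unfold _
  · intro τ P Q c
    simp only [Proc.annotate, Proc.shift, Proc.sends, Proc.sends_rename, Proc.annotate_rename,
      ncons_comp_succ, Proc.sends_eq_false _ (some_comp_ne_none c), Bool.false_or]
    exact .extrude _ _ _
  · exact fun _ _ => .refl _
  · exact fun _ ih c => (ih c).symm
  · exact fun _ _ ih ih' c => (ih c).trans (ih' c)
  · intro P Q π _ ih c; cases π <;> exact .pre _ (ih _)
  · exact fun _ _ ih ih' c => .plus (ih c) (ih' c)
  · exact fun M N c => .plus_comm _ _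
  · exact fun M N O c => .plus_assoc _ _ _

/-- The canonical annotation of a congruence class. -/
def annotateQ (c : ℕ → Bool) : ProcQ Unit →+ ProcQ α where
  toFun := Quotient.map (Proc.annotate t x c) fun _ _ h => Proc.Cong.annotate t x h c
  map_zero' := rfl
  map_add' a b := by
    induction a using ProcQ.ind; induction b using ProcQ.ind; rfl

theorem annotateQ_q (c : ℕ → Bool) (P : PiTerm) : annotateQ t x c P.q = (P.annotate t x c).q := rfl

theorem Proc.annotate_shift (c : ℕ → Bool) (v : Bool) (P : PiTerm) :
    P.shift.annotate t x (ncons v c) = (P.annotate t x c).shift :=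
  Proc.annotate_rename t x _ _ P

theorem Proc.annotate_parList (c : ℕ → Bool) : ∀ L : List PiTerm,
    (parList L).annotate t x c = parList (L.map (Proc.annotate t x c))
  | [] => rfl
  | [_] => rfl
  | _ :: B :: L => congrArg (Proc.par _) (Proc.annotate_parList c (B :: L))

theorem Proc.sends_parList (ρ : ℕ → Option Bool) (L : List PiTerm)
    (h : ∀ A ∈ L, A.sends ρ = false) : (parList L).sends ρ = false := by
  induction L with
  | nil => rfl
  | cons A L ih =>
      cases L with
      | nil => exact h A (by simp)
      | cons B L =>
          simp only [parList, Proc.sends, h A (by simp), Bool.false_or]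
          exact ih fun C hC => h C (by simp_all)

theorem annotate_outZA {c : ℕ → Bool} {a : ℕ} (h : c a = false) (P : PiTerm) :
    (outZA () a P).annotate t x c = outZA x a (P.annotate t x c) := by
  simp [outZA, Proc.annotate, Choice.annotate, Proc.sends, Choice.sends, h, Proc.annotate_shift]

theorem annotate_outZ2A {c : ℕ → Bool} {a b : ℕ} (h : c a = false) (P Q : PiTerm) :
    (outZ2A () a P b Q).annotate t x c = outZ2A x a (P.annotate t x c) b (Q.annotate t x c) := by
  simp [outZ2A, Proc.annotate, Choice.annotate, Proc.sends, Choice.sends, h, Proc.annotate_shift]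

theorem annotate_inZA (c : ℕ → Bool) (a : ℕ) (P : PiTerm) :
    (inZA a P).annotate t x c = inZA a (P.annotate t x c) := by
  simp [inZA, Choice.annotate, Proc.annotate_shift]

theorem annotate_msgA (c : ℕ → Bool) (a b : ℕ) :
    (msgA a b : PiTerm).annotate t x c = msgA a b := rfl

/-- The classification of the free names of encodings. -/
def isP (n : ℕ) : Bool := n % 5 == 0

@[simp] theorem isP_nP (i : ℕ) : isP (nP i) = true := by simp [isP, nP]
@[simp] theorem isP_nInc (i : ℕ) : isP (nInc i) = false := by simp [isP, nInc]
@[simp] theorem isP_nDec (i : ℕ) : isP (nDec i) = false := by simp [isP, nDec]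
@[simp] theorem isP_nRst (i : ℕ) : isP (nRst i) = false := by simp [isP, nRst]
@[simp] theorem isP_nLoc (i : ℕ) : isP (nLoc i) = false := by simp [isP, nLoc]

theorem annotate_counterBodyA (i : ℕ) : (counterBodyA () () i).annotate t x (ncons false isP) =
    counterBodyA t x i := by
  simp only [counterBodyA, Choice.annotate, annotate_inZA, Proc.annotate, annotate_msgA,
    annotate_outZA t x (c := ncons false isP) (a := 0) rfl]
  simp [msgA, Proc.sends, Choice.sends]

theorem annotate_counterA (i : ℕ) : (counterA () () i).annotate t x isP = counterA t x i := by
  simp only [counterA, Proc.annotate, Choice.annotate, annotate_counterBodyA]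

theorem annotate_bodyA {k n : ℕ} (I : Instr k n) : (bodyA () I).annotate t x isP = bodyA x I := by
  cases I <;> simp [bodyA, annotate_outZA, annotate_outZ2A, Proc.annotate]

theorem annotate_instrA {k n : ℕ} (m : Fin n) (I : Instr k n) :
    (instrA () m I).annotate t x isP = instrA x m I := by
  simp only [instrA, Proc.annotate, annotate_inZA, annotate_bodyA]

theorem annotate_controlA {k n : ℕ} (M : Machine k n) (pc : Fin n) (b : Bool) :
    (controlA () M pc b).annotate t x isP = controlA x M pc b := by
  cases b
  · simp [controlA, annotate_outZA, Proc.annotate]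
  · exact annotate_bodyA t x _

theorem annotate_headA (i : ℕ) (m : Mode) :
    (headA () () i m).annotate t x (ncons false isP) = headA t x i m := by
  cases m
  · rfl
  · simp only [headA, Proc.annotate, annotate_counterBodyA]
  · simp only [headA, Proc.annotate, annotate_inZA, annotate_msgA]

/-- A cell name is sent on the channel of its counter and nowhere else; its use as a subject does
not count. Hence its restriction receives the annotation `t` in every mode. -/
theorem sends_headA (i : ℕ) (m : Mode) :
    (headA () () i m).sends (ncons none (some ∘ isP)) = false := by
  cases m
  · simp [headA, msgA, Proc.sends, Choice.sends]
  · simp [headA, counterBodyA, msgA, Proc.sends, Choice.sends, inZA, outZA, Proc.shift,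
      Proc.rename, Choice.rename, Pre.rename, Pre.under]
  · simp [headA, msgA, Proc.sends, Choice.sends, inZA, Proc.shift, Proc.rename, Choice.rename,
      Pre.rename]

/-- The tokens of a counter cell, as a process. -/
def tokensA (r : ℕ) : Proc α := parList (List.replicate r (outZA x 0 .nil))

theorem q_tokensA (r : ℕ) : (tokensA x r).q = tokensQ x r := by
  rw [tokensA, Proc.q_parList, List.map_replicate, List.sum_replicate]; rfl

theorem annotate_tokensA (r : ℕ) :
    (tokensA () r).annotate t x (ncons false isP) = tokensA x r := by
  rw [tokensA, Proc.annotate_parList, List.map_replicate,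
    annotate_outZA t x (c := ncons false isP) (a := 0) rfl]
  rfl

theorem sends_tokensA (r : ℕ) : (tokensA () r).sends (ncons none (some ∘ isP)) = false := by
  refine Proc.sends_parList _ _ fun A hA => ?_
  rw [List.eq_of_mem_replicate hA]
  simp [outZA, Proc.sends, Choice.sends, Proc.shift, Proc.rename]

theorem annotateQ_cellQ (i : ℕ) (m : Mode) (r : ℕ) :
    annotateQ t x isP (cellQ () () i m r) = cellQ t x i m r := by
  rw [cellQ, cellQ, ← q_tokensA, ← q_tokensA, ← Proc.q_par, ← Proc.q_par, ← Proc.q_res,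
    ← Proc.q_res, annotateQ_q]
  simp only [Proc.annotate, Proc.sends, sends_headA, sends_tokensA, annotate_headA,
    annotate_tokensA]
  rfl

theorem annotateQ_garbageQ (r : ℕ) : annotateQ t x isP (garbageQ () () r) = garbageQ t x r := by
  rw [garbageQ, garbageQ, ← q_tokensA, ← q_tokensA, ← Proc.q_res, ← Proc.q_res, annotateQ_q]
  simp only [Proc.annotate, sends_tokensA, annotate_tokensA]
  rfl

/-- The canonical annotation recovers the annotated state from the plain one, so the forward
simulation, which holds for all annotations, lifts the reductions. -/
theorem annotateQ_enc {k n : ℕ} (M : Machine k n) (s : EncState k n) :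
    annotateQ t x isP (s.enc () () M) = s.enc t x M := by
  rw [EncState.enc, EncState.enc, map_multiset_sum]
  simp only [EncState.comps, EncState.cells, EncState.others, Multiset.map_cons, Multiset.map_add,
    Multiset.map_map, Function.comp_def, annotateQ_q, annotate_controlA, annotate_counterA,
    annotate_instrA, annotateQ_cellQ, annotateQ_garbageQ]

end Annotation

/-! ## Compatibility -/

/-- Along nested active restrictions the base types increase strictly, also above `l`. -/
def Hierarchy.Increasing (T : Hierarchy) {α : Type} (base : α → T.Base) :
    Option T.Base → Proc α → Prop
  | _, .nil => True
  | l, .res τ P => (∀ b ∈ l, T.lt b (base τ)) ∧ Increasing T base (some (base τ)) P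
  | l, .par P Q => Increasing T base l P ∧ Increasing T base l Q
  | _, .sum _ => True
  | _, .bang _ => True

section Compat
variable {T : Hierarchy} {α : Type} {base : α → T.Base}

theorem Hierarchy.Increasing.toRoot : ∀ {P : Proc α} {l : Option T.Base},
    T.Increasing base l P → T.Increasing base none P
  | .nil, _, _ => trivial
  | .res _ _, _, h => ⟨nofun, h.2⟩
  | .par _ _, _, h => ⟨h.1.toRoot, h.2.toRoot⟩
  | .sum _, _, _ => trivial
  | .bang _, _, _ => trivial

theorem Hierarchy.Increasing.parList {l : Option T.Base} : ∀ {L : List (Proc α)},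
    (∀ A ∈ L, T.Increasing base l A) → T.Increasing base l (parList L)
  | [], _ => trivial
  | [A], h => h A (by simp)
  | A :: B :: L, h =>
      ⟨h A (by simp), Hierarchy.Increasing.parList fun C hC => h C (List.mem_cons_of_mem _ hC)⟩

theorem Hierarchy.Increasing.of_isSeq {P : Proc α} (h : P.IsSeq) (l : Option T.Base) :
    T.Increasing base l P := by
  cases P <;> trivial

theorem Hierarchy.Increasing.chain_of_rootTrace : ∀ {P : Proc α} {l : Option T.Base}
    (_ : T.Increasing base l P) (ts : List T.Base) (A : Proc α)
    (_ : (P.forest base).RootTrace (ts.map Sum.inl ++ [Sum.inr A])), (l.toList ++ ts).IsChain T.lt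
  | .nil, l, h, ts, A, ht => by cases ht
  | .res τ P, l, h, ts, A, ht => by
      rw [Proc.forest] at ht
      cases ts with
      | nil => cases l <;> simp
      | cons u ts =>
          simp only [List.map_cons, List.cons_append] at ht
          generalize hw : ts.map Sum.inl ++ [Sum.inr A] = w at ht
          cases ht with
          | here => simp at hw
          | cons _ ht =>
              subst hw
              have := h.2.chain_of_rootTrace ts A ht
              cases l with
              | none => simpa using this
              | some l => simpa [h.1 l rfl] using this
  | .par P Q, l, h, ts, A, ht => by
      cases ht with
      | left _ ht => exact h.1.chain_of_rootTrace ts A ht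
      | right _ ht => exact h.2.chain_of_rootTrace ts A ht
  | .sum M, l, h, ts, A, ht => by
      rw [Proc.forest] at ht
      cases ts with
      | nil => cases l <;> simp
      | cons u ts => simp only [List.map_cons, List.cons_append] at ht; cases ht
  | .bang M, l, h, ts, A, ht => by
      rw [Proc.forest] at ht
      cases ts with
      | nil => cases l <;> simp
      | cons u ts => simp only [List.map_cons, List.cons_append] at ht; cases ht

theorem Hierarchy.Increasing.compatForest : ∀ {P : Proc α} {l : Option T.Base}
    (_ : T.Increasing base l P), T.CompatForest (P.forest base)
  | .nil, l, h, ts, A, ht => by cases ht with | root ht => cases ht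
  | .res τ P, l, h, ts, A, ht => by
      cases ht with
      | root ht => exact h.toRoot.chain_of_rootTrace ts A ht
      | sub _ ht => exact h.2.compatForest ts A ht
  | .par P Q, l, h, ts, A, ht => by
      cases ht with
      | root ht => exact h.toRoot.chain_of_rootTrace ts A ht
      | left _ ht => exact h.1.compatForest ts A ht
      | right _ ht => exact h.2.compatForest ts A ht
  | .sum M, l, h, ts, A, ht => by
      cases ht with
      | root ht => exact h.toRoot.chain_of_rootTrace ts A ht
      | sub _ ht => cases ht with | root ht => cases ht
  | .bang M, l, h, ts, A, ht => by
      cases ht with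
      | root ht => exact h.toRoot.chain_of_rootTrace ts A ht
      | sub _ ht => cases ht with | root ht => cases ht

theorem Hierarchy.Compat.of_increasing {P Q : Proc α} {l : Option T.Base}
    (h : T.Increasing base l P) (e : P.q = Q.q) : T.Compat base Q :=
  ⟨_, ⟨P, Proc.q_eq.1 e, rfl⟩, h.compatForest⟩

/-- Congruence classes with a member in which base types increase. -/
def Hierarchy.IncreasingQ (T : Hierarchy) {α : Type} (base : α → T.Base) :
    AddSubmonoid (ProcQ α) where
  carrier := {p | ∃ P : Proc α, P.q = p ∧ T.Increasing base none P}
  zero_mem' := ⟨.nil, rfl, trivial⟩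
  add_mem' := by
    rintro _ _ ⟨P, rfl, hP⟩ ⟨Q, rfl, hQ⟩
    exact ⟨.par P Q, rfl, hP, hQ⟩

theorem increasing_tokensA {x : α} {l : Option T.Base} (h : ∀ b ∈ l, T.lt b (base x)) (r : ℕ) :
    T.Increasing base l (tokensA x r) := by
  refine Hierarchy.Increasing.parList fun A hA => ?_
  rw [List.eq_of_mem_replicate hA]
  exact ⟨h, trivial⟩

theorem increasing_headA (t x : α) (i : ℕ) (m : Mode) (l : Option T.Base) :
    T.Increasing base l (headA t x i m) := by
  cases m <;> trivial

/-- No component needs more than two nested active restrictions, and these are a cell name above the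
private objects of its tokens. -/
theorem EncState.enc_mem_increasingQ {t x : α} (h : T.lt (base t) (base x)) {k n : ℕ}
    (M : Machine k n) (s : EncState k n) : s.enc t x M ∈ T.IncreasingQ base := by
  refine multiset_sum_mem _ fun p hp => ?_
  simp only [EncState.comps, EncState.cells, EncState.others, Multiset.mem_cons, Multiset.mem_add,
    Multiset.mem_map] at hp
  have htok : ∀ r, T.Increasing base (some (base t)) (tokensA x r) := increasing_tokensA (by simpa)
  rcases hp with rfl | ⟨i, -, rfl⟩ | ⟨i, -, rfl⟩ | ⟨m, -, rfl⟩ | ⟨r, -, rfl⟩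
  · refine ⟨_, rfl, ?_⟩
    cases s.fetched
    · exact ⟨nofun, trivial⟩
    · simp only [controlA]
      cases M s.pc <;> exact ⟨nofun, trivial⟩
  · refine ⟨.res t (.par (headA t x i (s.mode i)) (tokensA x (s.reg i))), ?_, nofun,
      increasing_headA _ _ _ _ _, htok _⟩
    rw [Proc.q_res, Proc.q_par, q_tokensA]; rfl
  · exact ⟨_, rfl, trivial⟩
  · exact ⟨_, rfl, trivial⟩
  · refine ⟨.res t (tokensA x r), ?_, nofun, htok _⟩
    rw [Proc.q_res, q_tokensA]; rfl

end Compat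

/-! ## The encoding is hierarchical -/

/-- The chain of four base types. -/
def chainHierarchy : Hierarchy where
  Base := Fin 4
  finite := inferInstance
  parent s t := s.val + 1 = t.val
  parent_unique r s t h h' := Fin.ext (by omega)
  acyclic t h := by
    have : ∀ s, Relation.TransGen (fun s t : Fin 4 => s.val + 1 = t.val) s t → s < t := by
      intro s hs
      clear h
      induction hs with
      | single h => exact Fin.lt_def.2 (by omega)
      | tail _ h ih => exact lt_trans ih (Fin.lt_def.2 (by omega))
    exact lt_irrefl _ (this t h)

theorem chainHierarchy_lt {s t : Fin 4} (h : s < t) : chainHierarchy.lt s t := by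
  have : ∀ d, ∀ t : Fin 4, t.val = s.val + 1 + d → chainHierarchy.lt s t := by
    intro d
    induction d with
    | zero => exact fun t ht => .single ht.symm
    | succ d ih =>
        intro t ht
        exact (ih ⟨s.val + 1 + d, by omega⟩ rfl).tail (show _ = _ by simp only; omega)
  exact this (t.val - s.val - 1) t (by have := Fin.lt_def.1 h; omega)

/-- The choice function ignores the annotated source and annotates the target canonically. This is
consistent because all reachable annotated terms are canonical annotations of terms that represent
states. -/
theorem hierarchical_encode {k n : ℕ} (M : Machine k n) (c : Config k n) :
    Hierarchical (encode M c) := by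
  -- Only `t < x` is used here; the two lower base types are needed for typing.
  obtain ⟨t, x, hlt⟩ : ∃ t x, chainHierarchy.lt t x :=
    ⟨(2 : Fin 4), (3 : Fin 4), chainHierarchy_lt (by decide)⟩
  let ann : PiTerm → Proc chainHierarchy.Base := Proc.annotate t x isP
  have hq : ∀ P, (ann P).q = annotateQ t x isP P.q := fun _ => rfl
  have herase : ∀ P, (ann P).erase = P := Proc.erase_annotate _ _ _
  have hstep : ∀ (R Q : PiTerm) (s : EncState k n), R.q = s.enc () () M → Step R Q →
      ∃ s' : EncState k n, Q.q = s'.enc () () M ∧ Step (ann R) (ann Q) := by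
    intro R Q s hR h
    obtain ⟨s', hs', hQ⟩ := EncState.step_of_step hR h
    refine ⟨s', hQ, Red.step ?_⟩
    rw [hq, hq, hR, hQ, annotateQ_enc, annotateQ_enc]
    exact hs'.red _ _
  have hinv : ∀ R', Relation.ReflTransGen (AnnStep fun _ Q => ann Q) (ann (encode M c)) R' →
      ∃ (R : PiTerm) (s : EncState k n), R' = ann R ∧ R.q = s.enc () () M := by
    intro R' h
    induction h with
    | refl => exact ⟨_, _, rfl, encode_q M c⟩
    | tail _ h ih =>
        obtain ⟨R, s, rfl, hR⟩ := ih
        obtain ⟨Q, hQ, rfl⟩ := h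
        rw [herase] at hQ
        obtain ⟨s', hs', -⟩ := hstep R Q s hR hQ
        exact ⟨Q, s', rfl, hs'⟩
  refine ⟨chainHierarchy, ann (encode M c), fun _ Q => ann Q, ⟨herase _, ?_⟩, ?_⟩
  · intro R' hR' Q hQ
    obtain ⟨R, s, rfl, hR⟩ := hinv R' hR'
    rw [herase] at hQ
    exact ⟨herase Q, (hstep R Q s hR hQ).choose_spec.2⟩
  · intro R' hR'
    obtain ⟨R, s, rfl, hR⟩ := hinv R' hR'
    obtain ⟨P, hP, hinc⟩ := EncState.enc_mem_increasingQ (T := chainHierarchy) (base := id) hlt M s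
    refine Hierarchy.Compat.of_increasing hinc ?_
    rw [hP, hq, hR, annotateQ_enc]

end PiCalc

-- Normal forms of encodings and their subterms

namespace PiCalc

/-! ## Normal forms of annotated terms -/

section MapAnn
variable {α β : Type} (g : α → β)

mutual
theorem Proc.mapAnn_rename (f : ℕ → ℕ) : ∀ P : Proc α,
    (P.rename f).mapAnn g = (P.mapAnn g).rename f
  | .nil => rfl
  | .res τ P => congrArg (Proc.res (g τ)) (Proc.mapAnn_rename (lift f) P)
  | .par P Q => congrArg₂ Proc.par (Proc.mapAnn_rename f P) (Proc.mapAnn_rename f Q)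
  | .sum M => congrArg Proc.sum (Choice.mapAnn_rename f M)
  | .bang M => congrArg Proc.bang (Choice.mapAnn_rename f M)
theorem Choice.mapAnn_rename (f : ℕ → ℕ) : ∀ M : Choice α,
    (M.rename f).mapAnn g = (M.mapAnn g).rename f
  | .pre π P => congrArg (Choice.pre (π.rename f)) (Proc.mapAnn_rename (π.under f) P)
  | .plus M N => congrArg₂ Choice.plus (Choice.mapAnn_rename f M) (Choice.mapAnn_rename f N)
end

theorem mapAnn_resList (P : Proc α) : ∀ X : List α,
    (resList X P).mapAnn g = resList (X.map g) (P.mapAnn g)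
  | [] => rfl
  | τ :: X => congrArg (Proc.res (g τ)) (mapAnn_resList P X)

theorem mapAnn_parList : ∀ L : List (Proc α),
    (parList L).mapAnn g = parList (L.map (Proc.mapAnn g))
  | [] => rfl
  | [_] => rfl
  | A :: B :: L => congrArg (Proc.par (A.mapAnn g)) (mapAnn_parList (B :: L))

mutual
theorem Proc.nfData_mapAnn : ∀ P : Proc α,
    (P.mapAnn g).nfData = (P.nfData.1.map g, P.nfData.2.map (Proc.mapAnn g))
  | .nil => rfl
  | .res τ P => by simp only [Proc.mapAnn, Proc.nfData, Proc.nfData_mapAnn P, List.map_cons]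
  | .par P Q => by
      simp only [Proc.mapAnn, Proc.nfData, Proc.nfData_mapAnn P, Proc.nfData_mapAnn Q,
        List.map_append, List.length_map, List.map_map, Function.comp_def, Proc.mapAnn_rename]
  | .sum M => by simp only [Proc.mapAnn, Proc.nfData, Choice.nf_mapAnn M]; rfl
  | .bang M => by simp only [Proc.mapAnn, Proc.nfData, Choice.nf_mapAnn M]; rfl
theorem Choice.nf_mapAnn : ∀ M : Choice α, (M.mapAnn g).nf = M.nf.mapAnn g
  | .pre π P => by
      simp only [Choice.mapAnn, Choice.nf, Proc.nfData_mapAnn P, mapAnn_resList, mapAnn_parList]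
  | .plus M N => congrArg₂ Choice.plus (Choice.nf_mapAnn M) (Choice.nf_mapAnn N)
end

theorem Proc.nf_mapAnn (P : Proc α) : (P.mapAnn g).nf = P.nf.mapAnn g := by
  rw [Proc.nf, Proc.nf, Proc.nfData_mapAnn, mapAnn_resList, mapAnn_parList]

mutual
theorem Proc.anns_mapAnn_subset : ∀ P : Proc α, (P.mapAnn g).anns ⊆ Set.range g
  | .nil => Set.empty_subset _
  | .res τ P => Set.union_subset (Set.singleton_subset_iff.2 ⟨τ, rfl⟩) (Proc.anns_mapAnn_subset P)
  | .par P Q => Set.union_subset (Proc.anns_mapAnn_subset P) (Proc.anns_mapAnn_subset Q)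
  | .sum M => Choice.anns_mapAnn_subset M
  | .bang M => Choice.anns_mapAnn_subset M
theorem Choice.anns_mapAnn_subset : ∀ M : Choice α, (M.mapAnn g).anns ⊆ Set.range g
  | .pre _ P => Proc.anns_mapAnn_subset P
  | .plus M N => Set.union_subset (Choice.anns_mapAnn_subset M) (Choice.anns_mapAnn_subset N)
end

theorem mapAnn_encodeA (t x : α) {k n : ℕ} (M : Machine k n) (c : Config k n) :
    (encodeA t x M c).mapAnn g = encodeA (g t) (g x) M c := by
  have h : ∀ m, (instrA x m (M m)).mapAnn g = instrA (g x) m (M m) := by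
    intro m; cases h : M m <;> rfl
  simp only [encodeA, Proc.mapAnn, mapAnn_parList, List.map_ofFn, Function.comp_def, h, cellA,
    List.map_replicate]
  rfl

end MapAnn

/-! ## The normal form of an encoding is shaped -/

section Shaped
variable {T : Hierarchy} {α : Type} {base : α → T.Base}

theorem Hierarchy.Increasing.rename : ∀ {P : Proc α} {l : Option T.Base}
    (_ : T.Increasing base l P) (f : ℕ → ℕ), T.Increasing base l (P.rename f)
  | .nil, _, _, _ => trivial
  | .res _ _, _, h, _ => ⟨h.1, h.2.rename _⟩
  | .par _ _, _, h, _ => ⟨h.1.rename _, h.2.rename _⟩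
  | .sum _, _, _, _ => trivial
  | .bang _, _, _, _ => trivial

theorem renQ_mem_increasingQ {p : ProcQ α} (h : p ∈ T.IncreasingQ base) (f : ℕ → ℕ) :
    renQ f p ∈ T.IncreasingQ base := by
  obtain ⟨P, rfl, hP⟩ := h
  exact ⟨P.rename f, rfl, hP.rename f⟩

theorem IsNFSeq.isSeq {A : Proc α} (h : IsNFSeq A) : A.IsSeq := by cases h <;> trivial

theorem sum_nfData_mem_increasingQ (P : Proc α) :
    (P.nfData.2.map Proc.q).sum ∈ T.IncreasingQ base := by
  refine list_sum_mem fun p hp => ?_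
  obtain ⟨A, hA, rfl⟩ := List.mem_map.1 hp
  exact ⟨A, rfl, .of_isSeq (P.isNFSeq_nfData A hA).isSeq _⟩

theorem Proc.resListQ_nfData (P : Proc α) :
    resListQ P.nfData.1 (P.nfData.2.map Proc.q).sum = P.q := by
  rw [← Proc.q_nf P, Proc.nf, Proc.q_resList, Proc.q_parList]

/-- Base types still increase after the first `j` restrictions of the normal form are removed. -/
theorem resListQ_drop_mem_increasingQ : ∀ (P : Proc α) (_ : T.Increasing base none P) (j : ℕ)
    (_ : j ≤ P.nfData.1.length),
    resListQ (P.nfData.1.drop j) (P.nfData.2.map Proc.q).sum ∈ T.IncreasingQ base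
  | .nil, _, _, _ => by simp [Proc.nfData, resListQ]
  | .res τ P, h, 0, _ => by
      rw [List.drop_zero, Proc.resListQ_nfData]; exact ⟨_, rfl, h⟩
  | .res τ P, h, j + 1, hj =>
      resListQ_drop_mem_increasingQ P h.2.toRoot j (Nat.le_of_succ_le_succ hj)
  | .par P Q, h, j, hj => by
      have hP := resListQ_drop_mem_increasingQ P h.1
      have hQ := resListQ_drop_mem_increasingQ Q h.2
      simp only [Proc.nfData, List.map_append, List.sum_append, renQ_list_sum, List.drop_append,
        List.length_append] at hj ⊢
      generalize P.nfData.1 = X at *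
      have hL := sum_nfData_mem_increasingQ (T := T) (base := base) P
      generalize (P.nfData.2.map Proc.q).sum = p at *
      -- The restrictions of `P` come first. If some of them remain, then `Q` is still intact below
      -- its own restrictions; otherwise the sequential processes of `P` are bare, and the removal
      -- continues in `Q`.
      rcases le_total j X.length with hjX | hjX
      · rw [Nat.sub_eq_zero_of_le hjX, List.drop_zero, resListQ_append, ← add_resListQ,
          ← renQ_resListQ, Proc.resListQ_nfData]
        have e : (fun i => i + X.length) = (fun i => i + (X.drop j).length) ∘ (fun i => i + j) := by
          funext i; simp only [Function.comp, List.length_drop]; omega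
        rw [e, ← renQ_renQ, ← resListQ_add]
        exact add_mem (hP j hjX) (renQ_mem_increasingQ ⟨Q, rfl, h.2⟩ _)
      · obtain ⟨i, rfl⟩ := Nat.exists_eq_add_of_le hjX
        have hi : i ≤ Q.nfData.1.length := by omega
        rw [List.drop_eq_nil_of_le hjX, List.nil_append, Nat.add_sub_cancel_left]
        have hQ := hQ i hi
        generalize Q.nfData.1 = Y at *
        have hY : Y.length = i + (Y.drop i).length := by rw [List.length_drop]; omega
        have e : (fun l => l + Y.length) = (fun l => l + (Y.drop i).length) ∘ (fun l => l + i) := by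
          funext l; simp only [Function.comp]; omega
        have e' : liftN Y.length (fun l => l + X.length) =
            liftN (Y.drop i).length (liftN i fun l => l + X.length) := by
          conv_lhs => rw [hY]
          rw [liftN, liftN, liftN, add_comm, Function.iterate_add_apply]
        rw [e, e', ← renQ_renQ, ← add_resListQ, ← renQ_resListQ]
        exact add_mem (renQ_mem_increasingQ hL _) (renQ_mem_increasingQ hQ _)
  | .sum M, _, j, _ => by
      simp only [Proc.nfData, List.drop_nil]
      exact ⟨.sum M.nf, by simp [resListQ], trivial⟩
  | .bang M, _, j, _ => by
      simp only [Proc.nfData, List.drop_nil]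
      exact ⟨.bang M.nf, by simp [resListQ], trivial⟩

/-- Terms without active restrictions. -/
def Proc.flat : Proc α → Bool
  | .nil => true
  | .res _ _ => false
  | .par P Q => P.flat && Q.flat
  | .sum _ => true
  | .bang _ => true

mutual
/-- Terms without nested restrictions, hereditarily below prefixes. -/
def Proc.shallow : Proc α → Bool
  | .nil => true
  | .res _ P => P.flat && Proc.shallow P
  | .par P Q => P.flat && Q.flat && Proc.shallow P && Proc.shallow Q
  | .sum M => Choice.shallow M
  | .bang M => Choice.shallow M
def Choice.shallow : Choice α → Bool
  | .pre _ P => Proc.shallow P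
  | .plus M N => Choice.shallow M && Choice.shallow N
end

theorem Proc.flat_rename : ∀ (P : Proc α) (f : ℕ → ℕ), (P.rename f).flat = P.flat
  | .nil, _ => rfl
  | .res _ _, _ => rfl
  | .par P Q, f => by simp only [Proc.rename, Proc.flat, P.flat_rename, Q.flat_rename]
  | .sum _, _ => rfl
  | .bang _, _ => rfl

mutual
theorem Proc.shallow_rename : ∀ (P : Proc α) (f : ℕ → ℕ), (P.rename f).shallow = P.shallow
  | .nil, _ => rfl
  | .res _ P, f => by simp only [Proc.rename, Proc.shallow, P.flat_rename, P.shallow_rename]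
  | .par P Q, f => by
      simp only [Proc.rename, Proc.shallow, P.flat_rename, P.shallow_rename, Q.flat_rename,
        Q.shallow_rename]
  | .sum M, f => Choice.shallow_rename M f
  | .bang M, f => Choice.shallow_rename M f
theorem Choice.shallow_rename : ∀ (M : Choice α) (f : ℕ → ℕ), (M.rename f).shallow = M.shallow
  | .pre π P, f => Proc.shallow_rename P (π.under f)
  | .plus M N, f => by
      simp only [Choice.rename, Choice.shallow, M.shallow_rename, N.shallow_rename]
end

theorem Subterm.shallow {Q P : Proc α} (h : Subterm Q P) : P.shallow → Q.shallow := by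
  induction h with
  | refl => exact id
  | res _ _ ih => intro h; simp only [Proc.shallow, Bool.and_eq_true] at h; exact ih h.2
  | left _ _ ih => intro h; simp only [Proc.shallow, Bool.and_eq_true] at h; exact ih h.1.2
  | right _ _ ih => intro h; simp only [Proc.shallow, Bool.and_eq_true] at h; exact ih h.2
  | bang _ ih => exact ih
  | plusLeft _ _ ih =>
      intro h; simp only [Proc.shallow, Choice.shallow, Bool.and_eq_true] at h; exact ih h.1
  | plusRight _ _ ih =>
      intro h; simp only [Proc.shallow, Choice.shallow, Bool.and_eq_true] at h; exact ih h.2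
  | pre _ _ ih => exact ih

theorem Hierarchy.Increasing.of_flat : ∀ {P : Proc α} (_ : P.flat) (l : Option T.Base),
    T.Increasing base l P
  | .nil, _, _ => trivial
  | .res _ _, h, _ => by cases h
  | .par P Q, h, l => by
      simp only [Proc.flat, Bool.and_eq_true] at h
      exact ⟨.of_flat h.1 l, .of_flat h.2 l⟩
  | .sum _, _, _ => trivial
  | .bang _, _, _ => trivial

theorem Hierarchy.Increasing.of_shallow {P : Proc α} (h : P.shallow) :
    T.Increasing base none P := by
  cases P with
  | res τ P =>
      simp only [Proc.shallow, Bool.and_eq_true] at h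
      exact ⟨nofun, .of_flat h.1 _⟩
  | par P Q =>
      simp only [Proc.shallow, Bool.and_eq_true] at h
      exact ⟨.of_flat h.1.1.1 _, .of_flat h.1.1.2 _⟩
  | _ => trivial

theorem Proc.IsSeq.flat {A : Proc α} (h : A.IsSeq) : A.flat := by
  cases A <;> trivial

theorem flat_parList : ∀ {L : List (Proc α)} (_ : ∀ A ∈ L, A.IsSeq), (parList L).flat
  | [], _ => rfl
  | [A], h => (h A (by simp)).flat
  | A :: B :: L, h => by
      have h₁ : A.flat := (h A (by simp)).flat
      have h₂ : (parList (B :: L)).flat := flat_parList fun C hC => h C (List.mem_cons_of_mem _ hC)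
      simp only [parList, Proc.flat, h₁, h₂, Bool.and_self]

theorem shallow_parList : ∀ {L : List (Proc α)} (_ : ∀ A ∈ L, A.IsSeq) (_ : ∀ A ∈ L, A.shallow),
    (parList L).shallow
  | [], _, _ => rfl
  | [A], _, h => h A (by simp)
  | A :: B :: L, h, h' => by
      have h₁ : A.flat := (h A (by simp)).flat
      have h₂ : (parList (B :: L)).flat := flat_parList fun C hC => h C (List.mem_cons_of_mem _ hC)
      have h₃ : (parList (B :: L)).shallow := shallow_parList
        (fun C hC => h C (List.mem_cons_of_mem _ hC)) fun C hC => h' C (List.mem_cons_of_mem _ hC)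
      simp only [parList, Proc.shallow, h₁, h₂, h₃, h' A (by simp), Bool.and_self]

theorem Subterm.of_resList {Q P : Proc α} : ∀ {X : List α} (_ : Subterm Q (resList X P)),
    (∃ j ≤ X.length, Q = resList (X.drop j) P) ∨ Subterm Q P
  | [], h => .inr h
  | τ :: X, h => by
      rw [resList] at h
      cases h with
      | refl => exact .inl ⟨0, by simp, rfl⟩
      | res _ h =>
          rcases h.of_resList with ⟨j, hj, rfl⟩ | h
          · exact .inl ⟨j + 1, by simpa using hj, rfl⟩
          · exact .inr h

/-- A subterm of a normal form either lacks some of the outer restrictions only, or lies in the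
parallel composition of the sequential processes, where restrictions are not nested. In the first
case the long prefix of restrictions is not itself increasing; scopes have to be narrowed again by
congruence. -/
theorem Hierarchy.Shaped.nf {P : Proc α} (h : T.Increasing base none P)
    (h' : ∀ A ∈ P.nfData.2, A.shallow) : T.Shaped base P.nf := by
  intro Q hQ
  rcases hQ.of_resList with ⟨j, hj, rfl⟩ | hQ
  · obtain ⟨R, hR, hinc⟩ := resListQ_drop_mem_increasingQ P h j hj
    refine .of_increasing hinc ?_
    rw [hR, Proc.q_resList, Proc.q_parList]
  · exact .of_increasing (.of_shallow (hQ.shallow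
      (shallow_parList (fun A hA => (P.isNFSeq_nfData A hA).isSeq) h'))) rfl

theorem shallow_nfData_par {P Q : Proc α} (hP : ∀ A ∈ P.nfData.2, A.shallow)
    (hQ : ∀ A ∈ Q.nfData.2, A.shallow) : ∀ A ∈ (Proc.par P Q).nfData.2, A.shallow := by
  intro A hA
  simp only [Proc.nfData, List.mem_append, List.mem_map] at hA
  rcases hA with ⟨B, hB, rfl⟩ | ⟨B, hB, rfl⟩
  · rw [Proc.shallow_rename]; exact hP B hB
  · rw [Proc.shallow_rename]; exact hQ B hB

theorem shallow_nfData_parList : ∀ {L : List (Proc α)}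
    (_ : ∀ P ∈ L, ∀ A ∈ P.nfData.2, A.shallow), ∀ A ∈ (parList L).nfData.2, A.shallow
  | [], _ => by simp [parList, Proc.nfData]
  | [A], h => h A (by simp)
  | A :: B :: L, h => shallow_nfData_par (h A (by simp))
      (shallow_nfData_parList fun C hC => h C (List.mem_cons_of_mem _ hC))

theorem shallow_nfData_outZA (x : α) (c : ℕ) :
    ∀ A ∈ (outZA x c .nil).nfData.2, A.shallow := by
  simp only [outZA, Proc.nfData, List.mem_singleton, forall_eq]
  rfl

theorem shaped_nf_encodeA {t x : α} (h : T.lt (base t) (base x)) {k n : ℕ} (M : Machine k n)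
    (c : Config k n) : T.Shaped base (encodeA t x M c).nf := by
  have htok : ∀ r, T.Increasing base (some (base t)) (tokensA x r) := increasing_tokensA (by simpa)
  refine .nf ⟨.parList fun A hA => ?_, .parList fun A hA => ?_, ⟨nofun, trivial⟩,
    .parList fun A hA => ?_⟩ (shallow_nfData_par (shallow_nfData_parList fun A hA => ?_)
    (shallow_nfData_par (shallow_nfData_parList fun A hA => ?_) (shallow_nfData_par
    (shallow_nfData_outZA x _) (shallow_nfData_parList fun A hA => ?_))))
  all_goals obtain ⟨i, rfl⟩ := List.mem_ofFn.1 hA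
  · exact ⟨nofun, trivial, htok _⟩
  · trivial
  · trivial
  · refine shallow_nfData_par (P := msgA _ _)
      (by simp only [msgA, Proc.nfData, List.mem_singleton, forall_eq]; rfl)
      (shallow_nfData_parList fun B hB => ?_)
    rw [List.eq_of_mem_replicate hB]
    exact shallow_nfData_outZA x 0
  · simp only [counterA, Proc.nfData, List.mem_singleton, forall_eq]
    rfl
  · simp only [instrA, Proc.nfData, List.mem_singleton, forall_eq]
    cases M i <;> rfl

end Shaped

end PiCalc

-- Typability of the encodings

namespace PiCalc

/-! ## Typing normal forms -/

section Typing
variable {T : Hierarchy}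

theorem Env.extend_add (X : List (Ty T.Base)) : ∀ (Γ : Env T.Base) (a : ℕ),
    Γ.extend X (a + X.length) = Γ a := by
  induction X with
  | nil => exact fun _ _ => rfl
  | cons τ X ih =>
      intro Γ a
      rw [Env.extend, List.length_cons, ← Nat.add_assoc, Nat.add_right_comm, ih]; rfl

theorem Env.extend_append (X Y : List (Ty T.Base)) : ∀ Γ : Env T.Base,
    Γ.extend (X ++ Y) = (Γ.extend X).extend Y := by
  induction X with
  | nil => exact fun _ => rfl
  | cons τ X ih => exact fun Γ => ih _

theorem Env.mem_of_extend {X : List (Ty T.Base)} : ∀ {Γ : Env T.Base} {a : ℕ} {σ : Ty T.Base},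
    a < X.length → Γ.extend X a = some σ → σ ∈ X := by
  induction X with
  | nil => exact fun h _ => absurd h (Nat.not_lt_zero _)
  | cons τ X ih =>
      intro Γ a σ h h'
      rcases Nat.lt_succ_iff_lt_or_eq.1 h with h | rfl
      · exact List.mem_cons_of_mem _ (ih h h')
      · have := Env.extend_add X (Γ.cons τ) 0
        rw [Nat.zero_add] at this
        rw [Env.extend, this] at h'
        exact Option.some.inj h' ▸ List.mem_cons_self

/-- The sequential processes of the normal form are typable below its restrictions, also after a
renaming. -/
def TyAtoms (T : Hierarchy) (Γ : Env T.Base) (P : Proc (Ty T.Base)) : Prop :=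
  ∀ A ∈ P.nfData.2, ∀ (f : ℕ → ℕ) (Δ : Env T.Base),
    Δ ∘ f = Γ.extend P.nfData.1 → TySeq T Δ (A.rename f)

variable {Γ : Env T.Base}

theorem TyAtoms.nil : TyAtoms T Γ .nil := nofun

theorem TyAtoms.res {τ : Ty T.Base} {P : Proc (Ty T.Base)} (h : TyAtoms T (Γ.cons τ) P) :
    TyAtoms T Γ (.res τ P) := h

/-- The quantification over renamings in `TyAtoms` absorbs the shifts by which `nfData` merges two
lists of restrictions, so no separate weakening lemma for typing is needed. -/
theorem TyAtoms.par {P Q : Proc (Ty T.Base)} (hP : TyAtoms T Γ P) (hQ : TyAtoms T Γ Q) :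
    TyAtoms T Γ (.par P Q) := by
  intro A hA f Δ hΔ
  simp only [Proc.nfData, List.mem_append, List.mem_map] at hA
  rw [Proc.nfData, Env.extend_append] at hΔ
  rcases hA with ⟨B, hB, rfl⟩ | ⟨B, hB, rfl⟩
  · rw [Proc.rename_rename]
    refine hP B hB _ _ ?_
    rw [← Function.comp_assoc, hΔ]
    funext a
    exact Env.extend_add _ _ _
  · rw [Proc.rename_rename]
    refine hQ B hB _ _ ?_
    rw [← Function.comp_assoc, hΔ]
    have : ∀ (Y : List (Ty T.Base)) (Γ Γ' : Env T.Base) (g : ℕ → ℕ), Γ' ∘ g = Γ →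
        Γ'.extend Y ∘ liftN Y.length g = Γ.extend Y := by
      intro Y
      induction Y with
      | nil => exact fun _ _ _ h => h
      | cons τ Y ih =>
          intro Γ Γ' g h
          refine ih (Γ.cons τ) (Γ'.cons τ) (lift g) ?_
          funext a
          cases a with
          | zero => rfl
          | succ a => exact congrFun h a
    exact this _ _ _ _ (funext fun a => Env.extend_add _ _ _)

theorem TyAtoms.list : ∀ {L : List (Proc (Ty T.Base))}, (∀ P ∈ L, TyAtoms T Γ P) →
    TyAtoms T Γ (parList L)
  | [], _ => .nil
  | [A], h => h A (by simp)
  | A :: B :: L, h => .par (h A (by simp))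
      (TyAtoms.list fun C hC => h C (List.mem_cons_of_mem _ hC))

theorem TyAtoms.sum {M : Choice (Ty T.Base)}
    (h : ∀ (f : ℕ → ℕ) (Δ : Env T.Base), (∀ a, Δ (f a) = Γ a) → TyChoice T Δ (M.nf.rename f)) :
    TyAtoms T Γ (.sum M) := by
  intro A hA f Δ hΔ
  simp only [Proc.nfData, List.mem_singleton] at hA
  subst hA
  exact .sum _ _ (h f Δ fun a => congrFun hΔ a)

theorem TyAtoms.bang {M : Choice (Ty T.Base)}
    (h : ∀ (f : ℕ → ℕ) (Δ : Env T.Base), (∀ a, Δ (f a) = Γ a) → TyChoice T Δ (M.nf.rename f)) :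
    TyAtoms T Γ (.bang M) := by
  intro A hA f Δ hΔ
  simp only [Proc.nfData, List.mem_singleton] at hA
  subst hA
  exact .bang _ _ (h f Δ fun a => congrFun hΔ a)

/-- If all names of the environment lie below all restrictions, the side condition holds regardless
of which names are tied to which processes. -/
theorem TyProc.nf {P : Proc (Ty T.Base)} (h : TyAtoms T Γ P)
    (h' : ∀ σ ∈ P.nfData.1, ∀ (y : ℕ) (ρ : Ty T.Base), Γ y = some ρ → T.lt ρ.base σ.base) :
    TyProc T Γ P.nf := by
  refine .par _ _ _ (fun A hA => ?_) fun _ x σ hx hσ _ y ρ _ hρ =>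
    h' σ (Env.mem_of_extend hx hσ) y ρ hρ
  have := h A hA id _ rfl
  rwa [Proc.rename_id] at this

theorem TyProc.noRes {L : List (Proc (Ty T.Base))} (h : ∀ A ∈ L, TySeq T Γ A) :
    TyProc T Γ (parList L) :=
  .par Γ [] L h fun _ _ _ h => absurd h (Nat.not_lt_zero _)

theorem TyProc.oneRes {L : List (Proc (Ty T.Base))} {τ : Ty T.Base}
    (h : ∀ A ∈ L, TySeq T (Γ.cons τ) A)
    (h' : ∀ A ∈ L, ∀ (y : ℕ) (ρ : Ty T.Base), y + 1 ∈ A.fn → Γ y = some ρ → T.lt ρ.base τ.base) :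
    TyProc T Γ (.res τ (parList L)) := by
  refine .par Γ [τ] L h fun i x σ hx hσ _ y ρ hy hρ => ?_
  obtain rfl : x = 0 := Nat.lt_one_iff.1 hx
  obtain rfl : τ = σ := Option.some.inj hσ
  exact h' _ (L.get_mem i) y ρ hy hρ

theorem TyProc.nil : TyProc T Γ .nil := .noRes (L := []) nofun

/-- A nullary output with a continuation in which only names of smaller base type are free. -/
theorem TyProc.outZ {s : T.Base} {τ : Ty T.Base} {c : ℕ} {P : Proc (Ty T.Base)}
    (hc : Γ c = some (.chan s τ)) (hP : TyProc T (Γ.cons τ) P)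
    (h : ∀ (y : ℕ) (ρ : Ty T.Base), y = c ∨ y + 1 ∈ P.fn → Γ y = some ρ → T.lt ρ.base τ.base) :
    TyProc T Γ (.res τ (.sum (.pre (.out (c + 1) 0) P))) := by
  refine .oneRes (L := [.sum (.pre (.out (c + 1) 0) P)]) ?_ ?_
  · simp only [List.mem_singleton, forall_eq]
    exact .sum _ _ (.out _ _ _ s τ _ hc rfl hP)
  · simp only [List.mem_singleton, forall_eq, Proc.fn, Choice.fn]
    refine fun y ρ hy => h y ρ ?_
    simpa using hy

end Typing

/-! ## The encoding is typably hierarchical -/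

section Encoding

/-- The types of nullary messages, cell parameters, requests and instructions, and counters. -/
def tyX : Ty chainHierarchy.Base := .atom (3 : Fin 4)
def tyT : Ty chainHierarchy.Base := .chan (2 : Fin 4) tyX
def tyC : Ty chainHierarchy.Base := .chan (0 : Fin 4) tyX
def tyP : Ty chainHierarchy.Base := .chan (1 : Fin 4) tyT

/-- The types of the free names of encodings. -/
def encEnv : Env chainHierarchy.Base := fun a => some (if isP a then tyP else tyC)

@[simp] theorem encEnv_nP (i : ℕ) : encEnv (nP i) = some tyP := by simp [encEnv]
@[simp] theorem encEnv_nInc (i : ℕ) : encEnv (nInc i) = some tyC := by simp [encEnv]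
@[simp] theorem encEnv_nDec (i : ℕ) : encEnv (nDec i) = some tyC := by simp [encEnv]
@[simp] theorem encEnv_nRst (i : ℕ) : encEnv (nRst i) = some tyC := by simp [encEnv]
@[simp] theorem encEnv_nLoc (i : ℕ) : encEnv (nLoc i) = some tyC := by simp [encEnv]

theorem tyC_lt_tyX : chainHierarchy.lt tyC.base tyX.base :=
  chainHierarchy_lt (show (0 : Fin 4) < 3 by decide)
theorem tyP_lt_tyX : chainHierarchy.lt tyP.base tyX.base :=
  chainHierarchy_lt (show (1 : Fin 4) < 3 by decide)
theorem tyT_lt_tyX : chainHierarchy.lt tyT.base tyX.base :=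
  chainHierarchy_lt (show (2 : Fin 4) < 3 by decide)
theorem tyC_lt_tyP : chainHierarchy.lt tyC.base tyP.base :=
  chainHierarchy_lt (show (0 : Fin 4) < 1 by decide)
theorem tyC_lt_tyT : chainHierarchy.lt tyC.base tyT.base :=
  chainHierarchy_lt (show (0 : Fin 4) < 2 by decide)
theorem tyP_lt_tyT : chainHierarchy.lt tyP.base tyT.base :=
  chainHierarchy_lt (show (1 : Fin 4) < 2 by decide)

variable {Γ : Env chainHierarchy.Base}

theorem TySeq.msg {a b : ℕ} {s : chainHierarchy.Base} {σ : Ty chainHierarchy.Base}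
    (ha : Γ a = some (.chan s σ)) (hb : Γ b = some σ) : TySeq chainHierarchy Γ (msgA a b) :=
  .sum _ _ (.out _ _ _ s σ _ ha hb .nil)

theorem TyAtoms.msg {a b : ℕ} {s : chainHierarchy.Base} {σ : Ty chainHierarchy.Base}
    (ha : Γ a = some (.chan s σ)) (hb : Γ b = some σ) : TyAtoms chainHierarchy Γ (msgA a b) :=
  .sum fun _ _ hΔ => .out _ _ _ s σ _ ((hΔ a).trans ha) ((hΔ b).trans hb) .nil

theorem TyAtoms.outZ {c : ℕ} {s : chainHierarchy.Base} (hc : Γ c = some (.chan s tyX)) :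
    TyAtoms chainHierarchy Γ (outZA tyX c .nil) :=
  .res (.msg hc rfl)

theorem TyAtoms.cell (i r : ℕ) : TyAtoms chainHierarchy encEnv (cellA tyT tyX i r) := by
  refine .res (.par (.msg (encEnv_nP i) rfl) (.list fun A hA => ?_))
  rw [List.eq_of_mem_replicate hA]
  exact .outZ rfl

/-- An input whose parameter is not used. -/
theorem TyChoice.inpUnused {T : Hierarchy} {Γ : Env T.Base} {a : ℕ} {s : T.Base} {σ : Ty T.Base}
    {X : List (Ty T.Base)} {L : List (Proc (Ty T.Base))}
    (ha : Γ a = some (.chan s σ)) (hL : ∀ A ∈ L, A.IsSeq) (h : ∀ A ∈ L, X.length ∉ A.fn)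
    (hP : TyProc T (Γ.cons σ) (resList X (parList L))) :
    TyChoice T Γ (.pre (.inp a) (resList X (parList L))) :=
  .inp Γ a s σ X L ha hL hP (.inr fun _ ⟨j, hj, _⟩ => absurd hj (h _ (L.get_mem j)))

/-- The parameter of the counter has a larger base type than its channel, so the first alternative
of the input rule fails. The second one holds: besides the channel itself, the free names of the
body are requests, whose base type is below that of the channel. The inner inputs do not use their
parameters, hence nothing is migratable there. -/
theorem TyAtoms.counter (i : ℕ) : TyAtoms chainHierarchy encEnv (counterA tyT tyX i) := by
  refine .bang fun f Δ hΔ => ?_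
  have hp := (hΔ (nP i)).trans (encEnv_nP i)
  have hi := (hΔ (nInc i)).trans (encEnv_nInc i)
  have hd := (hΔ (nDec i)).trans (encEnv_nDec i)
  have hr := (hΔ (nRst i)).trans (encEnv_nRst i)
  -- The computed normal form: in the first branch the restriction of the new token is pulled out
  -- over the message. The cell name then has index `2`, and free names are shifted by three.
  change TyChoice _ _ (.pre (.inp (f (nP i))) (resList [] (parList [.sum
    (.plus (.pre (.inp (f (nInc i) + 1)) (resList [tyX] (parList
        [msgA 2 0, msgA (f (nP i) + 3) 2])))
      (.plus (.pre (.inp (f (nDec i) + 1)) (resList [] (parList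
          [.sum (.pre (.inp 1) (resList [] (parList [msgA (f (nP i) + 3) 2])))])))
        (.pre (.inp (f (nRst i) + 1)) (resList [tyT] (parList [msgA (f (nP i) + 3) 0])))))])))
  generalize f (nP i) = p at *
  generalize f (nInc i) = a at *
  generalize f (nDec i) = d at *
  generalize f (nRst i) = e at *
  refine .inp _ _ _ tyT _ _ hp (by simp [Proc.IsSeq]) (.noRes ?_) (.inr ?_)
  · simp only [List.mem_singleton, forall_eq]
    refine .sum _ _ (.plus _ _ _ ?_ (.plus _ _ _ ?_ ?_))
    · refine .inpUnused hi (by simp [Proc.IsSeq, msgA]) (by simp [Proc.fn, Choice.fn, msgA])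
        (.oneRes ?_ ?_)
      · simp only [List.mem_cons, List.not_mem_nil, or_false, forall_eq_or_imp, forall_eq]
        exact ⟨.msg rfl rfl, .msg hp rfl⟩
      · simp only [List.mem_cons, List.not_mem_nil, or_false, forall_eq_or_imp, forall_eq, msgA,
          Proc.fn, Choice.fn]
        constructor
        · intro y ρ hy hρ
          obtain rfl : y = 1 := by simpa using hy
          cases hρ
          exact tyT_lt_tyX
        · intro y ρ hy hρ
          obtain rfl | rfl : y = p + 2 ∨ y = 1 := by simpa using hy
          · cases hp.symm.trans hρ
            exact tyP_lt_tyX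
          · cases hρ
            exact tyT_lt_tyX
    · refine .inpUnused hd (by simp [Proc.IsSeq]) (by simp [Proc.fn, Choice.fn, msgA, resList, parList])
        (.noRes ?_)
      simp only [List.mem_singleton, forall_eq]
      refine .sum _ _ (.inpUnused rfl (by simp [Proc.IsSeq, msgA])
        (by simp [Proc.fn, Choice.fn, msgA]) (.noRes ?_))
      simp only [List.mem_singleton, forall_eq]
      exact .msg hp rfl
    · refine .inpUnused hr (by simp [Proc.IsSeq, msgA]) (by simp [Proc.fn, Choice.fn, msgA])
        (.oneRes ?_ ?_)
      · simp only [List.mem_singleton, forall_eq]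
        exact .msg hp rfl
      · simp only [List.mem_singleton, forall_eq, msgA, Proc.fn, Choice.fn]
        intro y ρ hy hρ
        obtain rfl : y = p + 2 := by simpa using hy
        cases hp.symm.trans hρ
        exact tyP_lt_tyT
  · intro j _ y ρ hy hy' hρ
    have hj := List.get_mem _ j
    rw [List.mem_singleton] at hj
    rw [hj] at hy'
    have : y = a ∨ y = d ∨ y = e := by
      simp [Proc.fn, Choice.fn, msgA, resList, parList] at hy'
      tauto
    have hC : Δ y = some tyC := by rcases this with rfl | rfl | rfl <;> assumption
    cases hC.symm.trans hρ
    exact tyC_lt_tyP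

theorem TyAtoms.instr {k n : ℕ} (m : Fin n) (I : Instr k n) :
    TyAtoms chainHierarchy encEnv (instrA tyX m I) := by
  refine .bang fun f Δ hΔ => ?_
  have hm := (hΔ (nLoc m)).trans (encEnv_nLoc m)
  cases I with
  | inc i j =>
      have hi := (hΔ (nInc i)).trans (encEnv_nInc i)
      have hj := (hΔ (nLoc j)).trans (encEnv_nLoc j)
      change TyChoice _ _ (.pre (.inp (f (nLoc m))) (resList [tyX] (parList
        [.sum (.pre (.out (f (nInc i) + 2) 0)
          (.res tyX (.sum (.pre (.out (f (nLoc j) + 2 + 1) 0) .nil))))])))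
      generalize f (nInc i) = a at *
      generalize f (nLoc j) = l at *
      refine .inpUnused hm (by simp [Proc.IsSeq]) (by simp [Proc.fn, Choice.fn])
        (.outZ hi (.outZ hj .nil ?_) ?_)
      · intro y ρ hy hρ
        obtain rfl : y = l + 2 := by simpa [Proc.fn] using hy
        cases hj.symm.trans hρ
        exact tyC_lt_tyX
      · intro y ρ hy hρ
        have : y = a + 1 ∨ y = l + 1 := by simpa [Proc.fn, Choice.fn] using hy
        have hC : Env.cons Δ tyX y = some tyC := by rcases this with rfl | rfl <;> assumption
        cases hC.symm.trans hρ
        exact tyC_lt_tyX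
  | dec i j₁ j₂ =>
      have hd := (hΔ (nDec i)).trans (encEnv_nDec i)
      have hr := (hΔ (nRst i)).trans (encEnv_nRst i)
      have h₁ := (hΔ (nLoc j₁)).trans (encEnv_nLoc j₁)
      have h₂ := (hΔ (nLoc j₂)).trans (encEnv_nLoc j₂)
      change TyChoice _ _ (.pre (.inp (f (nLoc m))) (resList [tyX] (parList
        [.sum (.plus (.pre (.out (f (nDec i) + 2) 0)
            (.res tyX (.sum (.pre (.out (f (nLoc j₁) + 2 + 1) 0) .nil))))
          (.pre (.out (f (nRst i) + 2) 0)
            (.res tyX (.sum (.pre (.out (f (nLoc j₂) + 2 + 1) 0) .nil)))))])))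
      generalize f (nDec i) = a at *
      generalize f (nRst i) = b at *
      generalize f (nLoc j₁) = l₁ at *
      generalize f (nLoc j₂) = l₂ at *
      have hout : ∀ l, Δ l = some tyC → TyProc chainHierarchy (((Δ.cons tyX).cons tyX))
          (.res tyX (.sum (.pre (.out (l + 2 + 1) 0) .nil))) := by
        refine fun l hl => .outZ hl .nil fun y ρ hy hρ => ?_
        obtain rfl : y = l + 2 := by simpa [Proc.fn] using hy
        cases hl.symm.trans hρ
        exact tyC_lt_tyX
      refine .inpUnused hm (by simp [Proc.IsSeq]) (by simp [Proc.fn, Choice.fn]) (.oneRes ?_ ?_)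
      · simp only [List.mem_singleton, forall_eq]
        exact .sum _ _ (.plus _ _ _ (.out _ _ _ _ _ _ hd rfl (hout _ h₁))
          (.out _ _ _ _ _ _ hr rfl (hout _ h₂)))
      · simp only [List.mem_singleton, forall_eq]
        intro y ρ hy hρ
        have : y = a + 1 ∨ y = b + 1 ∨ y = l₁ + 1 ∨ y = l₂ + 1 := by
          simp [Proc.fn, Choice.fn] at hy
          tauto
        have hC : Env.cons Δ tyX y = some tyC := by
          rcases this with rfl | rfl | rfl | rfl <;> assumption
        cases hC.symm.trans hρ
        exact tyC_lt_tyX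

theorem TyAtoms.encode {k n : ℕ} (M : Machine k n) (c : Config k n) :
    TyAtoms chainHierarchy encEnv (encodeA tyT tyX M c) := by
  refine .par (.list fun A hA => ?_) (.par (.list fun A hA => ?_)
    (.par (.outZ (encEnv_nLoc _)) (.list fun A hA => ?_)))
  all_goals obtain ⟨i, rfl⟩ := List.mem_ofFn.1 hA
  · exact .cell _ _
  · exact .counter _
  · exact .instr _ _

theorem subset_anns_resList {α : Type} (P : Proc α) : ∀ X : List α,
    ∀ τ ∈ X, τ ∈ (resList X P).anns
  | [], _, h => by simp at h
  | σ :: X, τ, h => by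
      rcases List.mem_cons.1 h with rfl | h
      · exact .inl rfl
      · exact .inr (subset_anns_resList P X τ h)

theorem anns_nf_encodeA {k n : ℕ} (M : Machine k n) (c : Config k n)
    {τ : Ty chainHierarchy.Base} (h : τ ∈ (encodeA tyT tyX M c).nf.anns) : τ = tyT ∨ τ = tyX := by
  -- Annotating by Booleans first and mapping them to types shows that only two types can occur,
  -- without a traversal of the normal form.
  have e := mapAnn_encodeA (fun b : Bool => if b then tyT else tyX) true false M c
  simp only [if_true, Bool.false_eq_true, if_false] at e
  rw [← e, Proc.nf_mapAnn] at h
  obtain ⟨b, rfl⟩ := Proc.anns_mapAnn_subset _ _ h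
  cases b
  · exact .inr rfl
  · exact .inl rfl

theorem encEnv_lt {k n : ℕ} (M : Machine k n) (c : Config k n) {y : ℕ}
    {ρ τ : Ty chainHierarchy.Base} (hρ : encEnv y = some ρ)
    (hτ : τ ∈ (encodeA tyT tyX M c).nf.anns) : chainHierarchy.lt ρ.base τ.base := by
  have h : ρ = tyP ∨ ρ = tyC := by
    cases h : isP y <;> simp [encEnv, h] at hρ <;> simp [hρ]
  rcases h with rfl | rfl <;> rcases anns_nf_encodeA M c hτ with rfl | rfl
  exacts [tyP_lt_tyT, tyP_lt_tyX, tyC_lt_tyT, tyC_lt_tyX]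

theorem typablyHierarchical_encode {k n : ℕ} (M : Machine k n) (c : Config k n) :
    TypablyHierarchical (encode M c) := by
  refine ⟨chainHierarchy, (encodeA tyT tyX M c).nf, encEnv, ?_, fun _ _ _ hσ _ hτ =>
    encEnv_lt M c hσ hτ, shaped_nf_encodeA tyT_lt_tyX M c, .nf (.encode M c) fun σ hσ y ρ hρ =>
    encEnv_lt M c hρ (subset_anns_resList _ _ σ hσ)⟩
  rw [Proc.erase, ← Proc.nf_mapAnn, mapAnn_encodeA, encode_eq]

end Encoding

end PiCalc

-- Structured counter programs and primitive recursive functions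

namespace PiCalc

/-! ## Counter programs -/

open Function

/-- Structured programs over counters: stop; increment a counter; repeat a program as long as a
counter can be decremented. -/
inductive Prog : Type
  | done : Prog
  | inc (i : ℕ) (q : Prog) : Prog
  | loop (i : ℕ) (b q : Prog) : Prog

/-- Sequential composition. -/
def Prog.append : Prog → Prog → Prog
  | .done, r => r
  | .inc i q, r => .inc i (q.append r)
  | .loop i b q, r => .loop i b (q.append r)

theorem Prog.append_assoc : ∀ p q r : Prog, (p.append q).append r = p.append (q.append r)
  | .done, _, _ => rfl
  | .inc i p, q, r => congrArg (Prog.inc i) (p.append_assoc q r)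
  | .loop i b p, q, r => congrArg (Prog.loop i b) (p.append_assoc q r)

/-- `Ev p s s'`: from the counter values `s`, the program `p` stops with the values `s'`. -/
inductive Ev : Prog → (ℕ → ℕ) → (ℕ → ℕ) → Prop
  | done (s : ℕ → ℕ) : Ev .done s s
  | inc {i : ℕ} {q : Prog} {s s' : ℕ → ℕ} : Ev q (update s i (s i + 1)) s' → Ev (.inc i q) s s'
  | zero {i : ℕ} {b q : Prog} {s s' : ℕ → ℕ} : s i = 0 → Ev q s s' → Ev (.loop i b q) s s'
  | pos {i : ℕ} {b q : Prog} {s s' : ℕ → ℕ} : s i ≠ 0 →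
      Ev (b.append (.loop i b q)) (update s i (s i - 1)) s' → Ev (.loop i b q) s s'

theorem Ev.append {p q : Prog} {s m s' : ℕ → ℕ} (h : Ev p s m) (h' : Ev q m s') :
    Ev (p.append q) s s' := by
  induction h with
  | done => exact h'
  | inc _ ih => exact .inc (ih h')
  | zero h _ ih => exact .zero h (ih h')
  | pos h _ ih => exact .pos h (by rw [← Prog.append, ← Prog.append_assoc]; exact ih h')

/-- A loop whose counter is positive whenever it is tested does not stop. -/
theorem Ev.not_of_invariant {i : ℕ} {b q : Prog} {I : (ℕ → ℕ) → Prop}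
    (hI : ∀ m, I m → m i ≠ 0 ∧ ∃ m', Ev b (update m i (m i - 1)) m' ∧ I m') {p : Prog}
    {s s' : ℕ → ℕ} (h : Ev p s s') : ∀ (c : Prog) (m : ℕ → ℕ), p = c.append (.loop i b q) →
      Ev c s m → ¬ I m := by
  -- The induction follows the whole run. The program `c` is what remains of the current iteration
  -- and leads to a state in the invariant; as programs are deterministic, the run has to follow it
  -- and arrives at the next test.
  induction h with
  | done s => intro c m e; cases c <;> cases e
  | inc _ ih =>
      intro c m e hc
      cases c <;> cases e
      cases hc with
      | inc hc => exact ih _ m rfl hc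
  | zero h _ ih =>
      intro c m e hc hm
      cases c with
      | done =>
          cases e
          cases hc
          exact (hI _ hm).1 h
      | inc => cases e
      | loop =>
          cases e
          cases hc with
          | zero _ hc => exact ih _ m rfl hc hm
          | pos h' _ => exact h' h
  | pos h _ ih =>
      intro c m e hc hm
      cases c with
      | done =>
          cases e
          cases hc
          obtain ⟨m', hm', hI'⟩ := (hI _ hm).2
          exact ih b m' rfl hm' hI'
      | inc => cases e
      | loop =>
          cases e
          cases hc with
          | zero h' _ => exact h h'
          | pos _ hc => exact ih _ m (by rw [Prog.append_assoc, Prog.append]) hc hm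

theorem Ev.of_eq {p : Prog} {s m s' : ℕ → ℕ} (h : Ev p s m) (e : m = s') : Ev p s s' := e ▸ h

/-- A loop that runs through the states `S 0, …, S N`. -/
theorem Ev.loop {i N : ℕ} {b : Prog} (S : ℕ → ℕ → ℕ) (hi : ∀ l ≤ N, S l i = N - l)
    (hb : ∀ l < N, Ev b (update (S l) i (N - (l + 1))) (S (l + 1))) :
    Ev (.loop i b .done) (S 0) (S N) := by
  have h : ∀ d l, l + d = N → Ev (.loop i b .done) (S l) (S N) := by
    intro d
    induction d with
    | zero => rintro l rfl; exact .zero ((hi _ le_rfl).trans (Nat.sub_self _)) (.done _)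
    | succ d ih =>
        intro l hl
        refine .pos (by rw [hi l (by omega)]; omega) (.append ?_ (ih (l + 1) (by omega)))
        rw [hi l (by omega), Nat.sub_sub]
        exact hb l (by omega)
  exact h N 0 (Nat.zero_add N)

/-! ### Basic programs -/

def Prog.clear (i : ℕ) : Prog := .loop i .done .done

def Prog.move (i j : ℕ) : Prog := .loop i (.inc j .done) .done

/-- Adds the counter `i` to the counter `j`, with the help of `t`. -/
def Prog.copy (i j t : ℕ) : Prog := (Prog.loop i (.inc j (.inc t .done)) .done).append (.move t i)

theorem Ev.clear (i : ℕ) (s : ℕ → ℕ) : Ev (.clear i) s (update s i 0) := by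
  have := Ev.loop (i := i) (N := s i) (b := .done) (fun l => update s i (s i - l)) (by simp)
    fun l _ => (Ev.done _).of_eq (by simp)
  simpa [Prog.clear] using this

theorem Ev.move {i j : ℕ} (h : i ≠ j) (s : ℕ → ℕ) :
    Ev (.move i j) s (update (update s j (s j + s i)) i 0) := by
  have := Ev.loop (i := i) (N := s i) (b := .inc j .done)
    (fun l => update (update s j (s j + l)) i (s i - l)) (by simp) fun l _ => .inc ((Ev.done _).of_eq ?_)
  · simpa [Prog.move] using this
  · funext r
    grind [update_apply]

/-- The loop destroys the source, so a second copy is kept in `t` and moved back. -/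
theorem Ev.copy {i j t : ℕ} (hij : i ≠ j) (hit : i ≠ t) (hjt : j ≠ t) {s : ℕ → ℕ} (ht : s t = 0) :
    Ev (.copy i j t) s (update s j (s j + s i)) := by
  let S (l : ℕ) : ℕ → ℕ := update (update (update s j (s j + l)) t l) i (s i - l)
  have h₀ : S 0 = s := by funext r; grind [update_apply]
  have := Ev.loop (i := i) (N := s i) (b := .inc j (.inc t .done)) S (by simp [S])
    fun l _ => .inc (.inc ((Ev.done _).of_eq (by funext r; grind [update_apply])))
  rw [h₀] at this
  exact this.append ((Ev.move hit.symm _).of_eq (by funext r; grind [update_apply]))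

/-- A program that clears the counters `b, …, b + j - 1`. -/
theorem exists_clear (b j : ℕ) : ∃ p, ∀ s : ℕ → ℕ,
    Ev p s fun r => if b ≤ r ∧ r < b + j then 0 else s r := by
  induction j with
  | zero => exact ⟨.done, fun s => (Ev.done s).of_eq (by funext r; rw [if_neg (by omega)])⟩
  | succ j ih =>
      obtain ⟨p, hp⟩ := ih
      refine ⟨p.append (.clear (b + j)), fun s => (hp s).append ((Ev.clear _ _).of_eq ?_)⟩
      funext r
      simp only [update_apply]
      split_ifs <;> first | rfl | omega

/-! ### Primitive recursive functions -/

/-- Programs compute `f`: the arguments are in the counters `ins i`, the result is stored in the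
counter `out`, the counters from `b` on are free. -/
def Compiles {n : ℕ} (f : List.Vector ℕ n → ℕ) : Prop :=
  ∀ (ins : Fin n → ℕ) (out b : ℕ), (∀ i, ins i < b) → out < b → (∀ i, ins i ≠ out) →
    ∃ p, ∀ s : ℕ → ℕ, s out = 0 → (∀ r, b ≤ r → s r = 0) →
      Ev p s (update s out (f (List.Vector.ofFn fun i => s (ins i))))

theorem Compiles.get {n : ℕ} (i : Fin n) : Compiles fun v => v.get i := by
  intro ins out b hins hout hne
  refine ⟨.copy (ins i) out b, fun s h₀ hb => (Ev.copy (hne i) (hins i).ne hout.ne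
    (hb b le_rfl)).of_eq ?_⟩
  simp only [h₀, List.Vector.get_ofFn, Nat.zero_add]

theorem Compiles.succ : Compiles (n := 1) fun v => v.head + 1 := by
  intro ins out b hins hout hne
  refine ⟨(Prog.copy (ins 0) out b).append (.inc out .done), fun s h₀ hb => (Ev.copy (hne 0)
    (hins 0).ne hout.ne (hb b le_rfl)).append (.inc ((Ev.done _).of_eq ?_))⟩
  simp [h₀, List.Vector.ofFn]

/-- The values of the inner functions are stored in the counters `b, …, b + n - 1`, the outer
program reads them there, and they are cleared at the end, since free counters must be zero again
when the program stops. -/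
theorem Compiles.comp {m n : ℕ} {f : List.Vector ℕ n → ℕ} {g : Fin n → List.Vector ℕ m → ℕ}
    (hf : Compiles f) (hg : ∀ i, Compiles (g i)) :
    Compiles fun v => f (List.Vector.ofFn fun i => g i v) := by
  intro ins out b hins hout hne
  -- A total version of `g` on natural numbers, so that the contents of the counters can be
  -- described by one formula; the value `0` is never used.
  let G (i : ℕ) (v : List.Vector ℕ m) : ℕ := if h : i < n then g ⟨i, h⟩ v else 0
  have hG : ∀ j ≤ n, ∃ p, ∀ s : ℕ → ℕ, (∀ r, b ≤ r → s r = 0) → Ev p s fun r =>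
      if b ≤ r ∧ r < b + j then G (r - b) (List.Vector.ofFn fun i => s (ins i)) else s r := by
    intro j
    induction j with
    | zero =>
        exact fun _ => ⟨.done, fun s _ => (Ev.done s).of_eq (by funext r; rw [if_neg (by omega)])⟩
    | succ j ih =>
        intro hj
        obtain ⟨p, hp⟩ := ih (by omega)
        obtain ⟨q, hq⟩ := hg ⟨j, hj⟩ ins (b + j) (b + n) (fun i => by have := hins i; omega)
          (by omega) fun i => by have := hins i; omega
        refine ⟨p.append q, fun s hs => (hp s hs).append ((hq _ ?_ ?_).of_eq ?_)⟩
        · rw [if_neg (by omega), hs _ (by omega)]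
        · intro r hr; rw [if_neg (by omega), hs _ (by omega)]
        · funext r
          have e : ∀ i, (if b ≤ ins i ∧ ins i < b + j then
              G (ins i - b) (List.Vector.ofFn fun i => s (ins i)) else s (ins i)) = s (ins i) :=
            fun i => if_neg (by have := hins i; omega)
          simp only [update_apply, e]
          by_cases hr : r = b + j
          · subst hr
            simp [G, show j < n from hj]
          · rw [if_neg hr]
            by_cases hr' : b ≤ r ∧ r < b + j
            · rw [if_pos hr', if_pos (by omega)]
            · rw [if_neg hr', if_neg (by omega)]
  obtain ⟨p, hp⟩ := hG n le_rfl
  obtain ⟨q, hq⟩ := hf (fun i => b + i) out (b + n) (fun i => by simp) (by omega)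
    fun i => by omega
  obtain ⟨c, hc⟩ := exists_clear b n
  refine ⟨p.append (q.append c), fun s h₀ hs => (hp s hs).append ((hq _ ?_ ?_).append
    ((hc _).of_eq ?_))⟩
  · rw [if_neg (by omega), h₀]
  · intro r hr; rw [if_neg (by omega), hs _ (by omega)]
  · funext r
    by_cases hr : b ≤ r ∧ r < b + n
    · rw [if_pos hr, update_of_ne (by omega), hs r hr.1]
    · rw [if_neg hr]
      simp only [update_apply, if_neg hr]
      simp [G]

/-- Counter `b` holds the number of remaining iterations, `b + 1` the recursion variable, `b + 2`
the current value and `b + 3` the next value while it is being computed; the counters from `b + 4`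
on are free for subprograms. -/
theorem Compiles.prec {n : ℕ} {f : List.Vector ℕ n → ℕ} {g : List.Vector ℕ (n + 2) → ℕ}
    (hf : Compiles f) (hg : Compiles g) : Compiles fun v : List.Vector ℕ (n + 1) =>
      v.head.rec (f v.tail) fun y IH => g (y ::ᵥ IH ::ᵥ v.tail) := by
  intro ins out b hins hout hne
  obtain ⟨p, hp⟩ := hf (fun i => ins i.succ) (b + 2) (b + 4)
    (fun i => by have := hins i.succ; omega) (by omega) fun i => by have := hins i.succ; omega
  obtain ⟨q, hq⟩ := hg (Fin.cons (b + 1) (Fin.cons (b + 2) fun i => ins i.succ)) (b + 3) (b + 4)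
    (by
      refine Fin.cases (by simp) (Fin.cases (by simp) fun i => ?_)
      have := hins i.succ; simp only [Fin.cons_succ]; omega) (by omega)
    (by
      refine Fin.cases (by simp) (Fin.cases (by simp) fun i => ?_)
      have := hins i.succ; simp only [Fin.cons_succ]; omega)
  have h0 := hins 0
  let body := q.append ((Prog.clear (b + 2)).append ((Prog.move (b + 3) (b + 2)).append
    (.inc (b + 1) .done)))
  refine ⟨p.append ((Prog.copy (ins 0) b (b + 4)).append ((Prog.loop b body .done).append
    ((Prog.clear (b + 1)).append (.move (b + 2) out)))), fun s h₀ hs => ?_⟩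
  have hins' : ∀ i : Fin n, ins i.succ < b := fun i => hins _
  let w := List.Vector.ofFn fun i : Fin n => s (ins i.succ)
  let R (l : ℕ) : ℕ := l.rec (f w) fun y IH => g (y ::ᵥ IH ::ᵥ w)
  let S (l : ℕ) : ℕ → ℕ := update (update (update s b (s (ins 0) - l)) (b + 1) l) (b + 2) (R l)
  have hloop := Ev.loop (i := b) (N := s (ins 0)) (b := body) S (by simp [S]) fun l hl => ?_
  · have e : (fun v : List.Vector ℕ (n + 1) => (v.head.rec (f v.tail) fun y IH =>
        g (y ::ᵥ IH ::ᵥ v.tail) : ℕ)) (List.Vector.ofFn fun i => s (ins i)) = R (s (ins 0)) := by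
      simp [R, w, List.Vector.ofFn]
    rw [e]
    refine (hp s (hs _ (by omega)) fun r hr => hs r (by omega)).append
      (((Ev.copy (by omega) (by omega) (by omega) ?_).of_eq ?_).append (hloop.append
        ((Ev.clear _ _).append ((Ev.move (by omega) _).of_eq ?_))))
    · simp [hs]
    · have e₀ : R 0 = f w := rfl
      change update (update s (b + 2) (f w)) b _ = S 0
      rw [← e₀]
      funext r
      grind [update_apply]
    · funext r
      grind [update_apply]
  · refine (hq _ ?_ ?_).append ((Ev.clear _ _).append ((Ev.move (by omega) _).append
      (.inc ((Ev.done _).of_eq ?_))))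
    · grind [update_apply]
    · grind [update_apply]
    · have e : (List.Vector.ofFn fun i => update (S l) b (s (ins 0) - (l + 1))
          ((Fin.cons (b + 1) (Fin.cons (b + 2) fun i => ins i.succ) : Fin (n + 2) → ℕ) i)) =
          l ::ᵥ R l ::ᵥ w := by
        simp only [List.Vector.ofFn, Fin.cons_zero, Fin.cons_succ]
        congr 1
        · simp [S]
        · congr 1
          · simp [S]
          · refine congrArg _ (funext fun i => ?_)
            have := hins' i
            grind [update_apply]
      rw [e]
      have e₁ : g (l ::ᵥ R l ::ᵥ w) = R (l + 1) := rfl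
      rw [e₁]
      have h₃ := hs (b + 3) (by omega)
      clear e e₁ hp hq
      simp only [S]
      clear_value R
      funext r
      simp only [update_apply]
      grind

theorem compiles_of_primrec' {n : ℕ} {f : List.Vector ℕ n → ℕ} (h : Nat.Primrec' f) :
    Compiles f := by
  induction h with
  | zero =>
      intro ins out b _ _ _
      exact ⟨.done, fun s h₀ _ => (Ev.done s).of_eq (update_eq_self_iff.2 h₀.symm).symm⟩
  | succ => exact .succ
  | get i => exact .get i
  | comp g _ _ hf hg => exact .comp hf hg
  | prec _ _ hf hg => exact .prec hf hg

end PiCalc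

-- Search, machines, and the reduction from the halting problem

namespace PiCalc

open Function

/-! ### Unbounded search -/

/-- The counter values `v`, `y`, `r`, followed by zeros. -/
def counters (v y r : ℕ) : ℕ → ℕ
  | 0 => v
  | 1 => y
  | 2 => r
  | _ => 0

/-- The value `F v y` is computed into counter `2`, which controls a loop that increments `y` and
computes again. Afterwards the counters `0` and `1` are cleared, so that one final configuration
serves all inputs. If `F v` has no zero, then every test finds a positive counter and
`Ev.not_of_invariant` applies. -/
theorem exists_search {F : ℕ → ℕ → ℕ} (hF : Primrec₂ F) : ∃ p : Prog, ∀ v : ℕ,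
    ((∃ y, F v y = 0) → Ev p (counters v 0 0) fun _ => 0) ∧
    ((∃ s', Ev p (counters v 0 0) s') → ∃ y, F v y = 0) := by
  obtain ⟨p, hp⟩ := compiles_of_primrec' (Nat.Primrec'.prim_iff₂.2 hF) (fun i => i) 2 3
    (fun i => by omega) (by omega) fun i => by omega
  have hp' : ∀ v y, Ev p (counters v y 0) (counters v y (F v y)) := by
    intro v y
    refine (hp (counters v y 0) rfl fun r hr => ?_).of_eq ?_
    · obtain ⟨r, rfl⟩ := Nat.exists_eq_add_of_le' hr
      rfl
    · funext r
      rcases r with _ | _ | _ | r <;> simp [counters, List.Vector.ofFn]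
  -- The test of the loop subtracts only one, so the old value has to be cleared before the next one
  -- is computed.
  let b := (Prog.clear 2).append (.inc 1 p)
  have hb : ∀ v y r, Ev b (update (counters v y r) 2 (r - 1)) (counters v (y + 1) (F v (y + 1))) := by
    intro v y r
    refine (Ev.clear _ _).append (.inc ?_)
    convert hp' v (y + 1) using 1
    funext j
    rcases j with _ | _ | _ | j <;> simp [counters]
  let q := (Prog.clear 0).append (.clear 1)
  refine ⟨p.append (.loop 2 b q), fun v => ⟨?_, ?_⟩⟩
  · rintro ⟨y, hy⟩
    have h : ∀ d l, l + d = y → Ev (.loop 2 b q) (counters v l (F v l)) fun _ => 0 := by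
      intro d
      induction d with
      | zero =>
          rintro l rfl
          refine .zero hy ((Ev.clear _ _).append ((Ev.clear _ _).of_eq ?_))
          funext j
          rw [Nat.add_zero] at hy
          rcases j with _ | _ | _ | j <;> simp [counters, hy]
      | succ d ih =>
          intro l hl
          by_cases h₀ : F v l = 0
          · refine .zero h₀ ((Ev.clear _ _).append ((Ev.clear _ _).of_eq ?_))
            funext j
            rcases j with _ | _ | _ | j <;> simp [counters, h₀]
          · exact .pos h₀ ((hb v l _).append (ih (l + 1) (by omega)))
    exact (hp' v 0).append (h y 0 (Nat.zero_add y))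
  · rintro ⟨s', h⟩
    by_contra! hn
    refine Ev.not_of_invariant (I := fun m => ∃ y, m = counters v y (F v y)) ?_ h p _ rfl (hp' v 0)
      ⟨0, rfl⟩
    rintro m ⟨y, rfl⟩
    exact ⟨hn y, _, hb v y _, _, rfl⟩

/-! ### Programs as machines -/

/-- The programs that remain to be executed in the course of `p.append q`, before `q`. -/
def Prog.labels : Prog → Prog → List Prog
  | .done, _ => []
  | .inc i p, q => .inc i (p.append q) :: p.labels q
  | .loop i b p, q => .loop i b (p.append q) ::
      (b.labels (.loop i b (p.append q)) ++ p.labels q)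

theorem Prog.append_mem_labels : ∀ p q : Prog, p.append q ∈ q :: p.labels q
  | .done, _ => List.mem_cons_self
  | .inc _ _, _ => List.mem_cons_of_mem _ List.mem_cons_self
  | .loop _ _ _, _ => List.mem_cons_of_mem _ List.mem_cons_self

theorem Prog.append_done : ∀ p : Prog, p.append .done = p
  | .done => rfl
  | .inc i p => congrArg (Prog.inc i) p.append_done
  | .loop i b p => congrArg (Prog.loop i b) p.append_done

/-- The programs that can remain after the first step. -/
def Prog.next : Prog → List Prog
  | .done => []
  | .inc _ q => [q]
  | .loop i b q => [b.append (.loop i b q), q]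

/-- Unrolling a loop puts its body in front of the loop itself, so what remains is always a part of
the source followed by the enclosing loops. These programs form a finite list closed under
execution, which can serve as the locations of a machine. -/
theorem Prog.next_mem_labels : ∀ (p q l : Prog), l ∈ p.labels q → ∀ l' ∈ l.next, l' ∈ q :: p.labels q
  | .done, q, l, h => by simp [Prog.labels] at h
  | .inc i p, q, l, h => by
      have hp := p.append_mem_labels q
      have ih := p.next_mem_labels q
      simp only [Prog.labels, List.mem_cons] at h hp ih ⊢
      rcases h with rfl | h
      · simp only [Prog.next, List.mem_singleton, forall_eq]; tauto
      · intro l' hl'; have := ih l h l' hl'; tauto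
  | .loop i b p, q, l, h => by
      have hp := p.append_mem_labels q
      have ih := p.next_mem_labels q
      have hb := b.append_mem_labels (.loop i b (p.append q))
      have ihb := b.next_mem_labels (.loop i b (p.append q))
      simp only [Prog.labels, List.mem_cons, List.mem_append] at h hp ih hb ihb ⊢
      rcases h with rfl | h | h
      · simp only [Prog.next, List.mem_cons, List.not_mem_nil, or_false, forall_eq_or_imp, forall_eq]
        tauto
      · intro l' hl'; have := ihb l h l' hl'; tauto
      · intro l' hl'; have := ih l h l' hl'; tauto

/-- The counter that a program uses first. -/
def Prog.counter : Prog → ℕ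
  | .done => 0
  | .inc i _ => i
  | .loop i _ _ => i

/-- The first instruction of a program, for a numbering of the remaining programs. -/
def Prog.instr {k n : ℕ} (idx : Prog → Fin n) : Prog → Instr (k + 1) n
  | .done => .dec 0 (idx .done) (idx .done)
  | .inc i q => .inc (Fin.ofNat (k + 1) i) (idx q)
  | .loop i b q => .dec (Fin.ofNat (k + 1) i) (idx (b.append (.loop i b q))) (idx q)

/-- Having at least two counters ensures that the parallel composition of the cells in an encoding
is a proper one, whose code has a uniform shape. The converse claims nothing about the final values:
that the program stops is enough. -/
theorem exists_machine (p : Prog) : ∃ (k n : ℕ) (M : Machine (k + 2) n) (e e' : Fin n),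
    ∀ s : ℕ → ℕ,
      (∀ s', Ev p s s' → Machine.Reach M ⟨fun j => s j, e⟩ ⟨fun j => s' j, e'⟩) ∧
      (∀ r, Machine.Reach M ⟨fun j => s j, e⟩ ⟨r, e'⟩ → ∃ s', Ev p s s') := by
  classical
  obtain ⟨L, hpL, hdL, hL⟩ : ∃ L : List Prog, p ∈ L ∧ .done ∈ L ∧
      ∀ l ∈ L, ∀ l' ∈ l.next, l' ∈ L := by
    refine ⟨.done :: p.labels .done, by simpa only [p.append_done] using p.append_mem_labels .done,
      List.mem_cons_self, fun l hl => ?_⟩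
    rcases List.mem_cons.1 hl with rfl | hl
    · simp [Prog.next]
    · exact p.next_mem_labels _ l hl
  -- A crude bound for all counters in use.
  let k := (L.map Prog.counter).sum
  have hk : ∀ l ∈ L, l.counter < k + 2 := fun l hl => by
    have : l.counter ≤ k := List.le_sum_of_mem (List.mem_map_of_mem hl)
    omega
  have hn : 0 < L.length := List.length_pos_of_mem hdL
  obtain ⟨idx, hidx⟩ : ∃ idx : Prog → Fin L.length, ∀ l ∈ L, L.get (idx l) = l := by
    refine ⟨fun l => if h : ∃ j, L.get j = l then h.choose else ⟨0, hn⟩, fun l hl => ?_⟩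
    have h : ∃ j, L.get j = l := List.mem_iff_get.1 hl
    simp only [dif_pos h]
    exact h.choose_spec
  let M : Machine (k + 2) L.length := fun m => (L.get m).instr (k := k + 1) idx
  have hM : ∀ l ∈ L, M (idx l) = l.instr (k := k + 1) idx := fun l hl => by
    simp only [M, hidx l hl]
  have hget : ∀ (s : ℕ → ℕ) (i : ℕ), i < k + 2 → s (Fin.ofNat (k + 2) i : Fin (k + 2)) = s i := by
    intro s i hi
    rw [Fin.val_ofNat, Nat.mod_eq_of_lt hi]
  have hupd : ∀ (s : ℕ → ℕ) (i : ℕ) (h : ℕ → ℕ), i < k + 2 →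
      update (fun j : Fin (k + 2) => s j) (Fin.ofNat (k + 2) i)
        (h (s (Fin.ofNat (k + 2) i : Fin (k + 2)))) =
        fun j : Fin (k + 2) => update s i (h (s i)) j := by
    intro s i h hi
    funext j
    simp only [update_apply, Fin.ext_iff, Fin.val_ofNat, Nat.mod_eq_of_lt hi]
  refine ⟨k, L.length, M, idx p, idx .done, fun s => ⟨fun s' h => ?_, fun r h => ?_⟩⟩
  · induction h with
    | done => exact .refl
    | @inc i q s s' _ ih =>
        have hq := hL _ hpL q (by simp [Prog.next])
        have hi := hk _ hpL
        refine .head ?_ (ih hq)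
        convert Machine.Step.inc ⟨fun j : Fin (k + 2) => s j, _⟩ _ _ (hM _ hpL) using 1
        exact Config.ext' (hupd s i (· + 1) hi).symm rfl
    | @zero i b q s s' h₀ _ ih =>
        have hq := hL _ hpL q (by simp [Prog.next])
        have hi := hk _ hpL
        refine .head ?_ (ih hq)
        exact Machine.Step.decZero ⟨fun j : Fin (k + 2) => s j, _⟩ _ _ _ (hM _ hpL) ((hget s i hi).trans h₀)
    | @pos i b q s s' h₀ _ ih =>
        have hq := hL _ hpL (b.append (.loop i b q)) (by simp [Prog.next])
        have hi := hk _ hpL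
        refine .head ?_ (ih hq)
        convert Machine.Step.decPos ⟨fun j : Fin (k + 2) => s j, _⟩ _ _ _ (hM _ hpL)
          (Nat.pos_of_ne_zero ((hget s i hi).trans_ne h₀)) using 1
        exact Config.ext' (hupd s i (· - 1) hi).symm rfl
  · have key : ∀ c : Config (k + 2) L.length, Machine.Reach M c ⟨r, idx .done⟩ → ∀ l ∈ L,
        L.get c.pc = l → ∀ s : ℕ → ℕ, (c.reg = fun j : Fin (k + 2) => s j) → ∃ s', Ev l s s' := by
      intro c hc
      induction hc using Relation.ReflTransGen.head_induction_on with
      | refl =>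
          intro l hl e s _
          rw [hidx _ hdL] at e
          exact ⟨s, e ▸ .done s⟩
      | @head c c' hstep _ ih =>
          intro l hl e s hs
          have hMc : M c.pc = l.instr (k := k + 1) idx := by rw [← e]
          have hnext := hL l hl
          have hi := hk l hl
          obtain ⟨reg, pc⟩ := c
          subst hs
          cases l with
          -- At this location the machine may go on decrementing counter `0`, but the program has
          -- already stopped.
          | done => exact ⟨s, .done s⟩
          | inc i q =>
              have hq := hnext q (by simp [Prog.next])
              cases hstep with
              | inc i' j h' =>
                  cases hMc.symm.trans h'
                  obtain ⟨s', h⟩ := ih q hq (hidx q hq) (update s i (s i + 1))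
                    (hupd s i (· + 1) hi)
                  exact ⟨s', .inc h⟩
              | decPos i' j₁ j₂ h' => cases hMc.symm.trans h'
              | decZero i' j₁ j₂ h' => cases hMc.symm.trans h'
          | loop i b q =>
              have hq := hnext q (by simp [Prog.next])
              have hb := hnext (b.append (.loop i b q)) (by simp [Prog.next])
              cases hstep with
              | inc i' j h' => cases hMc.symm.trans h'
              | decPos i' j₁ j₂ h' hpos =>
                  cases hMc.symm.trans h'
                  obtain ⟨s', h⟩ := ih _ hb (hidx _ hb) (update s i (s i - 1))
                    (hupd s i (· - 1) hi)
                  exact ⟨s', .pos (fun h₀ => hpos.ne' ((hget s i hi).trans h₀)) h⟩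
              | decZero i' j₁ j₂ h' hz =>
                  cases hMc.symm.trans h'
                  obtain ⟨s', h⟩ := ih q hq (hidx q hq) s rfl
                  exact ⟨s', .zero ((hget s i hi).symm.trans hz) h⟩
    exact key _ h p hpL (hidx p hpL) s rfl

/-! ## Undecidability -/

theorem primrec_code_parList_replicate (A : PiTerm) :
    Primrec fun r => (parList (List.replicate r A)).code := by
  have h : Primrec fun r : ℕ => (Nat.rec A.code (fun _ x => 4 * Nat.pair A.code x + 2) r : ℕ) :=
    Primrec.nat_rec₁ _ (Primrec.nat_add.comp (Primrec.nat_mul.comp (.const 4)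
      (Primrec₂.natPair.comp (.const _) .snd)) (.const 2)).to₂
  -- The recursion starts at one copy, since a single process is not wrapped in a parallel
  -- composition.
  refine (Primrec.nat_casesOn .id (.const 0) (h.comp .snd).to₂).of_eq fun r => ?_
  cases r with
  | zero => rfl
  | succ r =>
      induction r with
      | zero => rfl
      | succ r ih => simp only [id] at ih ⊢; rw [ih]; rfl

/-- The input occurs only in the first cell, whose code sits at a fixed place inside constants `a`
and `b`. -/
theorem primrec_code_encode {k n : ℕ} (M : Machine (k + 2) n) (e : Fin n) :
    Primrec fun v => (encode M ⟨fun j => counters v 0 0 j, e⟩).code := by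
  obtain ⟨a, b, h⟩ : ∃ a b : ℕ, ∀ v, (encode M ⟨fun j => counters v 0 0 j, e⟩).code =
      4 * Nat.pair (4 * Nat.pair (cell 0 v).code a + 2) b + 2 := by
    refine ⟨(parList (cell 1 0 :: List.ofFn fun i : Fin k => cell (i + 1 + 1) 0)).code,
      (Proc.par (parList (List.ofFn fun i : Fin (k + 2) => counter i)) (.par (outZ (nLoc e) .nil)
        (parList (List.ofFn fun m : Fin n => encInstr m (M m))))).code, fun v => ?_⟩
    have h₀ : ∀ j, counters v 0 0 (j + 1) = 0 := by rintro (_ | _ | j) <;> rfl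
    rw [encode, List.ofFn_succ, List.ofFn_succ, parList, Proc.code, Proc.code]
    simp only [Fin.val_succ, h₀]
    rfl
  have hc : Primrec fun v => (cell 0 v).code := by
    simp only [cell, Proc.code]
    exact Primrec.nat_add.comp (Primrec.nat_mul.comp (.const 4) (Primrec.nat_add.comp
      (Primrec.nat_mul.comp (.const 4) (Primrec₂.natPair.comp (.const _)
        (primrec_code_parList_replicate _))) (.const 2))) (.const 1)
  simp only [h]
  exact Primrec.nat_add.comp (Primrec.nat_mul.comp (.const 4) (Primrec₂.natPair.comp
    (Primrec.nat_add.comp (Primrec.nat_mul.comp (.const 4) (Primrec₂.natPair.comp hc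
      (.const _))) (.const 2)) (.const _))) (.const 2)

/-- The instances used are encodings of one fixed machine and one fixed target; only the first
counter of the start varies. Any class that contains all encodings is therefore too large, and what
the procedure does outside the class is irrelevant. -/
theorem not_reachabilityDecidableFor {K : PiTerm → Prop}
    (hK : ∀ (k n : ℕ) (M : Machine k n) (c : Config k n), K (encode M c)) :
    ¬ ReachabilityDecidableFor K := by
  classical
  rintro ⟨f, hf, h⟩
  -- Zero signals success, because a loop stops at zero: `F v y = 0` says that the code with number
  -- `v` yields a value on input `0` within the bound `y`.
  let F (v y : ℕ) : ℕ :=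
    bif (Nat.Partrec.Code.evaln y (Denumerable.ofNat Nat.Partrec.Code v) 0).isSome then 0 else 1
  have hF : Primrec₂ F := by
    refine Primrec.cond (Primrec.option_isSome.comp (Nat.Partrec.Code.primrec_evaln.comp
      (.pair (.pair .snd ((Primrec.ofNat _).comp .fst)) (.const 0)))) (.const 0) (.const 1)
  obtain ⟨p, hp⟩ := exists_search hF
  obtain ⟨k, n, M, e, e', hM⟩ := exists_machine p
  let P (v : ℕ) : PiTerm := encode M ⟨fun j => counters v 0 0 j, e⟩
  let Q : PiTerm := encode M ⟨fun _ => 0, e'⟩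
  have hPQ : ∀ v, Reach (P v) Q ↔ ∃ y, F v y = 0 := by
    intro v
    rw [← reach_encode_iff]
    exact ⟨fun h => (hp v).2 ((hM _).2 _ h), fun h => (hM _).1 _ ((hp v).1 h)⟩
  have hdom : ∀ c : Nat.Partrec.Code,
      (c.eval 0).Dom ↔ ∃ y, F (Encodable.encode c) y = 0 := by
    intro c
    simp only [F, Denumerable.ofNat_encode, Part.dom_iff_mem, Nat.Partrec.Code.evaln_complete]
    rw [exists_comm]
    refine exists_congr fun y => ?_
    cases Nat.Partrec.Code.evaln y c 0 <;> simp
  refine ComputablePred.halting_problem 0 ⟨Classical.decPred _, ?_⟩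
  have hcode : Computable fun c : Nat.Partrec.Code => Nat.pair (P (Encodable.encode c)).code Q.code :=
    (Primrec₂.natPair.comp ((primrec_code_encode M e).comp .encode) (.const _)).to_comp
  refine (hf.comp hcode).of_eq fun c => ?_
  rw [PFun.coe_val, Part.eq_some_iff]
  by_cases hd : (c.eval 0).Dom
  · rw [decide_eq_true hd]
    exact (h _ Q (hK _ _ M _)).1 ((hPQ _).2 ((hdom c).1 hd))
  · rw [decide_eq_false hd]
    exact (h _ Q (hK _ _ M _)).2 fun hr => hd ((hdom c).2 ((hPQ _).1 hr))

end PiCalc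

/-- The weak encoding of Minsky machines is typably hierarchical and hierarchical, and it reflects
and preserves reachability of configurations; the reachability problem is undecidable for typably
hierarchical terms and for hierarchical terms. -/
theorem mainTheorem7 :
    (∀ (k n : ℕ) (M : PiCalc.Machine k n) (c : PiCalc.Config k n),
      PiCalc.TypablyHierarchical (PiCalc.encode M c) ∧
      PiCalc.Hierarchical (PiCalc.encode M c)) ∧
    (∀ (k n : ℕ) (M : PiCalc.Machine k n) (c d : PiCalc.Config k n),
      PiCalc.Machine.Reach M c d ↔ PiCalc.Reach (PiCalc.encode M c) (PiCalc.encode M d)) ∧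
    ¬ PiCalc.ReachabilityDecidableFor PiCalc.TypablyHierarchical ∧
    ¬ PiCalc.ReachabilityDecidableFor PiCalc.Hierarchical := by
  have h : ∀ (k n : ℕ) (M : PiCalc.Machine k n) (c : PiCalc.Config k n),
      PiCalc.TypablyHierarchical (PiCalc.encode M c) ∧ PiCalc.Hierarchical (PiCalc.encode M c) :=
    fun _ _ M c => ⟨PiCalc.typablyHierarchical_encode M c, PiCalc.hierarchical_encode M c⟩
  exact ⟨h, fun _ _ M => PiCalc.reach_encode_iff M,
    PiCalc.not_reachabilityDecidableFor fun k n M c => (h k n M c).1,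
    PiCalc.not_reachabilityDecidableFor fun k n M c => (h k n M c).2⟩
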